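/- Let $(M,g)$ be a smooth pseudo-Riemannian Einstein manifold of dimension $n\ge 3$, of any signature. With $[\nabla_a,\nabla_b]v^c=R_{ab}{}^c{}_dv^d$ and $\mathrm{Ric}_{bd}=R_{ab}{}^a{}_d$, let $P_{ab}$ be the Schouten tensor, so that $\mathrm{Ric}_{ab}=(n-2)P_{ab}+Jg_{ab}$ with $J=g^{ab}P_{ab}$; Einstein means $P_{ab}=\frac{J}{n}g_{ab}$. Let $\sigma$ be the conformal density of weight $1$ with $g=\sigma^{-2}\mathbf g$, where $\mathbf g$ is the conformal metric, and trivialise all density bundles by $g$ (so $\sigma=1$). In this scale the standard tractor bundle is $E[1]\oplus T^*M[1]\oplus E[-1]$. Write $V_A=\alpha Y_A+\mu_aZ_A{}^a+\tau X_A$; the only nonzero contractions of the frame are $Y^AX_A=1$ and $Z^{Aa}Z_A{}^b=g^{ab}$, and the tractor connection, coupled with the Levi-Civita connection, is $$\nabla_a(\alpha,\mu_b,\tau)=(\nabla_a\alpha-\mu_a,\ \nabla_a\mu_b+g_{ab}\tau+P_{ab}\alpha,\ \nabla_a\tau-P_{ab}\mu^b),$$ with curvature $\Omega_{ab}{}^C{}_E$,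 $[\nabla_a,\nabla_b]V^C=\Omega_{ab}{}^C{}_EV^E$. Put $\Delta=\nabla^a\nabla_a$. On tractor fields of weight $w$ the tractor-$D$ operator is $$D_AV=(n+2w-2)wY_AV+(n+2w-2)Z_A{}^a\nabla_aV-X_A(\Delta V+wJV).$$ Put $\Omega_{BCEF}=Z_B{}^bZ_C{}^c\Omega_{bcEF}$ and $W_{BCEF}=\frac{3}{n-2}D^A\bigl(X_{[A}\Omega_{BC]EF}\bigr)$, the argument of $D^A$ having weight $-1$. Let $W\sharp\sharp$ be the operator in which the two index pairs of $W$ act successively as endomorphisms of the tractor bundle, $S\sharp$ being the derivation of the tensor algebra with $(S\sharp V)_A=-S^B{}_AV_B$. Set $\mathbb D_A=D_A-\frac1{n-4}X_AW\sharp\sharp$ if $n\ne4$ and $\mathbb D_A=D_A$ if $n=4$, and $I_A=\frac1nD_A\sigma$. The operator $I^A\mathbb D_A$ lowers weights by $1$, and $(I^A\mathbb D_A)^p$ denotes its $p$-fold iterate. Let $d$ be the exterior derivative, $(\delta f)_{a_2\cdots a_k}=-\nabla^{a_1}f_{a_1a_2\cdots a_k}$, and, for forms of the appropriate degree, $$\mathbb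 Z\mu=Z_{A_1}{}^{a_1}\cdots Z_{A_k}{}^{a_k}\mu_{a_1\cdots a_k},\quad \mathbb Y\tau=Y_{[A_1}Z_{A_2}{}^{a_2}\cdots Z_{A_k]}{}^{a_k}\tau_{a_2\cdots a_k},\quad \mathbb X\rho=X_{[A_1}Z_{A_2}{}^{a_2}\cdots Z_{A_k]}{}^{a_k}\rho_{a_2\cdots a_k},$$ where $[\cdots]$ is skew-symmetrisation with total weight one. For a $k$-form $f$ with $k\ge1$ let $Mf=\frac{n-2k}{k}\mathbb Zf+\mathbb X\,\delta f$, a tractor form of weight $-k$. For $p\ge1$ let $\mathbb L^p_kf=\sigma^{-p}(I^A\mathbb D_A)^pMf$. For an operator $E$ on forms and an integer $l$ let $P^0_l[E]=\mathrm{id}$ and $P^q_l[E]=\prod_{i=1}^q\bigl(E+\frac{2i(n-2l-i+1)}nJ\bigr)$ for $q\ge1$. **Theorem.** Let $k\ge1$ and $p\ge1$, and assume that $n\ne4$ or $k=1$. Then every smooth $k$-form $f$ satisfies, in the Einstein scale $\sigma$, $$\begin{aligned}\mathbb L_k^pf={}&-p(n-2k-2p)\,\mathbb Y\bigl[\delta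 P^{p-1}_k[d\delta]f\bigr]\\&+\tfrac1k\,\mathbb Z\bigl[(n-2k-2p)\,d\delta P^{p-1}_k[d\delta]f+(n-2k)\,\delta d\,P^{p-1}_{k+1}[\delta d]f\bigr]\\&+\mathbb X\bigl[\delta\bigl(d\delta+\tfrac{p(n-2k+2)}nJ\bigr)P^{p-1}_k[d\delta]f\bigr].\end{aligned}$$ -/

import Mathlib

open scoped Manifold ContDiff

namespace EinsteinTractor

noncomputable section

/-! ## Tensor fields with coordinate and tractor indices in a coordinate patch

Everything is written in the trivialisation of the density bundles `E[w]` that is given by the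
metric under consideration: a field of weight `w` is represented by its components in this scale,
and the weight is passed as a parameter to the operators that depend on it. -/

/-- The coordinate space. -/
abbrev Space (n : ℕ) := EuclideanSpace ℝ (Fin n)

/-- Indices of the frame `Y_A`, `Z_A^a` (`a = 1, …, n`), `X_A` of the standard tractor bundle
`E[1] ⊕ E_a[1] ⊕ E[-1]` in a scale: `V_A = α Y_A + μ_a Z_A^a + τ X_A` has components `α`
(at `inl ()`), `μ_a` (at `inr (inl a)`), `τ` (at `inr (inr ())`). -/
abbrev TIdx (n : ℕ) := Unit ⊕ Fin n ⊕ Unit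

/-- Components of a field with `s` covariant coordinate indices and `t` tractor indices. -/
abbrev TField (n s t : ℕ) := Space n → (Fin s → Fin n) → (Fin t → TIdx n) → ℝ

/-- Component functions of a `k`-form. -/
abbrev LForm (n k : ℕ) := TField n k 0

/-- Component functions of a tractor field with `t` (lowered) tractor indices. -/
abbrev Tractor (n t : ℕ) := TField n 0 t

/-- Components of a (pseudo-Riemannian) metric. -/
abbrev LMetric (n : ℕ) := Space n → Matrix (Fin n) (Fin n) ℝ

variable {n : ℕ}

/-- The partial derivative `∂_a F`. -/
def pd (a : Fin n) (F : Space n → ℝ) : Space n → ℝ :=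
  fun y => fderiv ℝ F y (EuclideanSpace.single a 1)

/-- Multiplication of a field by a function. -/
def fmul {s t : ℕ} (φ : Space n → ℝ) (V : TField n s t) : TField n s t :=
  fun y a A => φ y * V y a A

/-! ### Levi-Civita connection and curvature -/

/-- The inverse metric `g^{ab}`. -/
def ginv (g : LMetric n) (y : Space n) (a b : Fin n) : ℝ := (g y)⁻¹ a b

/-- The Christoffel symbols `Γ^c_{ab}`. -/
def christoffel (g : LMetric n) (c a b : Fin n) : Space n → ℝ := fun y =>
  (1 / 2) * ∑ d, ginv g y c d *
    (pd a (fun z => g z d b) y + pd b (fun z => g z d a) y - pd d (fun z => g z a b) y)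

/-- The curvature `R_{ab}{}^c{}_d`, with `[∇_a, ∇_b] v^c = R_{ab}{}^c{}_d v^d`. -/
def riemann (g : LMetric n) (a b c d : Fin n) : Space n → ℝ := fun y =>
  pd a (christoffel g c b d) y - pd b (christoffel g c a d) y
    + ∑ e, (christoffel g c a e y * christoffel g e b d y
      - christoffel g c b e y * christoffel g e a d y)

/-- The Ricci tensor `Ric_{bd} = R_{ab}{}^a{}_d`. -/
def ricci (g : LMetric n) (b d : Fin n) : Space n → ℝ := fun y => ∑ a, riemann g a b a d y

/-- The scalar curvature. -/
def scal (g : LMetric n) : Space n → ℝ := fun y => ∑ a, ∑ b, ginv g y a b * ricci g a b y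

/-- The Schouten tensor `P_{ab}`, so that `Ric_{ab} = (n - 2) P_{ab} + J g_{ab}`. -/
def schouten (g : LMetric n) (a b : Fin n) : Space n → ℝ := fun y =>
  (1 / ((n : ℝ) - 2)) * (ricci g a b y - scal g y / (2 * ((n : ℝ) - 1)) * g y a b)

/-- The trace `J = P^a{}_a` of the Schouten tensor. -/
def schoutenTrace (g : LMetric n) : Space n → ℝ := fun y =>
  ∑ a, ∑ b, ginv g y a b * schouten g a b y

/-! ### The tractor metric, the tractor connection and the coupled connection -/

/-- The components of `Y_A`. -/
def projY : TIdx n → ℝ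
  | .inl _ => 1
  | .inr _ => 0

/-- The components of `Z_A^a`. -/
def projZ (a : Fin n) : TIdx n → ℝ
  | .inr (.inl b) => if b = a then 1 else 0
  | _ => 0

/-- The components of `X_A`. -/
def projX : TIdx n → ℝ
  | .inr (.inr _) => 1
  | _ => 0

/-- The tractor metric `h_{AB}`. -/
def hLower (g : LMetric n) (y : Space n) (A B : TIdx n) : ℝ :=
  projX A * projY B + projY A * projX B + ∑ a, ∑ b, g y a b * projZ a A * projZ b B

/-- The inverse tractor metric `h^{AB}`, as the matrix of contractions of the frame elements:
`Y^A X_A = 1`, `Z^{Aa} Z_A^b = g^{ab}`, and all other contractions vanish. -/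
def hUpper (g : LMetric n) (y : Space n) : TIdx n → TIdx n → ℝ
  | .inl _, .inr (.inr _) => 1
  | .inr (.inr _), .inl _ => 1
  | .inr (.inl a), .inr (.inl b) => ginv g y a b
  | _, _ => 0

/-- The connection coefficients of the standard tractor bundle in the scale `g`, i.e.
`(∇_a V)_A = ∂_a V_A + ∑_B ω_{a A}{}^B V_B`, which encodes
`∇_a (α, μ_b, τ) = (∇_a α - μ_a, ∇_a μ_b + g_{ab} τ + P_{ab} α, ∇_a τ - P_a{}^b μ_b)`. -/
def tractorConn (g : LMetric n) (a : Fin n) (y : Space n) : TIdx n → TIdx n → ℝ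
  | .inl _, .inr (.inl c) => if c = a then -1 else 0
  | .inr (.inl b), .inl _ => schouten g a b y
  | .inr (.inl b), .inr (.inl c) => -christoffel g c a b y
  | .inr (.inl b), .inr (.inr _) => g y a b
  | .inr (.inr _), .inr (.inl c) => -∑ b, ginv g y b c * schouten g a b y
  | _, _ => 0

/-- The coupled Levi-Civita–tractor covariant derivative; the new index is the first one. -/
def covD (g : LMetric n) {s t : ℕ} (V : TField n s t) : TField n (s + 1) t := fun y a A =>
  pd (a 0) (fun z => V z (Fin.tail a) A) y
    - ∑ i, ∑ c, christoffel g c (a 0) (Fin.tail a i) y *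
        V y (Function.update (Fin.tail a) i c) A
    + ∑ j, ∑ B, tractorConn g (a 0) y (A j) B * V y (Fin.tail a) (Function.update A j B)

/-- The Laplacian `Δ = g^{ab} ∇_a ∇_b`. -/
def lap (g : LMetric n) {s t : ℕ} (V : TField n s t) : TField n s t := fun y a A =>
  ∑ b, ∑ c, ginv g y b c * covD g (covD g V) y (Fin.cons b (Fin.cons c a)) A

/-- The tractor curvature `Ω_{abCE}`, with `[∇_a, ∇_b] V_C = Ω_{abCE} V^E`. -/
def tractorCurv (g : LMetric n) (a b : Fin n) (y : Space n) (C E : TIdx n) : ℝ :=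
  ∑ B, (pd a (fun z => tractorConn g b z C B) y - pd b (fun z => tractorConn g a z C B) y
    + ∑ F, (tractorConn g a y C F * tractorConn g b y F B
      - tractorConn g b y C F * tractorConn g a y F B)) * hLower g y B E

/-! ### The tractor-`D` operator, the `W`-tractor and the modified operator -/

/-- The tractor-`D` operator on tractors of weight `w` (the new index is the first one):
`D_A V = (n+2w-2) w Y_A V + (n+2w-2) Z_A^a ∇_a V - X_A (Δ V + w J V)`. -/
def tractorD (g : LMetric n) (w : ℝ) {t : ℕ} (V : Tractor n t) : Tractor n (t + 1) :=
  fun y a A =>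
    ((n : ℝ) + 2 * w - 2) * w * projY (A 0) * V y a (Fin.tail A)
      + ((n : ℝ) + 2 * w - 2) * ∑ b, projZ b (A 0) * covD g V y (Fin.cons b a) (Fin.tail A)
      - projX (A 0) * (lap g V y a (Fin.tail A)
          + w * schoutenTrace g y * V y a (Fin.tail A))

/-- `Ω_{BCEF} = Z_B^b Z_C^c Ω_{bcEF}`. -/
def tractorCurv4 (g : LMetric n) (y : Space n) (B C E F : TIdx n) : ℝ :=
  ∑ b, ∑ c, projZ b B * projZ c C * tractorCurv g b c y E F

/-- `X_{[A} Ω_{BC]EF}`, of weight `-1` (`Ω_{BCEF}` being skew in `BC`). -/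
def skewXΩ (g : LMetric n) : Tractor n 5 := fun y _ A =>
  (1 / 3) * (projX (A 0) * tractorCurv4 g y (A 1) (A 2) (A 3) (A 4)
    + projX (A 1) * tractorCurv4 g y (A 2) (A 0) (A 3) (A 4)
    + projX (A 2) * tractorCurv4 g y (A 0) (A 1) (A 3) (A 4))

/-- The `W`-tractor `W_{BCEF} = 3/(n-2) D^A X_{[A} Ω_{BC]EF}`. -/
def tractorW (g : LMetric n) (y : Space n) (B C E F : TIdx n) : ℝ :=
  (3 / ((n : ℝ) - 2)) * ∑ A, ∑ A', hUpper g y A A' *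
    tractorD g (-1) (skewXΩ g) y ![] ![A, A', B, C, E, F]

/-- The natural tensorial action `S♯` of the endomorphism `S^B{}_A = h^{BC} S_{CA}`, which on
one index is `(S♯V)_A = - S^B{}_A V_B`. -/
def sharp (g : LMetric n) (y : Space n) (S : TIdx n → TIdx n → ℝ) {t : ℕ}
    (V : (Fin t → TIdx n) → ℝ) (A : Fin t → TIdx n) : ℝ :=
  -∑ j, ∑ B, (∑ C, hUpper g y B C * S C (A j)) * V (Function.update A j B)

/-- `W♯♯V`: the two index pairs of `W` act successively as endomorphisms. -/
def sharpSharpW (g : LMetric n) {t : ℕ} (V : Tractor n t) : Tractor n t := fun y a A =>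
  -∑ j, ∑ B, ∑ C, hUpper g y B C *
    sharp g y (fun E F => tractorW g y C (A j) E F) (V y a) (Function.update A j B)

/-- The modified tractor-`D` operator: `𝔻_A = D_A - 1/(n-4) X_A W♯♯` for `n ≠ 4`, and
`𝔻_A = D_A` for `n = 4`. -/
def modD (g : LMetric n) (w : ℝ) {t : ℕ} (V : Tractor n t) : Tractor n (t + 1) :=
  if n = 4 then tractorD g w V
  else fun y a A => tractorD g w V y a A
    - (1 / ((n : ℝ) - 4)) * projX (A 0) * sharpSharpW g V y a (Fin.tail A)

/-! ### The scale `σ`, the tractor `I` and the operators `I^A 𝔻_A` -/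

/-- The density `σ ∈ E[1]` that defines the scale `g`, i.e. `g = σ⁻² 𝐠` for the conformal metric
`𝐠`; in the trivialisation of `E[1]` by `g` it is the constant `1`. -/
def scaleDensity : Tractor n 0 := fun _ _ _ => 1

/-- `I_A = (1/n) D_A σ`. -/
def scaleTractor (g : LMetric n) : Tractor n 1 := fun y a A =>
  (1 / (n : ℝ)) * tractorD g 1 scaleDensity y a A

/-- `I^A 𝔻_A` on tractors of weight `w`; the result has weight `w - 1`. -/
def modBox (g : LMetric n) (w : ℝ) {t : ℕ} (V : Tractor n t) : Tractor n t := fun y a A =>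
  ∑ B, ∑ C, hUpper g y B C * scaleTractor g y a ![B] * modD g w V y a (Fin.cons C A)

/-- `(I^A 𝔻_A)^p` on tractors of weight `w`. -/
def modBoxPow (g : LMetric n) (w : ℝ) {t : ℕ} : ℕ → Tractor n t → Tractor n t
  | 0, V => V
  | p + 1, V => modBox g (w - p) (modBoxPow g w p V)

/-! ### Forms, and the injections of forms into tractor forms -/

/-- The exterior derivative, `(df)_{a_0 … a_k} = (k+1) ∂_{[a_0} f_{a_1 … a_k]}`. -/
def extD {k : ℕ} (f : LForm n k) : LForm n (k + 1) := fun y a A =>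
  ∑ i : Fin (k + 1), (-1 : ℝ) ^ (i : ℕ) * pd (a i) (fun z => f z (a ∘ i.succAbove) A) y

/-- The formal adjoint of `d`, `(δf)_{a_2 … a_k} = - ∇^{a_1} f_{a_1 a_2 … a_k}`. -/
def coD (g : LMetric n) {k : ℕ} (f : LForm n (k + 1)) : LForm n k := fun y a A =>
  -∑ b, ∑ c, ginv g y b c * covD g f y (Fin.cons b (Fin.cons c a)) A

/-- The operator `dδ` on `k`-forms, `k ≥ 1`. -/
def dδ (g : LMetric n) {k : ℕ} (f : LForm n (k + 1)) : LForm n (k + 1) := extD (coD g f)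

/-- The operator `δd` on `k`-forms. -/
def δd (g : LMetric n) {k : ℕ} (f : LForm n k) : LForm n k := coD g (extD f)

/-- Skew-symmetrisation (with weight one) over all tractor indices. -/
def skew {t : ℕ} (V : Tractor n t) : Tractor n t := fun y a A =>
  (1 / (t.factorial : ℝ)) * ∑ π : Equiv.Perm (Fin t), ((Equiv.Perm.sign π : ℤ) : ℝ) *
    V y a (A ∘ π)

/-- `Z_{A_1}^{a_1} ⋯ Z_{A_k}^{a_k} μ_{a_1 … a_k}`. -/
def injZ {k : ℕ} (μ : LForm n k) : Tractor n k := fun y _ A =>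
  ∑ a : Fin k → Fin n, (∏ i, projZ (a i) (A i)) * μ y a ![]

/-- `Y_{A_0} Z_{A_1}^{a_1} ⋯ Z_{A_k}^{a_k} τ_{a_1 … a_k}`, skewed over `A_0 … A_k`. -/
def injY {k : ℕ} (τ : LForm n k) : Tractor n (k + 1) :=
  skew fun y a A => projY (A 0) * injZ τ y a (Fin.tail A)

/-- `X_{A_0} Z_{A_1}^{a_1} ⋯ Z_{A_k}^{a_k} ρ_{a_1 … a_k}`, skewed over `A_0 … A_k`. -/
def injX {k : ℕ} (ρ : LForm n k) : Tractor n (k + 1) :=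
  skew fun y a A => projX (A 0) * injZ ρ y a (Fin.tail A)

/-- The splitting operator `M f = (n-2k)/k ℤ f + 𝕏 δf` on `k`-forms, where `k = m + 1`;
its values have weight `-k`. -/
def splitM (g : LMetric n) {m : ℕ} (f : LForm n (m + 1)) : Tractor n (m + 1) :=
  (((n : ℝ) - 2 * (m + 1)) / (m + 1)) • injZ f + injX (coD g f)

/-- `σ^{-p} (I^A 𝔻_A)^p M f` for a `k`-form `f`, where `k = m + 1`. -/
def opL (g : LMetric n) {m : ℕ} (p : ℕ) (f : LForm n (m + 1)) : Tractor n (m + 1) :=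
  fun y a A => (scaleDensity y a ![] ^ p)⁻¹ * modBoxPow g (-((m : ℝ) + 1)) p (splitM g f) y a A

/-- `P^p_κ[E] = ∏_{i=1}^p (E + 2 i (n - 2κ - i + 1)/n J)`, for an operator `E` on `j`-forms. -/
def opP (g : LMetric n) (κ : ℕ) {j : ℕ} (E : LForm n j → LForm n j) :
    ℕ → LForm n j → LForm n j
  | 0, f => f
  | i + 1, f => E (opP g κ E i f)
      + fmul (fun y => 2 * ((i : ℝ) + 1) * ((n : ℝ) - 2 * κ - (i + 1) + 1) / n *
          schoutenTrace g y) (opP g κ E i f)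

/-! ## Manifolds

The tractor and form operators above are natural local differential operators; on a manifold they
are given by these expressions in each chart of the maximal smooth atlas. -/

variable (n) (M : Type*) [TopologicalSpace M] [ChartedSpace (EuclideanSpace ℝ (Fin n)) M]

/-- The coordinate vector field `∂/∂y^a` of the chart `e`, at the point with coordinates `y`. -/
def coordVec {n : ℕ} {M : Type*} [TopologicalSpace M]
    [ChartedSpace (EuclideanSpace ℝ (Fin n)) M]
    (e : OpenPartialHomeomorph M (EuclideanSpace ℝ (Fin n))) (y : EuclideanSpace ℝ (Fin n))
    (a : Fin n) : TangentSpace (𝓡 n) (e.symm y) :=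
  mfderiv (𝓡 n) (𝓡 n) e.symm y (EuclideanSpace.single a (1 : ℝ))

/-- Smooth pseudo-Riemannian metrics, of any signature. -/
structure PseudoMetric where
  /-- the bilinear form on each tangent space -/
  val : ∀ x : M, TangentSpace (𝓡 n) x →ₗ[ℝ] TangentSpace (𝓡 n) x →ₗ[ℝ] ℝ
  symm : ∀ x u v, val x u v = val x v u
  nondegenerate : ∀ x u, (∀ v, val x u v = 0) → u = 0
  smooth : ∀ e ∈ IsManifold.maximalAtlas (𝓡 n) ∞ M, ∀ a b,
    ContDiffOn ℝ ∞ (fun y => val (e.symm y) (coordVec e y a) (coordVec e y b)) e.target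

/-- Smooth differential `k`-forms. -/
structure DiffForm (k : ℕ) where
  /-- the alternating form on each tangent space -/
  val : ∀ x : M, TangentSpace (𝓡 n) x [⋀^Fin k]→ₗ[ℝ] ℝ
  smooth : ∀ e ∈ IsManifold.maximalAtlas (𝓡 n) ∞ M, ∀ a : Fin k → Fin n,
    ContDiffOn ℝ ∞ (fun y => val (e.symm y) fun i => coordVec e y (a i)) e.target

variable {n M}

/-- The components `g_{ab}` of a metric in a chart. -/
def PseudoMetric.inChart (g : PseudoMetric n M)
    (e : OpenPartialHomeomorph M (EuclideanSpace ℝ (Fin n))) : LMetric n :=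
  fun y => Matrix.of fun a b => g.val (e.symm y) (coordVec e y a) (coordVec e y b)

/-- The components `f_{a_1 … a_k}` of a `k`-form in a chart. -/
def DiffForm.inChart {k : ℕ} (f : DiffForm n M k)
    (e : OpenPartialHomeomorph M (EuclideanSpace ℝ (Fin n))) : LForm n k :=
  fun y a _ => f.val (e.symm y) fun i => coordVec e y (a i)

/-- `g` is Einstein: the trace-free part of the Schouten tensor vanishes, `P_{ab} = (J/n) g_{ab}`
(equivalently, the Ricci tensor is pointwise proportional to `g`). -/
def PseudoMetric.IsEinstein (g : PseudoMetric n M) : Prop :=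
  ∀ e ∈ IsManifold.maximalAtlas (𝓡 n) ∞ M, ∀ y ∈ e.target, ∀ a b,
    schouten (g.inChart e) a b y
      = schoutenTrace (g.inChart e) y / (n : ℝ) * g.inChart e y a b

end

end EinsteinTractor

open EinsteinTractor

namespace EinsteinTractor

noncomputable section

/-! ## Metrics over a commutative algebra with commuting derivations -/

/-! Put `p = J/n`. On an Einstein manifold of dimension at least three, `p` is constant (Schur), the
tractor curvature consists of the Weyl curvature alone, and `I = Y - p X`. Hence on weight `w` the
operator `I^A D_A` is `-Δ - 2pw(n+w-1)`, with `Δ` the tractor Laplacian. The `W`-tractor is `(n-4)`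
times the Weyl curvature, so the term `-1/(n-4) X W♯♯` subtracts a curvature operator `weyl` whose
coefficient does not depend on `n-4`. In dimension four nothing is subtracted by definition; this is
harmless on one-index tractors because `weyl` vanishes there (`RepT.modBox`, `weyl_one`).

Tractor forms are treated as a Fock space: `c` and `b` are exterior multiplication and insertion for
the frame, and `N` counts the `Z`-indices. With `θ = cY + p cX` and `β = p bY + bX`, the tractor
derivative is the Levi-Civita derivative plus `cl_a β - θ bZ_a`, which gives the tractor Laplacian
as the rough Laplacian plus `2(θδ - βd) - (n-N)θβ - Nβθ` (`lapT_eq`). The Weitzenböck formula gives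
`weyl = -(rough Laplacian) - (dδ+δd) + 2pN(n-N)` (`weyl_eq`). In the combination defining `I^A 𝔻_A`
the rough Laplacian cancels, and `dδ + δd - 2pN(n-N) - 2pw(n+w-1) - 2(θδ - βd) + (n-N)θβ + Nβθ`
remains (`box_eq`). No curvature is left except the constant `p`. On the slots `Y`, `Z`, `X` this
operator is a matrix of polynomials in `d` and `δ` (`box_mid`, `box_top`, `box_bot`), and `d² = δ² =
0` turns its powers into the stated products by induction (`boxPow_split`).

All of this is proved over an abstract commutative algebra with commuting derivations, on covariant
tensors of all degrees at once, so that operators which change the degree form a ring. The analytic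
statement follows by taking the functions smooth on a chart domain as the algebra and evaluating at
points. The skew-symmetrised injections carry a factor `1/k` relative to the Fock space operators;
the algebraic formula is `k` times the one for `M f`. -/

/-- A metric with entries in a commutative algebra `R` with `n` commuting derivations. -/
structure AlgMetric (n : ℕ) (R : Type*) [CommRing R] [Algebra ℝ R] where
  /-- the coordinate derivations -/
  der : Fin n → Derivation ℝ R R
  der_comm : ∀ a b x, der a (der b x) = der b (der a x)
  /-- the metric -/
  g : Fin n → Fin n → R
  /-- the inverse metric -/
  gi : Fin n → Fin n → R
  g_symm : ∀ a b, g a b = g b a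
  gi_symm : ∀ a b, gi a b = gi b a
  gi_g : ∀ a c, ∑ b, gi a b * g b c = if a = c then 1 else 0

namespace AlgMetric

variable {n : ℕ} {R : Type*} [CommRing R] [Algebra ℝ R] (𝒢 : AlgMetric n R)

/-- Twice this element is one. -/
def half (R : Type*) [CommRing R] [Algebra ℝ R] : R := algebraMap ℝ R (1 / 2)

lemma two_half : (2 : R) * half R = 1 := by
  have : (2 : R) = algebraMap ℝ R 2 := (map_ofNat _ 2).symm
  rw [half, this, ← map_mul]; norm_num

lemma half_add_half : half R + half R = 1 := by rw [← two_half (R := R)]; ring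

lemma der_half (a : Fin n) : 𝒢.der a (half R) = 0 := (𝒢.der a).map_algebraMap _

/-- Christoffel symbols of the first kind. -/
def chl (e a b : Fin n) : R :=
  half R * (𝒢.der a (𝒢.g e b) + 𝒢.der b (𝒢.g e a) - 𝒢.der e (𝒢.g a b))

/-- Christoffel symbols `Γ^c_{ab}`. -/
def chr (c a b : Fin n) : R := ∑ d, 𝒢.gi c d * 𝒢.chl d a b

lemma g_gi (a c : Fin n) : ∑ b, 𝒢.g a b * 𝒢.gi b c = if a = c then 1 else 0 := by
  have h := 𝒢.gi_g c a
  simp_rw [eq_comm (a := c)] at h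
  rw [← h]
  exact Finset.sum_congr rfl fun b _ => by rw [𝒢.g_symm, 𝒢.gi_symm, mul_comm]

lemma sum_g_gi_mul (e : Fin n) (x : Fin n → R) :
    ∑ c, 𝒢.g e c * ∑ d, 𝒢.gi c d * x d = x e := by
  simp_rw [Finset.mul_sum]
  rw [Finset.sum_comm]
  simp_rw [← mul_assoc, ← Finset.sum_mul, 𝒢.g_gi]
  simp

lemma sum_gi_g_mul (e : Fin n) (x : Fin n → R) :
    ∑ c, 𝒢.gi e c * ∑ d, 𝒢.g c d * x d = x e := by
  simp_rw [Finset.mul_sum]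
  rw [Finset.sum_comm]
  simp_rw [← mul_assoc, ← Finset.sum_mul, 𝒢.gi_g]
  simp

lemma chl_symm (e a b : Fin n) : 𝒢.chl e a b = 𝒢.chl e b a := by
  simp only [chl, 𝒢.g_symm a b]; ring

lemma chr_symm (e a b : Fin n) : 𝒢.chr e a b = 𝒢.chr e b a := by
  simp only [chr, 𝒢.chl_symm _ a b]

lemma g_chr (e a b : Fin n) : ∑ c, 𝒢.g e c * 𝒢.chr c a b = 𝒢.chl e a b :=
  𝒢.sum_g_gi_mul e fun d => 𝒢.chl d a b

lemma der_g (a b c : Fin n) : 𝒢.der a (𝒢.g b c) = 𝒢.chl b a c + 𝒢.chl c a b := by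
  have h := half_add_half (R := R)
  simp only [chl, 𝒢.g_symm c b, 𝒢.g_symm b a, 𝒢.g_symm c a]
  linear_combination (-𝒢.der a (𝒢.g b c)) * h

lemma der_g' (a b c : Fin n) : 𝒢.der a (𝒢.g b c)
    = ∑ f, 𝒢.chr f a b * 𝒢.g f c + ∑ f, 𝒢.chr f a c * 𝒢.g b f := by
  rw [der_g, ← g_chr, ← g_chr, add_comm]
  congr 1 <;> exact Finset.sum_congr rfl fun f _ => by simp only [𝒢.g_symm c f, mul_comm]

/-- Differentiating `g g⁻¹ = 1` determines the derivative of the inverse metric; metric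
compatibility `der_g'` rewrites it by Christoffel symbols. -/
lemma der_gi (a b c : Fin n) : 𝒢.der a (𝒢.gi b c)
    = -∑ f, 𝒢.chr b a f * 𝒢.gi f c - ∑ f, 𝒢.chr c a f * 𝒢.gi b f := by
  have key : ∀ e, ∑ c, 𝒢.g e c * 𝒢.der a (𝒢.gi c b)
      = -∑ f, 𝒢.chr f a e * (if f = b then 1 else 0) - ∑ f, 𝒢.chl e a f * 𝒢.gi f b := by
    intro e
    have h := congrArg (𝒢.der a) (𝒢.g_gi e b)
    have h0 : 𝒢.der a (if e = b then (1 : R) else 0) = 0 := by split_ifs <;> simp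
    rw [h0, map_sum] at h
    simp only [Derivation.leibniz, smul_eq_mul, Finset.sum_add_distrib] at h
    rw [eq_neg_of_add_eq_zero_left h]
    simp_rw [𝒢.der_g', mul_add, Finset.sum_add_distrib, Finset.mul_sum]
    rw [neg_add, sub_eq_add_neg]
    congr 2
    · rw [Finset.sum_comm]
      refine Finset.sum_congr rfl fun f _ => ?_
      rw [← 𝒢.g_gi f b, Finset.mul_sum]
      exact Finset.sum_congr rfl fun _ _ => by ring
    · refine Finset.sum_congr rfl fun f _ => ?_
      rw [← 𝒢.g_chr, Finset.sum_mul]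
      exact Finset.sum_congr rfl fun _ _ => by ring
  have h2 := 𝒢.sum_gi_g_mul c fun d => 𝒢.der a (𝒢.gi d b)
  simp only [key] at h2
  rw [𝒢.gi_symm b c, ← h2]
  simp only [mul_sub, Finset.sum_sub_distrib, mul_ite, mul_one, mul_zero, Finset.sum_ite_eq',
    Finset.mem_univ, if_true]
  congr 1
  · rw [← Finset.sum_neg_distrib]
    exact Finset.sum_congr rfl fun f _ => by rw [𝒢.gi_symm f c]; ring
  · simp_rw [Finset.mul_sum]
    rw [Finset.sum_comm]
    refine Finset.sum_congr rfl fun f _ => ?_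
    rw [chr, Finset.sum_mul]
    exact Finset.sum_congr rfl fun d _ => by rw [𝒢.gi_symm b f]; ring

/-! ### Curvature and its algebraic symmetries -/

/-- The curvature `R_{ab}{}^c{}_d`. -/
def riem (a b c d : Fin n) : R :=
  𝒢.der a (𝒢.chr c b d) - 𝒢.der b (𝒢.chr c a d)
    + ∑ e, (𝒢.chr c a e * 𝒢.chr e b d - 𝒢.chr c b e * 𝒢.chr e a d)

/-- The curvature `R_{abcd}`. -/
def riemL (a b c d : Fin n) : R := ∑ e, 𝒢.g c e * 𝒢.riem a b e d

/-- The Ricci tensor `R_{ab}{}^a{}_d`. -/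
def ric (b d : Fin n) : R := ∑ a, 𝒢.riem a b a d

lemma riem_eq (a b c d : Fin n) : 𝒢.riem a b c d = ∑ e, 𝒢.gi c e * 𝒢.riemL a b e d :=
  (𝒢.sum_gi_g_mul c fun e => 𝒢.riem a b e d).symm

/-- The contraction `g^{ef} Γ_{e ab} Γ_{f cd}`. -/
def chlProd (a b c d : Fin n) : R := ∑ e, 𝒢.chl e a b * 𝒢.chr e c d

lemma chlProd_swap (a b c d : Fin n) : 𝒢.chlProd a b c d = 𝒢.chlProd c d a b := by
  simp only [chlProd, chr, Finset.mul_sum]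
  rw [Finset.sum_comm]
  exact Finset.sum_congr rfl fun e _ => Finset.sum_congr rfl fun f _ => by
    rw [𝒢.gi_symm e f]; ring

lemma chlProd_symm_left (a b c d : Fin n) : 𝒢.chlProd a b c d = 𝒢.chlProd b a c d := by
  simp only [chlProd, 𝒢.chl_symm _ a b]

lemma chlProd_symm_right (a b c d : Fin n) : 𝒢.chlProd a b c d = 𝒢.chlProd a b d c := by
  simp only [chlProd, 𝒢.chr_symm _ c d]

lemma g_der_chr (a b c d : Fin n) :
    ∑ e, 𝒢.g c e * 𝒢.der a (𝒢.chr e b d)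
      = 𝒢.der a (𝒢.chl c b d) - ∑ e, 𝒢.chl c a e * 𝒢.chr e b d - 𝒢.chlProd a c b d := by
  rw [← g_chr 𝒢 c b d, map_sum]
  simp only [Derivation.leibniz, smul_eq_mul, Finset.sum_add_distrib, der_g, mul_add, chlProd]
  simp only [mul_comm (𝒢.chr _ b d), 𝒢.chl_symm _ a c]
  ring

lemma riemL_eq (a b c d : Fin n) : 𝒢.riemL a b c d
    = 𝒢.der a (𝒢.chl c b d) - 𝒢.der b (𝒢.chl c a d)
      - 𝒢.chlProd a c b d + 𝒢.chlProd b c a d := by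
  have h : ∀ a b, ∑ e, 𝒢.g c e * ∑ f, 𝒢.chr e a f * 𝒢.chr f b d
      = ∑ e, 𝒢.chl c a e * 𝒢.chr e b d := by
    intro a b
    simp_rw [Finset.mul_sum]
    rw [Finset.sum_comm]
    exact Finset.sum_congr rfl fun f _ => by
      rw [← g_chr, Finset.sum_mul]; exact Finset.sum_congr rfl fun _ _ => by ring
  simp only [riemL, riem, mul_add, mul_sub, Finset.sum_add_distrib, Finset.sum_sub_distrib,
    g_der_chr, h]
  ring

/-- The second derivatives of the metric and the two quadratic terms are separated here. Both
skew-symmetry in the last pair and pair symmetry then follow from symmetries of `g` and `chlProd`,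
with commuting derivations where needed. -/
lemma riemL_eq_der (a b c d : Fin n) : 𝒢.riemL a b c d
    = half R * (𝒢.der a (𝒢.der d (𝒢.g c b)) - 𝒢.der a (𝒢.der c (𝒢.g b d))
        - 𝒢.der b (𝒢.der d (𝒢.g c a)) + 𝒢.der b (𝒢.der c (𝒢.g a d)))
      - 𝒢.chlProd a c b d + 𝒢.chlProd b c a d := by
  rw [riemL_eq]
  simp only [chl, Derivation.leibniz, smul_eq_mul, der_half, map_add, map_sub, 𝒢.der_comm b a]
  ring

lemma riem_antisymm (a b c d : Fin n) : 𝒢.riem a b c d = -𝒢.riem b a c d := by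
  simp only [riem, Finset.sum_sub_distrib]; ring

lemma riemL_antisymm (a b c d : Fin n) : 𝒢.riemL a b c d = -𝒢.riemL b a c d := by
  simp only [riemL, 𝒢.riem_antisymm a b, mul_neg, Finset.sum_neg_distrib]

lemma riemL_antisymm' (a b c d : Fin n) : 𝒢.riemL a b c d = -𝒢.riemL a b d c := by
  rw [riemL_eq_der, riemL_eq_der, 𝒢.chlProd_swap b d, 𝒢.chlProd_swap a d]
  simp only [𝒢.g_symm c b, 𝒢.g_symm b d, 𝒢.g_symm c a, 𝒢.g_symm a d]
  ring

lemma riemL_pair (a b c d : Fin n) : 𝒢.riemL a b c d = 𝒢.riemL c d a b := by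
  rw [riemL_eq_der, riemL_eq_der, 𝒢.chlProd_swap c a, 𝒢.chlProd_swap d a c b,
    𝒢.chlProd_symm_left c b, 𝒢.chlProd_symm_right b c d a, 𝒢.chlProd_symm_right a c,
    𝒢.chlProd_symm_left a c, 𝒢.chlProd_swap c a d b, 𝒢.chlProd_symm_left d b,
    𝒢.chlProd_swap b d c a]
  simp only [𝒢.der_comm c b, 𝒢.der_comm c a, 𝒢.der_comm d b, 𝒢.der_comm d a,
    𝒢.g_symm a d, 𝒢.g_symm d b, 𝒢.g_symm a c, 𝒢.g_symm c b]
  ring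

lemma riem_bianchi (a b c d : Fin n) :
    𝒢.riem a b d c + 𝒢.riem b c d a + 𝒢.riem c a d b = 0 := by
  simp only [riem, Finset.sum_sub_distrib, 𝒢.chr_symm _ c a, 𝒢.chr_symm _ c b, 𝒢.chr_symm _ b a]
  ring

/-! ### Covariant derivative of the curvature and the second Bianchi identity -/

/-- The covariant derivative `∇_a S_{bcde}`. -/
def cov4 (S : Fin n → Fin n → Fin n → Fin n → R) (a b c d e : Fin n) : R :=
  𝒢.der a (S b c d e) - ∑ f, 𝒢.chr f a b * S f c d e - ∑ f, 𝒢.chr f a c * S b f d e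
    - ∑ f, 𝒢.chr f a d * S b c f e - ∑ f, 𝒢.chr f a e * S b c d f

/-- This is the Jacobi identity for the operators `D_a + Γ_a`, whose commutators are the curvature
matrices, verified in the noncommutative ring of matrices. The Christoffel terms on the two form
indices are absent here. -/
lemma matrix_bianchi (a b c d e : Fin n) :
    (𝒢.der a (𝒢.riem b c d e) + ∑ f, (𝒢.chr d a f * 𝒢.riem b c f e - 𝒢.riem b c d f * 𝒢.chr f a e))
    + (𝒢.der b (𝒢.riem c a d e)
      + ∑ f, (𝒢.chr d b f * 𝒢.riem c a f e - 𝒢.riem c a d f * 𝒢.chr f b e))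
    + (𝒢.der c (𝒢.riem a b d e)
      + ∑ f, (𝒢.chr d c f * 𝒢.riem a b f e - 𝒢.riem a b d f * 𝒢.chr f c e)) = 0 := by
  let Γ : Fin n → Matrix (Fin n) (Fin n) R := fun a => Matrix.of fun d e => 𝒢.chr d a e
  let D : Fin n → Matrix (Fin n) (Fin n) R → Matrix (Fin n) (Fin n) R :=
    fun a X => X.map (𝒢.der a)
  have Dadd : ∀ a X Y, D a (X + Y) = D a X + D a Y := fun a X Y => by ext; simp [D]
  have Dsub : ∀ a X Y, D a (X - Y) = D a X - D a Y := fun a X Y => by ext; simp [D]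
  have Dmul : ∀ a X Y, D a (X * Y) = D a X * Y + X * D a Y := fun a X Y => by
    ext i j
    simp only [D, Matrix.map_apply, Matrix.mul_apply, map_sum, Derivation.leibniz, smul_eq_mul,
      Matrix.add_apply, Finset.sum_add_distrib]
    rw [add_comm]
    simp only [mul_comm]
  have Dcomm : ∀ a b X, D a (D b X) = D b (D a X) := fun a b X => by
    ext i j; exact 𝒢.der_comm a b _
  have hR : ∀ a b, (Matrix.of fun d e => 𝒢.riem a b d e)
      = D a (Γ b) - D b (Γ a) + (Γ a * Γ b - Γ b * Γ a) := fun a b => by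
    ext d e
    simp [riem, D, Γ, Matrix.mul_apply, Finset.sum_sub_distrib]
  have hM : ∀ a b c, (Matrix.of fun d e => 𝒢.der a (𝒢.riem b c d e)
      + ∑ f, (𝒢.chr d a f * 𝒢.riem b c f e - 𝒢.riem b c d f * 𝒢.chr f a e))
      = D a (Matrix.of fun d e => 𝒢.riem b c d e)
        + (Γ a * (Matrix.of fun d e => 𝒢.riem b c d e)
          - (Matrix.of fun d e => 𝒢.riem b c d e) * Γ a) := fun a b c => by
    ext d e
    simp [D, Γ, Matrix.mul_apply, Finset.sum_sub_distrib]
  have h := (congrArg₂ (· + ·) (congrArg₂ (· + ·) (hM a b c) (hM b c a)) (hM c a b)).trans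
    (show _ = (0 : Matrix (Fin n) (Fin n) R) by
      rw [hR, hR, hR]
      simp only [Dadd, Dsub, Dmul, Dcomm b a, Dcomm c a, Dcomm c b]
      noncomm_ring)
  exact congrFun (congrFun h d) e

/-- Lowering the third index commutes with covariant differentiation: the derivative of `g` supplies
exactly the Christoffel term on that index. The remaining bracket is the summand of `matrix_bianchi`
corrected on the form indices. -/
lemma cov4_riemL (a b c d e : Fin n) : 𝒢.cov4 𝒢.riemL a b c d e
    = ∑ h, 𝒢.g d h * ((𝒢.der a (𝒢.riem b c h e)
        + ∑ f, (𝒢.chr h a f * 𝒢.riem b c f e - 𝒢.riem b c h f * 𝒢.chr f a e))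
        - ∑ f, 𝒢.chr f a b * 𝒢.riem f c h e - ∑ f, 𝒢.chr f a c * 𝒢.riem b f h e) := by
  have e1 : ∀ (x : Fin n → R) (y : Fin n → Fin n → R), ∑ h, 𝒢.g d h * ∑ f, x f * y f h
      = ∑ f, x f * ∑ h, 𝒢.g d h * y f h := fun x y => by
    simp_rw [Finset.mul_sum]
    rw [Finset.sum_comm]
    exact Finset.sum_congr rfl fun f _ => Finset.sum_congr rfl fun _ _ => by ring
  have e2 : ∑ h, 𝒢.g d h * ∑ f, 𝒢.chr h a f * 𝒢.riem b c f e
      = ∑ f, 𝒢.chl d a f * 𝒢.riem b c f e := by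
    simp_rw [Finset.mul_sum]
    rw [Finset.sum_comm]
    exact Finset.sum_congr rfl fun f _ => by
      rw [← g_chr, Finset.sum_mul]; exact Finset.sum_congr rfl fun _ _ => by ring
  have e3 : ∑ f, 𝒢.chr f a d * ∑ h, 𝒢.g f h * 𝒢.riem b c h e
      = ∑ h, 𝒢.chl h a d * 𝒢.riem b c h e := by
    simp_rw [Finset.mul_sum]
    rw [Finset.sum_comm]
    exact Finset.sum_congr rfl fun f _ => by
      rw [← g_chr, Finset.sum_mul]
      exact Finset.sum_congr rfl fun h _ => by rw [𝒢.g_symm h f]; ring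
  have e4 : ∑ h, 𝒢.g d h * ∑ f, 𝒢.riem b c h f * 𝒢.chr f a e
      = ∑ f, 𝒢.chr f a e * ∑ h, 𝒢.g d h * 𝒢.riem b c h f := by
    rw [← e1]; simp only [mul_comm]
  simp only [cov4, riemL, mul_sub, mul_add, Finset.sum_sub_distrib, Finset.sum_add_distrib, e1, e2,
    e3, e4, map_sum, Derivation.leibniz, smul_eq_mul, der_g, 𝒢.chl_symm _ a d]
  simp only [mul_comm (𝒢.riem b c _ e)]
  simp only [𝒢.chl_symm d a]
  ring

/-- The second Bianchi identity. -/
lemma cov4_bianchi (a b c d e : Fin n) : 𝒢.cov4 𝒢.riemL a b c d e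
    + 𝒢.cov4 𝒢.riemL b c a d e + 𝒢.cov4 𝒢.riemL c a b d e = 0 := by
  simp only [cov4_riemL, ← Finset.sum_add_distrib, ← mul_add]
  refine Finset.sum_eq_zero fun h _ => ?_
  have h1 := 𝒢.matrix_bianchi a b c h e
  -- The corrections on the form indices cancel in pairs over the cyclic sum, because the
  -- Christoffel symbols are symmetric and the curvature is skew in its first pair.
  have anti : ∀ x y z, ∑ f, 𝒢.chr f x y * 𝒢.riem z f h e
      = -∑ f, 𝒢.chr f y x * 𝒢.riem f z h e := fun x y z => by
    rw [← Finset.sum_neg_distrib]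
    exact Finset.sum_congr rfl fun f _ => by rw [𝒢.riem_antisymm z f, 𝒢.chr_symm f x y]; ring
  rw [anti a c b, anti b a c, anti c b a]
  linear_combination 𝒢.g d h * h1

/-- Contraction with the parallel inverse metric commutes with covariant differentiation: the
Christoffel terms on the contracted indices are those of `der_gi`. -/
lemma cov4_trace (S : Fin n → Fin n → Fin n → Fin n → R) (s : Fin n → Fin n → R)
    (hS : ∀ c e, ∑ b, ∑ d, 𝒢.gi b d * S b c d e = s c e) (a c e : Fin n) :
    ∑ b, ∑ d, 𝒢.gi b d * 𝒢.cov4 S a b c d e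
      = 𝒢.der a (s c e) - ∑ f, 𝒢.chr f a c * s f e - ∑ f, 𝒢.chr f a e * s c f := by
  have e1 : ∀ (x : Fin n → R) (y : Fin n → Fin n → Fin n → R),
      ∑ b, ∑ d, 𝒢.gi b d * ∑ f, x f * y f b d
        = ∑ f, x f * ∑ b, ∑ d, 𝒢.gi b d * y f b d := fun x y => by
    simp_rw [Finset.mul_sum]
    rw [Finset.sum_comm_cycle]
    refine Finset.sum_congr rfl fun f _ => Finset.sum_congr rfl fun b _ =>
      Finset.sum_congr rfl fun d _ => by ring
  have e2 : ∑ b, ∑ d, 𝒢.gi b d * ∑ f, 𝒢.chr f a b * S f c d e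
      = ∑ b, ∑ d, (∑ f, 𝒢.chr b a f * 𝒢.gi f d) * S b c d e := by
    simp_rw [Finset.mul_sum, Finset.sum_mul]
    rw [Finset.sum_comm_cycle]
    refine Finset.sum_congr rfl fun b _ => ?_
    rw [Finset.sum_comm]
    exact Finset.sum_congr rfl fun f _ => Finset.sum_congr rfl fun d _ => by ring
  have e3 : ∑ b, ∑ d, 𝒢.gi b d * ∑ f, 𝒢.chr f a d * S b c f e
      = ∑ b, ∑ d, (∑ f, 𝒢.chr d a f * 𝒢.gi b f) * S b c d e := by
    refine Finset.sum_congr rfl fun b _ => ?_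
    simp_rw [Finset.mul_sum, Finset.sum_mul]
    rw [Finset.sum_comm]
    exact Finset.sum_congr rfl fun f _ => Finset.sum_congr rfl fun d _ => by ring
  simp only [cov4, mul_sub, Finset.sum_sub_distrib, e1, e2, e3, hS]
  rw [← hS c e, map_sum]
  simp only [map_sum, Derivation.leibniz, smul_eq_mul, der_gi, Finset.sum_add_distrib,
    mul_comm (S _ c _ e), sub_mul, neg_mul, Finset.sum_sub_distrib, Finset.sum_neg_distrib]
  ring

/-! ### Einstein metrics -/

lemma trace_riemL (c e : Fin n) : ∑ b, ∑ d, 𝒢.gi b d * 𝒢.riemL b c d e = 𝒢.ric c e :=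
  Finset.sum_congr rfl fun b _ => 𝒢.sum_gi_g_mul b fun f => 𝒢.riem b c f e

lemma trace_g : ∑ a, ∑ b, 𝒢.gi a b * 𝒢.g a b = (n : R) := by
  have : ∀ a, ∑ b, 𝒢.gi a b * 𝒢.g a b = 1 := fun a => by
    simpa [𝒢.g_symm a] using 𝒢.gi_g a a
  simp [this]

lemma cov4_antisymm (a b c d e : Fin n) :
    𝒢.cov4 𝒢.riemL a b c d e = -𝒢.cov4 𝒢.riemL a c b d e := by
  simp only [cov4]
  simp only [fun x d e => 𝒢.riemL_antisymm b x d e, fun x d e => 𝒢.riemL_antisymm x c d e, map_neg,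
    mul_neg, Finset.sum_neg_distrib]
  ring

lemma cov4_antisymm' (a b c d e : Fin n) :
    𝒢.cov4 𝒢.riemL a b c d e = -𝒢.cov4 𝒢.riemL a b c e d := by
  simp only [cov4]
  simp only [fun b c x => 𝒢.riemL_antisymm' b c d x, fun b c x => 𝒢.riemL_antisymm' b c x e,
    map_neg, mul_neg, Finset.sum_neg_distrib]
  ring

lemma cov4_pair (a b c d e : Fin n) :
    𝒢.cov4 𝒢.riemL a b c d e = 𝒢.cov4 𝒢.riemL a d e b c := by
  simp only [cov4]
  simp only [fun x => 𝒢.riemL_pair x c d e, fun x => 𝒢.riemL_pair b x d e,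
    fun x => 𝒢.riemL_pair b c x e, fun x => 𝒢.riemL_pair b c d x]
  ring

/-- The Ricci tensor equals `2 (n - 1) p g`. -/
def IsEinsteinWith (p : R) : Prop :=
  ∀ b d, 𝒢.ric b d = 2 * ((n : R) - 1) * p * 𝒢.g b d

variable {𝒢} {p : R}

lemma IsEinsteinWith.trace_cov4 (hE : 𝒢.IsEinsteinWith p) (a c e : Fin n) :
    ∑ b, ∑ d, 𝒢.gi b d * 𝒢.cov4 𝒢.riemL a b c d e
      = 2 * ((n : R) - 1) * 𝒢.der a p * 𝒢.g c e := by
  rw [𝒢.cov4_trace _ _ 𝒢.trace_riemL]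
  have h1 : 𝒢.der a (2 * ((n : R) - 1)) = 0 := by
    have : (2 * ((n : R) - 1)) = algebraMap ℝ R (2 * (n - 1)) := by
      simp only [map_mul, map_sub, map_natCast, map_one, map_ofNat]
    rw [this, Derivation.map_algebraMap]
  have h2 : ∀ c e, ∑ f, 𝒢.chr f a c * (2 * ((n : R) - 1) * p * 𝒢.g f e)
      = 2 * ((n : R) - 1) * p * ∑ f, 𝒢.chr f a c * 𝒢.g f e := fun c e => by
    rw [Finset.mul_sum]; exact Finset.sum_congr rfl fun _ _ => by ring
  have h3 : ∀ c e, ∑ f, 𝒢.chr f a c * (2 * ((n : R) - 1) * p * 𝒢.g e f)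
      = 2 * ((n : R) - 1) * p * ∑ f, 𝒢.chr f a c * 𝒢.g e f := fun c e => by
    rw [Finset.mul_sum]; exact Finset.sum_congr rfl fun _ _ => by ring
  simp only [hE c, hE _ e, h2, h3]
  simp only [Derivation.leibniz, smul_eq_mul, 𝒢.der_g', h1]
  ring

/-- Contracting the second Bianchi identity expresses the divergence by derivatives of the Ricci
tensor, and for an Einstein metric those are derivatives of `p`. -/
lemma IsEinsteinWith.div_cov4 (hE : 𝒢.IsEinsteinWith p) (b c e : Fin n) :
    ∑ a, ∑ d, 𝒢.gi a d * 𝒢.cov4 𝒢.riemL a b c d e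
      = 2 * ((n : R) - 1) * (𝒢.der b p * 𝒢.g c e - 𝒢.der c p * 𝒢.g b e) := by
  have h : ∑ a, ∑ d, 𝒢.gi a d * (𝒢.cov4 𝒢.riemL a b c d e
    + 𝒢.cov4 𝒢.riemL b c a d e + 𝒢.cov4 𝒢.riemL c a b d e) = 0 := by
    simp [cov4_bianchi]
  simp only [fun a d => 𝒢.cov4_antisymm b c a d e, mul_add, Finset.sum_add_distrib,
    mul_neg, Finset.sum_neg_distrib, hE.trace_cov4] at h
  linear_combination h

/-- Schur's lemma. A double contraction of the derivative of the curvature is `2(n-1) ∂p` when the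
Ricci contraction is done first, and `2(n-1)² ∂p` by the contracted Bianchi identity. -/
lemma IsEinsteinWith.der_eq_zero (hE : 𝒢.IsEinsteinWith p) (hn : 3 ≤ n) (b : Fin n) :
    𝒢.der b p = 0 := by
  have h1 : ∑ c, ∑ e, 𝒢.gi c e * ∑ a, ∑ d, 𝒢.gi a d * 𝒢.cov4 𝒢.riemL a b c d e
      = 2 * ((n : R) - 1) * 𝒢.der b p := by
    have : ∀ a d, ∑ c, ∑ e, 𝒢.gi c e * 𝒢.cov4 𝒢.riemL a b c d e
        = 2 * ((n : R) - 1) * 𝒢.der a p * 𝒢.g b d := fun a d => by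
      rw [← hE.trace_cov4]
      exact Finset.sum_congr rfl fun c _ => Finset.sum_congr rfl fun e _ => by
        rw [cov4_antisymm, cov4_antisymm', neg_neg]
    calc _ = ∑ a, ∑ d, 𝒢.gi a d * ∑ c, ∑ e, 𝒢.gi c e * 𝒢.cov4 𝒢.riemL a b c d e := by
          simp_rw [Finset.mul_sum]
          rw [Finset.sum_congr rfl fun c _ => Finset.sum_comm_cycle.symm.trans
            (Finset.sum_congr rfl fun _ _ => Finset.sum_comm)]
          rw [Finset.sum_comm]
          refine Finset.sum_congr rfl fun a _ => ?_
          rw [Finset.sum_congr rfl fun c _ => Finset.sum_comm]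
          rw [Finset.sum_comm]
          refine Finset.sum_congr rfl fun d _ => Finset.sum_congr rfl fun c _ =>
            Finset.sum_congr rfl fun e _ => by ring
      _ = _ := by
          simp only [this]
          have h4 : ∀ a d, 𝒢.gi a d * (2 * ((n : R) - 1) * 𝒢.der a p * 𝒢.g b d)
            = 2 * ((n : R) - 1) * 𝒢.der a p * (𝒢.gi a d * 𝒢.g d b) := fun a d => by
              rw [𝒢.g_symm b]; ring
          simp only [h4, ← Finset.mul_sum, 𝒢.gi_g]
          simp
  simp only [hE.div_cov4] at h1
  have h2 : ∑ c, ∑ e, 𝒢.gi c e * (2 * ((n : R) - 1) * (𝒢.der b p * 𝒢.g c e - 𝒢.der c p * 𝒢.g b e))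
      = 2 * ((n : R) - 1) * (𝒢.der b p * ∑ c, ∑ e, 𝒢.gi c e * 𝒢.g c e
        - ∑ c, 𝒢.der c p * ∑ e, 𝒢.gi c e * 𝒢.g e b) := by
    simp only [Finset.mul_sum, ← Finset.sum_sub_distrib]
    exact Finset.sum_congr rfl fun c _ => Finset.sum_congr rfl fun e _ => by
      rw [𝒢.g_symm b]; ring
  rw [h2, trace_g] at h1
  simp only [𝒢.gi_g, mul_ite, mul_one, mul_zero, Finset.sum_ite_eq', Finset.mem_univ,
    if_true] at h1
  -- The algebra may have zero divisors, so the factor `2(n-1)(n-2)` is treated as a nonzero real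
  -- scalar and inverted there.
  have h5 : ((2 * ((n : ℝ) - 1) * ((n : ℝ) - 2))) • 𝒢.der b p = 0 := by
    rw [Algebra.smul_def]
    simp only [map_mul, map_sub, map_natCast, map_one, map_ofNat]
    linear_combination h1
  have h6 : (3 : ℝ) ≤ n := by exact_mod_cast hn
  have h7 : (2 * ((n : ℝ) - 1) * ((n : ℝ) - 2)) ≠ 0 :=
    mul_ne_zero (mul_ne_zero two_ne_zero (by linarith)) (by linarith)
  rw [← inv_smul_smul₀ h7 (𝒢.der b p), h5, smul_zero]

lemma IsEinsteinWith.div_riemL (hE : 𝒢.IsEinsteinWith p) (hn : 3 ≤ n) (c e f : Fin n) :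
    ∑ a, ∑ b, 𝒢.gi a b * 𝒢.cov4 𝒢.riemL a b c e f = 0 := by
  have h := hE.div_cov4 e f c
  simp only [hE.der_eq_zero hn, zero_mul, sub_zero, mul_zero] at h
  rw [← h]
  exact Finset.sum_congr rfl fun a _ => Finset.sum_congr rfl fun b _ => by rw [cov4_pair]

end AlgMetric

end

end EinsteinTractor

namespace EinsteinTractor

noncomputable section

/-! ## Covariant tensors of all degrees and alternating tensors -/

/-- Covariant tensors of all degrees, with indices in `ι`. -/
abbrev Fock (ι R : Type*) := ∀ t : ℕ, (Fin t → ι) → R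

namespace Fock

variable {ι R : Type*} [CommRing R]

/-- Insertion of the frame element `A` in the first slot. -/
def ann (A : ι) : Fock ι R →ₗ[R] Fock ι R where
  toFun V := fun t L => V (t + 1) (Fin.cons A L)
  map_add' _ _ := rfl
  map_smul' _ _ := rfl

@[simp] lemma ann_apply (A : ι) (V : Fock ι R) (t : ℕ) (L : Fin t → ι) :
    ann A V t L = V (t + 1) (Fin.cons A L) := rfl

lemma ext_ann {V W : Fock ι R} (h0 : V 0 = W 0) (h : ∀ A, ann A V = ann A W) : V = W := by
  funext t L
  cases t with
  | zero => rw [h0]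
  | succ t =>
    have := congrFun (congrFun (h (L 0)) t) (Fin.tail L)
    simpa using this

/-- A map that commutes with all insertions vanishes if it vanishes in degree zero. -/
lemma eq_zero_of_ann {P : Fock ι R → Prop} (hP : ∀ V A, P V → P (ann A V))
    {T : Fock ι R → Fock ι R} (h0 : ∀ V, P V → T V 0 = 0)
    (h : ∀ V A, P V → ann A (T V) = T (ann A V)) (V : Fock ι R) (hV : P V) : T V = 0 := by
  funext t
  induction t generalizing V with
  | zero => exact h0 V hV
  | succ t ih =>
    funext L
    have h1 := congrFun (congrFun (h V (L 0) hV) t) (Fin.tail L)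
    rw [ih _ (hP _ _ hV)] at h1
    simpa using h1

/-- The components of the wedge product with a covector. -/
def creAux (η : ι → R) : ∀ t : ℕ, Fock ι R → (Fin t → ι) → R
  | 0, _, _ => 0
  | t + 1, V, L => η (L 0) * V t (Fin.tail L) - creAux η t (ann (L 0) V) (Fin.tail L)

/-- The (unnormalised) wedge product with a covector. -/
def cre (η : ι → R) : Fock ι R →ₗ[R] Fock ι R where
  toFun V := fun t L => creAux η t V L
  map_add' V W := by
    funext t L
    induction t generalizing V W with
    | zero => simp [creAux]
    | succ t ih =>
      have := ih (ann (L 0) V) (ann (L 0) W) (Fin.tail L)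
      simp only [Pi.add_apply] at this ⊢
      simp only [creAux, map_add, this, Pi.add_apply]; ring
  map_smul' r V := by
    funext t L
    induction t generalizing V with
    | zero => simp [creAux]
    | succ t ih =>
      have := ih (ann (L 0) V) (Fin.tail L)
      simp only [Pi.smul_apply, RingHom.id_apply, smul_eq_mul] at this ⊢
      simp only [creAux, map_smul, this, Pi.smul_apply, smul_eq_mul]; ring

@[simp] lemma cre_zero_apply (η : ι → R) (V : Fock ι R) : cre η V 0 = 0 := rfl

/-- Together with the vanishing in degree zero this recursion determines `cre`; it is one half of
the canonical anticommutation relations. -/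
lemma ann_cre (η : ι → R) (A : ι) (V : Fock ι R) :
    ann A (cre η V) = η A • V - cre η (ann A V) := by
  funext t L
  simp [cre, creAux]

lemma cre_anticomm (η θ : ι → R) (V : Fock ι R) : cre η (cre θ V) = -cre θ (cre η V) := by
  rw [eq_neg_iff_add_eq_zero]
  refine eq_zero_of_ann (P := fun _ => True) (T := fun V => cre η (cre θ V) + cre θ (cre η V))
    (fun _ _ _ => trivial) (fun _ _ => by simp) (fun V A _ => ?_) V trivial
  simp only [map_add, ann_cre, map_sub, map_smul]
  abel

/-- Unfolding the recursion gives the alternating sum over slots, the form needed for comparison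
with the exterior derivative and with skew-symmetrisation. -/
lemma cre_apply (η : ι → R) (V : Fock ι R) (t : ℕ) (L : Fin (t + 1) → ι) :
    cre η V (t + 1) L
      = ∑ i : Fin (t + 1), (-1 : R) ^ (i : ℕ) * (η (L i) * V t (L ∘ i.succAbove)) := by
  induction t generalizing V with
  | zero =>
    simp only [cre, LinearMap.coe_mk, AddHom.coe_mk, creAux]
    simp
    rfl
  | succ t ih =>
    rw [Fin.sum_univ_succ]
    have h : cre η V (t + 1 + 1) L = η (L 0) * V (t + 1) (Fin.tail L)
      - cre η (ann (L 0) V) (t + 1) (Fin.tail L) := rfl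
    rw [h, ih, sub_eq_add_neg, ← Finset.sum_neg_distrib]
    congr 1
    · simp [Function.comp_def]
      rfl
    · refine Finset.sum_congr rfl fun i _ => ?_
      have h2 : (Fin.cons (L 0) (Fin.tail L ∘ i.succAbove) : Fin (t + 1) → ι)
          = L ∘ i.succ.succAbove := by
        funext j
        refine Fin.cases ?_ (fun j => ?_) j <;> simp [Fin.tail]
      rw [ann_apply, h2, Fin.val_succ, pow_succ]
      simp only [Fin.tail]
      ring

/-! ### Alternating tensors -/

/-- A tensor is alternating. -/
def IsAlt (V : Fock ι R) : Prop :=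
  ∀ (t : ℕ) (L : Fin t → ι) (i j : Fin t), i ≠ j → V t (L ∘ Equiv.swap i j) = -V t L

lemma IsAlt.ann {V : Fock ι R} (hV : V.IsAlt) (A : ι) : (ann A V).IsAlt := by
  intro t L i j hij
  have h := hV (t + 1) (Fin.cons A L) i.succ j.succ (by simpa using hij)
  rw [ann_apply, ann_apply, ← h]
  congr 1
  funext k
  refine Fin.cases ?_ (fun k => ?_) k
  · simp [Equiv.swap_apply_of_ne_of_ne (Fin.succ_ne_zero i).symm (Fin.succ_ne_zero j).symm]
  · simp only [Fin.cons_succ, Function.comp_apply]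
    rcases eq_or_ne k i with rfl | h1
    · simp
    rcases eq_or_ne k j with rfl | h2
    · simp
    rw [Equiv.swap_apply_of_ne_of_ne h1 h2, Equiv.swap_apply_of_ne_of_ne (by simpa using h1)
      (by simpa using h2), Fin.cons_succ]

lemma IsAlt.ann_anticomm {V : Fock ι R} (hV : V.IsAlt) (A B : ι) :
    Fock.ann A (Fock.ann B V) = -Fock.ann B (Fock.ann A V) := by
  funext t L
  have h := hV (t + 2) (Fin.cons A (Fin.cons B L)) 0 1 (by simp)
  simp only [ann_apply, Pi.neg_apply]
  rw [← h]
  congr 1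
  funext k
  refine Fin.cases ?_ (fun k => Fin.cases ?_ (fun k => ?_) k) k
  · simp
  · simp
  · rw [Function.comp_apply, Equiv.swap_apply_of_ne_of_ne (Fin.succ_ne_zero _)
      (by simp [Fin.ext_iff])]
    simp

lemma apply_perm_of_swap {t : ℕ} {v : (Fin t → ι) → R}
    (h : ∀ (L : Fin t → ι) (i j : Fin t), i ≠ j → v (L ∘ Equiv.swap i j) = -v L)
    (σ : Equiv.Perm (Fin t)) (L : Fin t → ι) :
    v (L ∘ σ) = ((Equiv.Perm.sign σ : ℤ) : R) * v L := by
  induction σ using Equiv.Perm.swap_induction_on generalizing L with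
  | one => simp
  | swap_mul σ x y hxy ih =>
    have : L ∘ (Equiv.swap x y * σ) = (L ∘ Equiv.swap x y) ∘ σ := rfl
    rw [this, ih, h _ _ _ hxy, Equiv.Perm.sign_mul, Equiv.Perm.sign_swap hxy]
    simp

/-- Alternation can be tested with the first two slots, hereditarily. -/
lemma isAlt_of_ann {P : Fock ι R → Prop} (hP : ∀ V A, P V → P (Fock.ann A V))
    (h : ∀ V A B, P V → Fock.ann A (Fock.ann B V) = -Fock.ann B (Fock.ann A V))
    (V : Fock ι R) (hV : P V) : V.IsAlt := by
  -- Adjacent transpositions come first: the one in the leading two slots is the hypothesis, and the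
  -- others reduce to it after an insertion. They generate the symmetric group.
  have key : ∀ (t : ℕ) (V : Fock ι R), P V → ∀ (i : Fin t) (L : Fin (t + 1) → ι),
      V (t + 1) (L ∘ Equiv.swap i.castSucc i.succ) = -V (t + 1) L := by
    intro t
    induction t with
    | zero => intro V _ i; exact i.elim0
    | succ t ih =>
      intro V hV i L
      refine Fin.cases ?_ (fun i => ?_) i
      · have h1 := congrFun (congrFun (h V (L 0) (L 1) hV) t) (Fin.tail (Fin.tail L))
        simp only [ann_apply, Pi.neg_apply] at h1
        have e1 : (Fin.cons (L 0) (Fin.cons (L 1) (Fin.tail (Fin.tail L))) : Fin (t + 2) → ι)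
          = L := by
          funext k
          refine Fin.cases ?_ (fun k => Fin.cases ?_ (fun k => ?_) k) k <;> simp [Fin.tail]
        have e2 : (Fin.cons (L 1) (Fin.cons (L 0) (Fin.tail (Fin.tail L))) : Fin (t + 2) → ι)
          = L ∘ Equiv.swap (Fin.castSucc 0) (Fin.succ 0) := by
          funext k
          refine Fin.cases ?_ (fun k => Fin.cases ?_ (fun k => ?_) k) k
          · simp
          · simp
          · rw [Function.comp_apply, Equiv.swap_apply_of_ne_of_ne (by simp [Fin.ext_iff])
              (by simp [Fin.ext_iff])]
            simp [Fin.tail]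
        rw [e1, e2] at h1
        exact h1
      · have h1 := ih (Fock.ann (L 0) V) (hP _ _ hV) i (Fin.tail L)
        simp only [ann_apply] at h1
        rw [Fin.cons_self_tail] at h1
        rw [← h1]
        congr 1
        funext k
        refine Fin.cases ?_ (fun k => ?_) k
        · rw [Function.comp_apply, Equiv.swap_apply_of_ne_of_ne (by simp [Fin.ext_iff])
            (by simp [Fin.ext_iff])]
          simp
        · simp only [Function.comp_apply, Fin.cons_succ, Fin.tail, Fin.castSucc_succ]
          rcases eq_or_ne k i.castSucc with rfl | h1
          · simp
          rcases eq_or_ne k i.succ with rfl | h2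
          · simp
          rw [Equiv.swap_apply_of_ne_of_ne h1 h2, Equiv.swap_apply_of_ne_of_ne
            (by simpa using h1) (by simpa using h2)]
  intro t L i j hij
  cases t with
  | zero => exact i.elim0
  | succ t =>
    have hσ : ∀ σ : Equiv.Perm (Fin (t + 1)), ∀ L : Fin (t + 1) → ι,
        V (t + 1) (L ∘ σ) = ((Equiv.Perm.sign σ : ℤ) : R) * V (t + 1) L := by
      intro σ
      have hm : σ ∈ Submonoid.closure
          (Set.range fun i : Fin t => Equiv.swap i.castSucc i.succ) := by
        rw [Equiv.Perm.mclosure_swap_castSucc_succ]; trivial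
      induction hm using Submonoid.closure_induction with
      | mem σ h =>
        obtain ⟨i, rfl⟩ := h
        intro L
        simp only [key t V hV i L]
        rw [Equiv.Perm.sign_swap (by simp [Fin.ext_iff])]
        simp
      | one => simp
      | mul σ τ _ _ h1 h2 =>
        intro L
        have : L ∘ (σ * τ) = (L ∘ σ) ∘ τ := rfl
        rw [this, h2, h1, Equiv.Perm.sign_mul]
        push_cast; ring
    rw [hσ, Equiv.Perm.sign_swap hij]
    simp

lemma IsAlt.add {V W : Fock ι R} (hV : V.IsAlt) (hW : W.IsAlt) : (V + W).IsAlt :=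
  fun t L i j h => by simp only [Pi.add_apply, hV t L i j h, hW t L i j h]; ring

lemma IsAlt.smul {V : Fock ι R} (hV : V.IsAlt) (r : R) : (r • V).IsAlt :=
  fun t L i j h => by simp only [Pi.smul_apply, hV t L i j h, smul_neg]

/-- The tensors `cre η V + U` with `V` and `U` alternating are closed under insertion, since
inserting into `cre η V` yields a multiple of `V` and another term of the form `cre η V'`. On this
class the first two slots are skew by `ann_cre`, so `isAlt_of_ann` applies. -/
lemma IsAlt.cre {V : Fock ι R} (hV : V.IsAlt) (η : ι → R) : (cre η V).IsAlt := by
  refine isAlt_of_ann (P := fun W => ∃ V U : Fock ι R, V.IsAlt ∧ U.IsAlt ∧ W = Fock.cre η V + U)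
    ?_ ?_ _ ⟨V, 0, hV, fun _ _ _ _ _ => by simp, by simp⟩
  · rintro _ A ⟨V, U, hV, hU, rfl⟩
    exact ⟨-Fock.ann A V, η A • V + Fock.ann A U,
      by simpa using (hV.ann A).smul (-1), (hV.smul _).add (hU.ann A), by
        simp only [map_add, ann_cre, map_neg]; abel⟩
  · rintro _ A B ⟨V, U, hV, hU, rfl⟩
    simp only [map_add, ann_cre, map_sub, map_smul, hV.ann_anticomm A B, hU.ann_anticomm A B,
      map_neg]
    abel

variable [Fintype ι]

/-! ### Derivations extending endomorphisms of covectors -/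

/-- The components of the derivation that extends an endomorphism of covectors. -/
def actAux (E : ι → ι → R) : ∀ t : ℕ, Fock ι R → (Fin t → ι) → R
  | 0, _, _ => 0
  | t + 1, V, L => ∑ B, E (L 0) B * V (t + 1) (Fin.cons B (Fin.tail L))
      + actAux E t (ann (L 0) V) (Fin.tail L)

/-- The derivation of the tensor algebra that extends an endomorphism of covectors. -/
def act (E : ι → ι → R) (V : Fock ι R) : Fock ι R := fun t L => actAux E t V L

@[simp] lemma act_zero_apply (E : ι → ι → R) (V : Fock ι R) : act E V 0 = 0 := rfl

lemma ann_act (E : ι → ι → R) (A : ι) (V : Fock ι R) :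
    ann A (act E V) = ∑ B, E A B • ann B V + act E (ann A V) := by
  funext t L
  simp [act, actAux]

lemma act_apply [DecidableEq ι] (E : ι → ι → R) (V : Fock ι R) (t : ℕ) (L : Fin t → ι) :
    act E V t L = ∑ j, ∑ B, E (L j) B * V t (Function.update L j B) := by
  induction t generalizing V with
  | zero => simp
  | succ t ih =>
    have h : act E V (t + 1) L = ∑ B, E (L 0) B * V (t + 1) (Fin.cons B (Fin.tail L))
      + act E (ann (L 0) V) t (Fin.tail L) := rfl
    rw [h, ih, Fin.sum_univ_succ]
    congr 1
    · refine Finset.sum_congr rfl fun B _ => ?_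
      congr 2
      conv_rhs => rw [← Fin.cons_self_tail L, Fin.update_cons_zero]
    · refine Finset.sum_congr rfl fun j _ => Finset.sum_congr rfl fun B _ => ?_
      rw [ann_apply]
      congr 2
      conv_rhs => rw [← Fin.cons_self_tail L, ← Fin.cons_update]

variable [DecidableEq ι]

/-- On alternating tensors a derivation is a quadratic expression `∑ E_{AB} c^A b_B`; both sides
obey the same recursion under insertion because insertions anticommute. This is the bridge from
index formulas to the operator calculus. -/
lemma IsAlt.act_eq {V : Fock ι R} (hV : V.IsAlt) (E : ι → ι → R) :
    act E V = ∑ A, ∑ B, E A B • Fock.cre (Pi.single A 1) (Fock.ann B V) := by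
  rw [← sub_eq_zero]
  refine eq_zero_of_ann (P := IsAlt) (T := fun V => act E V
    - ∑ A, ∑ B, E A B • Fock.cre (Pi.single A 1) (Fock.ann B V)) (fun V A h => h.ann A)
    (fun V _ => ?_) (fun V C hV => ?_) V hV
  · funext L; simp
  · simp only [map_sub, ann_act, map_sum, map_smul, ann_cre, hV.ann_anticomm C, map_neg,
      sub_neg_eq_add, smul_add, Finset.sum_add_distrib, Pi.single_apply]
    have : ∑ x, ∑ x_1, E x x_1 • (if C = x then (1 : R) else 0) • Fock.ann x_1 V
        = ∑ B, E C B • Fock.ann B V := by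
      simp [ite_smul, smul_ite]
    rw [this]
    abel

/-- The module of alternating tensors. -/
def altModule (ι R : Type*) [CommRing R] : Submodule R (Fock ι R) where
  carrier := {V | V.IsAlt}
  add_mem' := IsAlt.add
  zero_mem' := fun _ _ _ _ _ => by simp
  smul_mem' r _ h := h.smul r

end Fock

end

end EinsteinTractor

namespace EinsteinTractor

noncomputable section

/-! ## The operator calculus on alternating tensors -/

/-- Creation, annihilation and derivation operators over the algebra `R`. -/
structure OpCalc {n : ℕ} {R : Type*} [CommRing R] [Algebra ℝ R] (𝒢 : AlgMetric n R)
    (E : Type*) [Ring E] [Module R E] where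
  /-- creation operators -/
  c : TIdx n → E
  /-- annihilation operators -/
  b : TIdx n → E
  /-- componentwise derivations -/
  D : Fin n → E
  c_c : ∀ A B, c A * c B = -(c B * c A)
  b_b : ∀ A B, b A * b B = -(b B * b A)
  b_c : ∀ A B, b A * c B = (if A = B then 1 else 0) - c B * b A
  c_smul : ∀ A (r : R) (x : E), c A * (r • x) = r • (c A * x)
  b_smul : ∀ A (r : R) (x : E), b A * (r • x) = r • (b A * x)
  D_smul : ∀ a (r : R) (x : E), D a * (r • x) = r • (D a * x) + 𝒢.der a r • x
  D_c : ∀ a A, D a * c A = c A * D a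
  D_b : ∀ a A, D a * b A = b A * D a
  D_D : ∀ a b, D a * D b = D b * D a

namespace OpCalc

set_option linter.unusedSectionVars false

variable {n : ℕ} {R : Type*} [CommRing R] [Algebra ℝ R] {𝒢 : AlgMetric n R}
  {E : Type*} [Ring E] [Module R E] [IsScalarTower R E E] (F : OpCalc 𝒢 E)

/-- Exterior multiplication with `dy^a`. -/
def cZ (a : Fin n) : E := F.c (.inr (.inl a))
/-- Insertion of `∂_a`. -/
def bZ (a : Fin n) : E := F.b (.inr (.inl a))
/-- Exterior multiplication with `Y`. -/
def cY : E := F.c (.inl ())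
/-- Exterior multiplication with `X`. -/
def cX : E := F.c (.inr (.inr ()))
/-- The annihilation operator dual to `cY`. -/
def bY : E := F.b (.inl ())
/-- The annihilation operator dual to `cX`. -/
def bX : E := F.b (.inr (.inr ()))

lemma eq_zero_of_eq_neg (R : Type*) [CommRing R] [Algebra ℝ R] {E : Type*} [Ring E] [Module R E]
    {x : E} (h : x = -x) : x = 0 := by
  have h2 : (2 : R) • x = 0 := by rw [two_smul]; nth_rw 1 [h]; simp
  rw [← one_smul R x, ← AlgMetric.two_half, mul_comm, mul_smul, h2, smul_zero]

/-- The contraction of a symmetric with a skew-symmetric array vanishes. -/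
lemma sum_symm_smul_skew (s : Fin n → Fin n → R) (hs : ∀ a b, s a b = s b a)
    (T : Fin n → Fin n → E) (hT : ∀ a b, T a b = -T b a) :
    ∑ a, ∑ b, s a b • T a b = 0 := by
  refine eq_zero_of_eq_neg R ?_
  nth_rw 1 [Finset.sum_comm]
  rw [← Finset.sum_neg_distrib]
  refine Finset.sum_congr rfl fun a _ => ?_
  rw [← Finset.sum_neg_distrib]
  exact Finset.sum_congr rfl fun b _ => by rw [hs, hT, smul_neg]

lemma cZ_smul (a : Fin n) (r : R) (x : E) : F.cZ a * (r • x) = r • (F.cZ a * x) := F.c_smul _ _ _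
lemma bZ_smul (a : Fin n) (r : R) (x : E) : F.bZ a * (r • x) = r • (F.bZ a * x) := F.b_smul _ _ _

lemma cb_c (A B C : TIdx n) : F.c A * F.b B * F.c C
    = F.c C * (F.c A * F.b B) + if B = C then F.c A else 0 := by
  rw [mul_assoc, F.b_c, mul_sub, ← mul_assoc, F.c_c A C, ← mul_assoc]
  split_ifs <;> simp [add_comm]

lemma cb_b (A B C : TIdx n) : F.c A * F.b B * F.b C
    = F.b C * (F.c A * F.b B) - if C = A then F.b B else 0 := by
  rw [← mul_assoc (F.b C), F.b_c, mul_assoc, F.b_b B C, sub_mul]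
  split_ifs <;> simp [mul_assoc]

/-! ### Quadratic operators attached to matrices -/

/-- The operator `∑ M_{ab} c^a b_b`. -/
def op (M : Fin n → Fin n → R) : E := ∑ a, ∑ b, M a b • (F.cZ a * F.bZ b)

lemma op_smul (M : Fin n → Fin n → R) (r : R) (x : E) : F.op M * (r • x) = r • (F.op M * x) := by
  simp only [op, Finset.sum_mul, Finset.smul_sum, smul_mul_assoc, mul_assoc, cZ_smul, bZ_smul]
  exact Finset.sum_congr rfl fun _ _ => Finset.sum_congr rfl fun _ _ => smul_comm _ _ _

lemma op_add (M N : Fin n → Fin n → R) : F.op M + F.op N = F.op (M + N) := by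
  simp [op, add_smul, Finset.sum_add_distrib]

lemma op_sub (M N : Fin n → Fin n → R) : F.op M - F.op N = F.op (M - N) := by
  simp [op, sub_smul, Finset.sum_sub_distrib]

lemma op_c (M : Fin n → Fin n → R) (C : TIdx n) : F.op M * F.c C
    = F.c C * F.op M + ∑ a, ∑ b, M a b • if Sum.inr (Sum.inl b) = C then F.cZ a else 0 := by
  simp only [op, Finset.sum_mul, Finset.mul_sum, smul_mul_assoc, F.c_smul, cZ, bZ, cb_c, smul_add,
    Finset.sum_add_distrib]

lemma op_b (M : Fin n → Fin n → R) (C : TIdx n) : F.op M * F.b C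
    = F.b C * F.op M - ∑ a, ∑ b, M a b • if C = Sum.inr (Sum.inl a) then F.bZ b else 0 := by
  simp only [op, Finset.sum_mul, Finset.mul_sum, smul_mul_assoc, F.b_smul, cZ, bZ, cb_b, smul_sub,
    Finset.sum_sub_distrib]

lemma op_cZ (M : Fin n → Fin n → R) (f : Fin n) :
    F.op M * F.cZ f = F.cZ f * F.op M + ∑ a, M a f • F.cZ a := by
  rw [cZ, op_c]; simp

lemma op_bZ (M : Fin n → Fin n → R) (f : Fin n) :
    F.op M * F.bZ f = F.bZ f * F.op M - ∑ b, M f b • F.bZ b := by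
  rw [bZ, op_b]; simp

lemma op_cX (M : Fin n → Fin n → R) : F.op M * F.cX = F.cX * F.op M := by rw [cX, op_c]; simp
lemma op_cY (M : Fin n → Fin n → R) : F.op M * F.cY = F.cY * F.op M := by rw [cY, op_c]; simp
lemma op_bX (M : Fin n → Fin n → R) : F.op M * F.bX = F.bX * F.op M := by rw [bX, op_b]; simp
lemma op_bY (M : Fin n → Fin n → R) : F.op M * F.bY = F.bY * F.op M := by rw [bY, op_b]; simp

lemma D_op (a : Fin n) (M : Fin n → Fin n → R) :
    F.D a * F.op M = F.op M * F.D a + F.op fun c d => 𝒢.der a (M c d) := by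
  simp only [op, Finset.sum_mul, Finset.mul_sum, smul_mul_assoc, F.D_smul,
    Finset.sum_add_distrib, cZ, bZ]
  congr 1
  refine Finset.sum_congr rfl fun _ _ => Finset.sum_congr rfl fun _ _ => ?_
  rw [← mul_assoc, F.D_c, mul_assoc, F.D_b, mul_assoc]

/-- Passing from matrices to quadratic operators is a homomorphism of Lie algebras; this is what
makes the Ricci identity a statement about matrices of Christoffel symbols. -/
lemma op_op (M N : Fin n → Fin n → R) : F.op M * F.op N = F.op N * F.op M
    + F.op fun c d => ∑ e, (M c e * N e d - N c e * M e d) := by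
  have h : ∀ a b, F.op M * (F.cZ a * F.bZ b) = F.cZ a * F.bZ b * F.op M
      + (∑ e, M e a • (F.cZ e * F.bZ b) - ∑ f, M b f • (F.cZ a * F.bZ f)) := fun a b => by
    rw [← mul_assoc, op_cZ, add_mul, mul_assoc, op_bZ, mul_sub, ← mul_assoc, Finset.sum_mul,
      Finset.mul_sum]
    simp only [smul_mul_assoc, cZ_smul]
    abel
  conv_lhs => rw [op, op]
  rw [← op]
  simp only [Finset.mul_sum, op_smul, h, smul_add, Finset.sum_add_distrib]
  congr 1
  · simp only [op, Finset.sum_mul, smul_mul_assoc]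
  · simp only [smul_sub, Finset.sum_sub_distrib, op, sub_smul, Finset.sum_smul, Finset.smul_sum,
      smul_smul]
    congr 1
    · rw [Finset.sum_comm_cycle]
      refine Finset.sum_congr rfl fun a _ => ?_
      rw [Finset.sum_comm]
      exact Finset.sum_congr rfl fun _ _ => Finset.sum_congr rfl fun _ _ => by rw [mul_comm]
    · refine Finset.sum_congr rfl fun a _ => ?_
      rw [Finset.sum_comm]

/-! ### The Levi-Civita derivative, `d`, `δ` and the rough Laplacian as operators -/

/-- The Levi-Civita covariant derivative. -/
def nab (a : Fin n) : E := F.D a - F.op fun e d => 𝒢.chr d a e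

lemma nab_smul (a : Fin n) (r : R) (x : E) :
    F.nab a * (r • x) = r • (F.nab a * x) + 𝒢.der a r • x := by
  simp only [nab, sub_mul, F.D_smul, op_smul, smul_sub]; abel

lemma nab_cZ (a b : Fin n) :
    F.nab a * F.cZ b = F.cZ b * F.nab a - ∑ e, 𝒢.chr b a e • F.cZ e := by
  simp only [nab, sub_mul, mul_sub, op_cZ]
  rw [cZ, F.D_c]; abel

lemma nab_bZ (a b : Fin n) :
    F.nab a * F.bZ b = F.bZ b * F.nab a + ∑ d, 𝒢.chr d a b • F.bZ d := by
  simp only [nab, sub_mul, mul_sub, op_bZ]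
  rw [bZ, F.D_b]; abel

lemma nab_cX (a : Fin n) : F.nab a * F.cX = F.cX * F.nab a := by
  have h : F.D a * F.cX = F.cX * F.D a := F.D_c _ _
  simp only [nab, sub_mul, mul_sub, op_cX, h]
lemma nab_cY (a : Fin n) : F.nab a * F.cY = F.cY * F.nab a := by
  have h : F.D a * F.cY = F.cY * F.D a := F.D_c _ _
  simp only [nab, sub_mul, mul_sub, op_cY, h]
lemma nab_bX (a : Fin n) : F.nab a * F.bX = F.bX * F.nab a := by
  have h : F.D a * F.bX = F.bX * F.D a := F.D_b _ _
  simp only [nab, sub_mul, mul_sub, op_bX, h]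
lemma nab_bY (a : Fin n) : F.nab a * F.bY = F.bY * F.nab a := by
  have h : F.D a * F.bY = F.bY * F.D a := F.D_b _ _
  simp only [nab, sub_mul, mul_sub, op_bY, h]

/-- The Ricci identity. -/
lemma nab_nab (a b : Fin n) : F.nab a * F.nab b - F.nab b * F.nab a
    = F.op fun c d => -𝒢.riem a b d c := by
  simp only [nab, sub_mul, mul_sub, F.D_D a b, D_op]
  rw [F.op_op (fun e d => 𝒢.chr d a e)]
  have h : (fun c d => -𝒢.riem a b d c) = (fun c d => 𝒢.der b (𝒢.chr d a c))
      - (fun c d => 𝒢.der a (𝒢.chr d b c))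
      + (fun c d => ∑ e, (𝒢.chr e a c * 𝒢.chr d b e - 𝒢.chr e b c * 𝒢.chr d a e)) := by
    funext c d
    simp only [AlgMetric.riem, Pi.add_apply, Pi.sub_apply, Finset.sum_sub_distrib,
      mul_comm (𝒢.chr _ _ c)]
    ring
  rw [h, ← op_add, ← op_sub]
  abel

/-- Insertion of the gradient of `y^a`. -/
def bu (a : Fin n) : E := ∑ b, 𝒢.gi a b • F.bZ b

/-- Exterior multiplication with `g_{ab} dy^b`. -/
def cl (a : Fin n) : E := ∑ b, 𝒢.g a b • F.cZ b

/-- The number operator. -/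
def num : E := ∑ a, F.cZ a * F.bZ a

/-- The exterior derivative. -/
def ext : E := ∑ a, F.cZ a * F.nab a

/-- The codifferential. -/
def cod : E := -∑ a, F.bu a * F.nab a

/-- The Laplacian of the Levi-Civita connection. -/
def lapLC : E := ∑ a, ∑ b, 𝒢.gi a b • (F.nab a * F.nab b - ∑ c, 𝒢.chr c a b • F.nab c)

lemma bu_smul (a : Fin n) (r : R) (x : E) : F.bu a * (r • x) = r • (F.bu a * x) := by
  simp only [bu, Finset.sum_mul, Finset.smul_sum, smul_mul_assoc, bZ_smul]
  exact Finset.sum_congr rfl fun _ _ => smul_comm _ _ _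

lemma cl_smul (a : Fin n) (r : R) (x : E) : F.cl a * (r • x) = r • (F.cl a * x) := by
  simp only [cl, Finset.sum_mul, Finset.smul_sum, smul_mul_assoc, cZ_smul]
  exact Finset.sum_congr rfl fun _ _ => smul_comm _ _ _

lemma cZ_cZ (a b : Fin n) : F.cZ a * F.cZ b = -(F.cZ b * F.cZ a) := F.c_c _ _
lemma bZ_bZ (a b : Fin n) : F.bZ a * F.bZ b = -(F.bZ b * F.bZ a) := F.b_b _ _
lemma bZ_cZ (a b : Fin n) : F.bZ a * F.cZ b = (if a = b then 1 else 0) - F.cZ b * F.bZ a := by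
  rw [bZ, cZ, F.b_c]; simp

lemma bu_cZ (a b : Fin n) : F.bu a * F.cZ b = 𝒢.gi a b • 1 - F.cZ b * F.bu a := by
  simp only [bu, Finset.sum_mul, Finset.mul_sum, smul_mul_assoc, cZ_smul, bZ_cZ, smul_sub,
    Finset.sum_sub_distrib]
  simp

lemma bZ_cl (a b : Fin n) : F.bZ a * F.cl b = 𝒢.g b a • 1 - F.cl b * F.bZ a := by
  simp only [cl, Finset.sum_mul, Finset.mul_sum, smul_mul_assoc, bZ_smul, bZ_cZ, smul_sub,
    Finset.sum_sub_distrib]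
  simp

lemma bu_cl (a b : Fin n) : F.bu a * F.cl b = (if a = b then 1 else 0) - F.cl b * F.bu a := by
  simp only [bu, Finset.sum_mul, Finset.mul_sum, smul_mul_assoc, cl_smul, bZ_cl, smul_sub,
    Finset.sum_sub_distrib, smul_smul]
  rw [← Finset.sum_smul]
  simp only [𝒢.g_symm b, 𝒢.gi_g]
  split_ifs <;> simp

lemma bu_bu (a b : Fin n) : F.bu a * F.bu b = -(F.bu b * F.bu a) := by
  simp only [bu, Finset.sum_mul, Finset.mul_sum, smul_mul_assoc, bZ_smul]
  rw [Finset.sum_comm, ← Finset.sum_neg_distrib]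
  refine Finset.sum_congr rfl fun d _ => ?_
  rw [← Finset.sum_neg_distrib]
  refine Finset.sum_congr rfl fun c _ => ?_
  rw [F.bZ_bZ c d, smul_neg, smul_neg, smul_comm, neg_neg]

lemma sum_gi_cl (b : Fin n) : ∑ a, 𝒢.gi b a • F.cl a = F.cZ b := by
  simp only [cl, Finset.smul_sum, smul_smul]
  rw [Finset.sum_comm]
  simp only [← Finset.sum_smul, 𝒢.gi_g]
  simp

lemma sum_g_bu (b : Fin n) : ∑ a, 𝒢.g b a • F.bu a = F.bZ b := by
  simp only [bu, Finset.smul_sum, smul_smul]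
  rw [Finset.sum_comm]
  simp only [← Finset.sum_smul, 𝒢.g_gi]
  simp

lemma sum_cl_bu : ∑ a, F.cl a * F.bu a = F.num := by
  simp only [cl, Finset.sum_mul, smul_mul_assoc]
  rw [Finset.sum_comm, num]
  refine Finset.sum_congr rfl fun b _ => ?_
  rw [← sum_g_bu, Finset.mul_sum]
  simp only [cZ_smul]
  exact Finset.sum_congr rfl fun a _ => by rw [𝒢.g_symm]

lemma num_eq_op : F.num = F.op fun a b => if a = b then 1 else 0 := by
  simp [num, op]

lemma num_cZ (a : Fin n) : F.num * F.cZ a = F.cZ a * F.num + F.cZ a := by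
  rw [num_eq_op, op_cZ]; simp
lemma num_bZ (a : Fin n) : F.num * F.bZ a = F.bZ a * F.num - F.bZ a := by
  rw [num_eq_op, op_bZ]; simp
lemma num_cX : F.num * F.cX = F.cX * F.num := by rw [num_eq_op, op_cX]
lemma num_cY : F.num * F.cY = F.cY * F.num := by rw [num_eq_op, op_cY]
lemma num_smul (r : R) (x : E) : F.num * (r • x) = r • (F.num * x) := by rw [num_eq_op, op_smul]

/-- The degree operator comes from the identity matrix, which is constant and commutes with the
matrices of Christoffel symbols. -/
lemma nab_num (a : Fin n) : F.nab a * F.num = F.num * F.nab a := by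
  rw [num_eq_op, nab, sub_mul, mul_sub, D_op, op_op]
  have h1 : (fun c d : Fin n => 𝒢.der a (if c = d then (1 : R) else 0)) = fun _ _ => 0 := by
    funext c d; split_ifs <;> simp
  have h2 : (fun c d : Fin n => ∑ e, (𝒢.chr e a c * (if e = d then (1 : R) else 0)
      - (if c = e then 1 else 0) * 𝒢.chr d a e)) = fun _ _ => 0 := by
    funext c d; simp
  have h3 : F.op (fun _ _ => 0) = 0 := by simp [op]
  rw [h1, h2, h3]; simp

lemma num_bu (a : Fin n) : F.num * F.bu a = F.bu a * F.num - F.bu a := by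
  simp only [bu, Finset.mul_sum, Finset.sum_mul, num_smul, num_bZ, smul_sub,
    Finset.sum_sub_distrib, smul_mul_assoc]

lemma num_ext : F.num * F.ext = F.ext * F.num + F.ext := by
  simp only [ext, Finset.mul_sum, Finset.sum_mul, ← mul_assoc, num_cZ, add_mul,
    Finset.sum_add_distrib]
  simp only [mul_assoc, nab_num]

lemma num_cod : F.num * F.cod = F.cod * F.num - F.cod := by
  simp only [cod, mul_neg, neg_mul, Finset.mul_sum, Finset.sum_mul, ← mul_assoc, num_bu, sub_mul,
    Finset.sum_sub_distrib]
  simp only [mul_assoc, nab_num]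
  abel

/-- The connection is torsion free: symmetric Christoffel symbols meet anticommuting creation
operators. -/
lemma ext_eq : F.ext = ∑ a, F.cZ a * F.D a := by
  simp only [ext, nab, mul_sub, Finset.sum_sub_distrib]
  rw [sub_eq_self]
  simp only [op, Finset.mul_sum, cZ_smul, ← mul_assoc]
  rw [Finset.sum_comm_cycle]
  refine Finset.sum_eq_zero fun d _ => ?_
  exact sum_symm_smul_skew (fun a e => 𝒢.chr d a e) (fun a e => 𝒢.chr_symm d a e) _
    fun a e => by rw [F.cZ_cZ a e, neg_mul]

lemma ext_ext : F.ext * F.ext = 0 := by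
  have h : ∑ a, ∑ b, (1 : R) • (F.cZ a * F.D a * (F.cZ b * F.D b)) = 0 := by
    refine sum_symm_smul_skew (fun _ _ => 1) (fun _ _ => rfl) _ fun a b => ?_
    have h1 : ∀ a b, F.cZ a * F.D a * (F.cZ b * F.D b)
        = F.cZ a * F.cZ b * (F.D a * F.D b) := fun a b => by
      have h2 : F.D a * F.cZ b = F.cZ b * F.D a := F.D_c _ _
      rw [mul_assoc, ← mul_assoc (F.D a), h2]
      noncomm_ring
    rw [h1, h1, F.D_D, F.cZ_cZ, neg_mul]
  simp only [one_smul] at h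
  rw [ext_eq, Finset.sum_mul]
  simp only [Finset.mul_sum]
  exact h

lemma nab_bu (a b : Fin n) :
    F.nab a * F.bu b = F.bu b * F.nab a - ∑ e, 𝒢.chr b a e • F.bu e := by
  have h1 : ∑ c, 𝒢.gi b c • ∑ d, 𝒢.chr d a c • F.bZ d
      = ∑ c, (∑ f, 𝒢.chr c a f * 𝒢.gi b f) • F.bZ c := by
    simp only [Finset.smul_sum, smul_smul, Finset.sum_smul]
    rw [Finset.sum_comm]
    simp only [mul_comm]
  have h2 : ∑ e, 𝒢.chr b a e • F.bu e = ∑ c, (∑ f, 𝒢.chr b a f * 𝒢.gi f c) • F.bZ c := by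
    simp only [bu, Finset.smul_sum, smul_smul, Finset.sum_smul]
    rw [Finset.sum_comm]
  rw [h2]
  simp only [bu, Finset.mul_sum, nab_smul, nab_bZ, smul_add, Finset.sum_add_distrib, h1,
    𝒢.der_gi, sub_smul, neg_smul, Finset.sum_sub_distrib, Finset.sum_neg_distrib, Finset.sum_mul,
    smul_mul_assoc]
  abel

lemma nab_cl (a b : Fin n) :
    F.nab a * F.cl b = F.cl b * F.nab a + ∑ e, 𝒢.chr e a b • F.cl e := by
  have h1 : ∑ c, 𝒢.g b c • ∑ d, 𝒢.chr c a d • F.cZ d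
      = ∑ c, (∑ f, 𝒢.chr f a c * 𝒢.g b f) • F.cZ c := by
    simp only [Finset.smul_sum, smul_smul, Finset.sum_smul]
    rw [Finset.sum_comm]
    simp only [mul_comm]
  have h2 : ∑ e, 𝒢.chr e a b • F.cl e = ∑ c, (∑ f, 𝒢.chr f a b * 𝒢.g f c) • F.cZ c := by
    simp only [cl, Finset.smul_sum, smul_smul, Finset.sum_smul]
    rw [Finset.sum_comm]
  rw [h2]
  simp only [cl, Finset.mul_sum, nab_smul, nab_cZ, smul_sub, Finset.sum_add_distrib, h1,
    𝒢.der_g', add_smul, Finset.sum_sub_distrib, Finset.sum_mul, smul_mul_assoc]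
  abel

/-- Weitzenböck formula before the curvature is inserted. The anticommutator of `bu a` with `cZ b`
is `g^{ab}` and produces the rough Laplacian; what is left over is contracted with the commutator of
two covariant derivatives. -/
lemma ext_cod_add_cod_ext : F.ext * F.cod + F.cod * F.ext = -F.lapLC
    - ∑ a, ∑ b, F.cZ a * F.bu b * (F.nab a * F.nab b - F.nab b * F.nab a) := by
  have h1 : F.ext * F.cod = -(∑ a, ∑ b, F.cZ a * F.bu b * (F.nab a * F.nab b)
      - ∑ a, ∑ b, ∑ e, 𝒢.chr b a e • (F.cZ a * F.bu e * F.nab b)) := by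
    simp only [ext, cod, mul_neg, Finset.sum_mul, Finset.mul_sum]
    rw [← Finset.sum_sub_distrib]
    congr 1
    rw [Finset.sum_comm]
    refine Finset.sum_congr rfl fun a _ => ?_
    rw [← Finset.sum_sub_distrib]
    refine Finset.sum_congr rfl fun b _ => ?_
    rw [mul_assoc, ← mul_assoc (F.nab a), nab_bu, sub_mul, mul_sub, Finset.sum_mul,
      Finset.mul_sum]
    simp only [smul_mul_assoc, cZ_smul, mul_assoc]
  have h2 : F.cod * F.ext = -(∑ a, ∑ b, F.bu a * F.cZ b * (F.nab a * F.nab b)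
      - ∑ a, ∑ b, ∑ e, 𝒢.chr b a e • (F.bu a * F.cZ e * F.nab b)) := by
    rw [ext, cod, neg_mul, Finset.sum_mul]
    simp only [Finset.mul_sum]
    rw [← Finset.sum_sub_distrib]
    congr 1
    refine Finset.sum_congr rfl fun a _ => ?_
    rw [← Finset.sum_sub_distrib]
    refine Finset.sum_congr rfl fun b _ => ?_
    rw [mul_assoc, ← mul_assoc (F.nab a), nab_cZ, sub_mul, mul_sub, Finset.sum_mul,
      Finset.mul_sum]
    simp only [smul_mul_assoc, bu_smul, mul_assoc]
  have h3 : ∑ a, ∑ b, F.bu a * F.cZ b * (F.nab a * F.nab b)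
      = ∑ a, ∑ b, 𝒢.gi a b • (F.nab a * F.nab b)
        - ∑ a, ∑ b, F.cZ a * F.bu b * (F.nab b * F.nab a) := by
    simp only [bu_cZ, sub_mul, smul_mul_assoc, one_mul, Finset.sum_sub_distrib]
    congr 1
    rw [Finset.sum_comm]
  have h4 : ∑ a, ∑ b, ∑ e, 𝒢.chr b a e • (F.bu a * F.cZ e * F.nab b)
      = ∑ a, ∑ b, 𝒢.gi a b • ∑ c, 𝒢.chr c a b • F.nab c
        - ∑ a, ∑ b, ∑ e, 𝒢.chr b a e • (F.cZ a * F.bu e * F.nab b) := by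
    -- Symmetry of the Christoffel symbols exchanges the derivative index with the form index, so
    -- these first-order terms cancel against those of `d δ`.
    have h5 : ∑ a, ∑ b, ∑ e, 𝒢.chr b a e • (F.cZ a * F.bu e * F.nab b)
        = ∑ a, ∑ b, ∑ e, 𝒢.chr b a e • (F.cZ e * F.bu a * F.nab b) := by
      rw [Finset.sum_comm]
      conv_rhs => rw [Finset.sum_comm]
      refine Finset.sum_congr rfl fun b _ => ?_
      rw [Finset.sum_comm]
      refine Finset.sum_congr rfl fun e _ => Finset.sum_congr rfl fun a _ => ?_
      rw [𝒢.chr_symm]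
    rw [h5]
    simp only [bu_cZ, sub_mul, smul_mul_assoc, one_mul, Finset.sum_sub_distrib, smul_sub]
    congr 1
    refine Finset.sum_congr rfl fun a _ => ?_
    rw [Finset.sum_comm]
    refine Finset.sum_congr rfl fun b _ => ?_
    rw [Finset.smul_sum]
    exact Finset.sum_congr rfl fun c _ => smul_comm _ _ _
  rw [h1, h2, h3, h4, lapLC]
  simp only [mul_sub, smul_sub, Finset.sum_sub_distrib]
  abel

end OpCalc
end
end EinsteinTractor

namespace EinsteinTractor

noncomputable section

namespace OpCalc

set_option linter.unusedSectionVars false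

variable {n : ℕ} {R : Type*} [CommRing R] [Algebra ℝ R] {𝒢 : AlgMetric n R}
  {E : Type*} [Ring E] [Module R E] [IsScalarTower R E E] (F : OpCalc 𝒢 E)

/-! ### Curvature contractions and `δ² = 0` -/

lemma op_riem (a b : Fin n) : F.op (fun c d => -𝒢.riem a b d c)
    = -∑ c, ∑ e, 𝒢.riemL a b e c • (F.cZ c * F.bu e) := by
  simp only [op, ← sum_g_bu, Finset.mul_sum, cZ_smul, smul_smul, Finset.smul_sum,
    AlgMetric.riemL, Finset.sum_smul]
  rw [← Finset.sum_neg_distrib]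
  refine Finset.sum_congr rfl fun c _ => ?_
  rw [← Finset.sum_neg_distrib, Finset.sum_comm]
  refine Finset.sum_congr rfl fun e _ => ?_
  rw [← Finset.sum_neg_distrib]
  refine Finset.sum_congr rfl fun d _ => ?_
  rw [neg_mul, neg_smul, mul_comm, 𝒢.g_symm]

lemma bu_bu_cZ (a b c : Fin n) : F.bu a * F.bu b * F.cZ c
    = 𝒢.gi b c • F.bu a - 𝒢.gi a c • F.bu b + F.cZ c * (F.bu a * F.bu b) := by
  rw [mul_assoc, bu_cZ, mul_sub, bu_smul, mul_one, ← mul_assoc, bu_cZ, sub_mul, smul_mul_assoc,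
    one_mul, mul_assoc]
  abel

/-- The product of three anticommuting insertions is invariant under cyclic permutation, so the
first Bianchi identity says that the sum `S` satisfies `S = -2S`. -/
lemma sum_riemL_bu (c : Fin n) :
    ∑ a, ∑ b, ∑ e, 𝒢.riemL a b e c • (F.bu a * F.bu b * F.bu e) = 0 := by
  have h : ∀ a b e, 𝒢.riemL a b e c = -𝒢.riemL b e a c - 𝒢.riemL e a b c := fun a b e => by
    have h0 : 𝒢.riemL a b c e + 𝒢.riemL b e c a + 𝒢.riemL e a c b = 0 := by
      simp only [AlgMetric.riemL, ← Finset.sum_add_distrib, ← mul_add, 𝒢.riem_bianchi, mul_zero,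
        Finset.sum_const_zero]
    rw [𝒢.riemL_antisymm' a b e c, 𝒢.riemL_antisymm' b e a c, 𝒢.riemL_antisymm' e a b c]
    linear_combination -h0
  have cyc : ∀ a b e, F.bu a * F.bu b * F.bu e = F.bu b * F.bu e * F.bu a := fun a b e => by
    rw [mul_assoc (F.bu b), F.bu_bu e a, mul_neg, ← mul_assoc, F.bu_bu b a, neg_mul, neg_neg]
  set S := ∑ a, ∑ b, ∑ e, 𝒢.riemL a b e c • (F.bu a * F.bu b * F.bu e) with hS
  have h1 : ∑ a, ∑ b, ∑ e, 𝒢.riemL b e a c • (F.bu a * F.bu b * F.bu e) = S := by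
    have h0 : ∀ a b e, 𝒢.riemL b e a c • (F.bu a * F.bu b * F.bu e)
        = 𝒢.riemL b e a c • (F.bu b * F.bu e * F.bu a) := fun a b e => by rw [cyc]
    rw [hS, Finset.sum_congr rfl fun a _ => Finset.sum_congr rfl fun b _ =>
      Finset.sum_congr rfl fun e _ => h0 a b e, Finset.sum_comm]
    exact Finset.sum_congr rfl fun _ _ => Finset.sum_comm
  have h2 : ∑ a, ∑ b, ∑ e, 𝒢.riemL e a b c • (F.bu a * F.bu b * F.bu e) = S := by
    have h0 : ∀ a b e, 𝒢.riemL e a b c • (F.bu a * F.bu b * F.bu e)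
        = 𝒢.riemL e a b c • (F.bu e * F.bu a * F.bu b) := fun a b e => by rw [cyc e]
    rw [hS, Finset.sum_congr rfl fun a _ => Finset.sum_congr rfl fun b _ =>
      Finset.sum_congr rfl fun e _ => h0 a b e, Finset.sum_comm_cycle]
  have h3 : S = -S - S := by
    have h0 : ∀ a b e, 𝒢.riemL a b e c • (F.bu a * F.bu b * F.bu e)
        = -(𝒢.riemL b e a c • (F.bu a * F.bu b * F.bu e))
          - 𝒢.riemL e a b c • (F.bu a * F.bu b * F.bu e) := fun a b e => by
      rw [h, sub_smul, neg_smul]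
    conv_lhs => rw [hS]
    rw [Finset.sum_congr rfl fun a _ => Finset.sum_congr rfl fun b _ =>
      Finset.sum_congr rfl fun e _ => h0 a b e]
    simp only [Finset.sum_sub_distrib, Finset.sum_neg_distrib]
    rw [h1, h2]
  have h4 : (3 : R) • S = 0 := by
    have : (3 : R) = 1 + 1 + 1 := by norm_num
    rw [this, add_smul, add_smul, one_smul]
    nth_rw 1 [h3]; abel
  have h5 : algebraMap ℝ R (1 / 3) * 3 = 1 := by
    have : (3 : R) = algebraMap ℝ R 3 := (map_ofNat _ 3).symm
    rw [this, ← map_mul]; norm_num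
  rw [← one_smul R S, ← h5, mul_smul, h4, smul_zero]

variable {p : R}

/-- The square of `δ` is half a curvature contraction. Normal ordering splits that contraction into
two Ricci terms, which vanish because the Ricci tensor is a multiple of the symmetric metric, and a
term killed by the first Bianchi identity. -/
lemma cod_cod (hE : 𝒢.IsEinsteinWith p) : F.cod * F.cod = 0 := by
  have h1 : F.cod * F.cod = ∑ a, ∑ b, F.bu a * F.bu b * (F.nab a * F.nab b)
      - ∑ b, ∑ a, ∑ e, 𝒢.chr b a e • (F.bu a * F.bu e * F.nab b) := by
    rw [cod, neg_mul_neg, Finset.sum_mul]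
    simp only [Finset.mul_sum]
    rw [Finset.sum_comm (f := fun b a => ∑ e, 𝒢.chr b a e • (F.bu a * F.bu e * F.nab b)),
      ← Finset.sum_sub_distrib]
    refine Finset.sum_congr rfl fun a _ => ?_
    rw [← Finset.sum_sub_distrib]
    refine Finset.sum_congr rfl fun b _ => ?_
    rw [mul_assoc, ← mul_assoc (F.nab a), nab_bu, sub_mul, mul_sub, Finset.sum_mul,
      Finset.mul_sum]
    simp only [smul_mul_assoc, bu_smul, mul_assoc]
  have h2 : ∑ b, ∑ a, ∑ e, 𝒢.chr b a e • (F.bu a * F.bu e * F.nab b) = 0 :=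
    Finset.sum_eq_zero fun b _ => sum_symm_smul_skew (fun a e => 𝒢.chr b a e)
      (fun a e => 𝒢.chr_symm b a e) _ fun a e => by rw [F.bu_bu a e, neg_mul]
  have h3 : ∑ a, ∑ b, F.bu a * F.bu b * (F.nab a * F.nab b - F.nab b * F.nab a) = 0 := by
    simp only [nab_nab, op_riem, mul_neg, Finset.sum_neg_distrib, neg_eq_zero]
    simp only [Finset.mul_sum, bu_smul, mul_assoc]
    have h4 : ∀ a b c e, F.bu a * (F.bu b * (F.cZ c * F.bu e))
        = 𝒢.gi b c • (F.bu a * F.bu e) - 𝒢.gi a c • (F.bu b * F.bu e)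
          + F.cZ c * (F.bu a * F.bu b * F.bu e) := fun a b c e => by
      rw [← mul_assoc, ← mul_assoc, bu_bu_cZ, add_mul, sub_mul, smul_mul_assoc, smul_mul_assoc,
        mul_assoc (F.cZ c)]
    simp only [h4, smul_add, smul_sub, Finset.sum_add_distrib, Finset.sum_sub_distrib, smul_smul]
    have sg : ∑ a, ∑ e, 𝒢.g a e • (F.bu a * F.bu e) = 0 :=
      sum_symm_smul_skew _ 𝒢.g_symm _ fun a e => F.bu_bu a e
    have t1 : ∑ a, ∑ b, ∑ c, ∑ e, (𝒢.riemL a b e c * 𝒢.gi b c) • (F.bu a * F.bu e) = 0 := by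
      have : ∀ a, ∑ b, ∑ c, ∑ e, (𝒢.riemL a b e c * 𝒢.gi b c) • (F.bu a * F.bu e)
          = (2 * ((n : R) - 1) * p) • ∑ e, 𝒢.g a e • (F.bu a * F.bu e) := fun a => by
        rw [Finset.smul_sum, Finset.sum_comm_cycle]
        refine Finset.sum_congr rfl fun e _ => ?_
        rw [smul_smul, ← hE, ← 𝒢.trace_riemL, Finset.sum_smul]
        refine Finset.sum_congr rfl fun b _ => ?_
        rw [Finset.sum_smul]
        refine Finset.sum_congr rfl fun c _ => ?_
        rw [𝒢.riemL_antisymm, 𝒢.riemL_antisymm', neg_neg, mul_comm]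
      simp only [this, ← Finset.smul_sum, sg, smul_zero]
    have t2 : ∑ a, ∑ b, ∑ c, ∑ e, (𝒢.riemL a b e c * 𝒢.gi a c) • (F.bu b * F.bu e) = 0 := by
      rw [Finset.sum_comm, ← neg_eq_zero, ← t1]
      simp only [← Finset.sum_neg_distrib]
      refine Finset.sum_congr rfl fun b _ => Finset.sum_congr rfl fun a _ =>
        Finset.sum_congr rfl fun c _ => Finset.sum_congr rfl fun e _ => ?_
      rw [𝒢.riemL_antisymm a b, neg_mul, neg_smul, neg_neg]
    have t3 : ∑ a, ∑ b, ∑ c, ∑ e, 𝒢.riemL a b e c • (F.cZ c * (F.bu a * F.bu b * F.bu e)) = 0 := by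
      have : ∑ a, ∑ b, ∑ c, ∑ e, 𝒢.riemL a b e c • (F.cZ c * (F.bu a * F.bu b * F.bu e))
          = ∑ c, F.cZ c * ∑ a, ∑ b, ∑ e, 𝒢.riemL a b e c • (F.bu a * F.bu b * F.bu e) := by
        simp only [Finset.mul_sum, cZ_smul]
        rw [Finset.sum_comm (t := Finset.univ)]
        rw [Finset.sum_comm]
        conv_rhs => rw [Finset.sum_comm]
        refine Finset.sum_congr rfl fun a _ => ?_
        rw [Finset.sum_comm]
      simp only [this, sum_riemL_bu, mul_zero, Finset.sum_const_zero]
    rw [t1, t2, t3]; simp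
  have h5 : ∑ a, ∑ b, F.bu a * F.bu b * (F.nab b * F.nab a)
      = -∑ a, ∑ b, F.bu a * F.bu b * (F.nab a * F.nab b) := by
    rw [Finset.sum_comm, ← Finset.sum_neg_distrib]
    refine Finset.sum_congr rfl fun a _ => ?_
    rw [← Finset.sum_neg_distrib]
    exact Finset.sum_congr rfl fun b _ => by rw [F.bu_bu b a, neg_mul]
  simp only [mul_sub, Finset.sum_sub_distrib] at h3
  rw [h5] at h3
  rw [h1, h2, sub_zero]
  exact eq_zero_of_eq_neg R (sub_eq_zero.mp h3)

/-! ### The curvature term and its Weitzenböck formula -/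

/-- The `Z`-components of the tractor curvature. -/
def Kmat (𝒢 : AlgMetric n R) (p : R) (a b c d : Fin n) : R :=
  -𝒢.riem a b d c
    - 2 * p * (𝒢.g a c * (if d = b then 1 else 0) - 𝒢.g b c * (if d = a then 1 else 0))

/-- The curvature of the tractor connection. -/
def Kop (p : R) (a b : Fin n) : E := F.op (Kmat 𝒢 p a b)

/-- The tractor curvature is split into a commutator of covariant derivatives, which feeds the
Weitzenböck formula, and a constant curvature part, which is algebraic. -/
lemma Kop_eq (a b : Fin n) : F.Kop p a b = F.nab a * F.nab b - F.nab b * F.nab a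
    - (2 * p) • (F.cl a * F.bZ b - F.cl b * F.bZ a) := by
  have h : ∀ a b, F.cl a * F.bZ b = F.op fun c d => 𝒢.g a c * (if d = b then 1 else 0) :=
    fun a b => by
      simp only [cl, Finset.sum_mul, smul_mul_assoc, op, mul_ite, mul_one, mul_zero, ite_smul,
        zero_smul, Finset.sum_ite_eq', Finset.mem_univ, if_true]
  have hs : ∀ (r : R) (M : Fin n → Fin n → R), r • F.op M = F.op (r • M) := fun r M => by
    simp [op, Finset.smul_sum, smul_smul]
  rw [nab_nab, h, h, op_sub, hs, op_sub]
  rfl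

/-- The curvature term of the modified tractor Laplacian. -/
def weyl (p : R) : E := ∑ a, ∑ b, F.cZ a * F.bu b * F.Kop p a b

/-- Normal ordering costs one contraction of the curvature, which vanishes by the trace hypothesis.
With two annihilators on the right the operator kills tensors of degree one. -/
lemma weyl_eq_sum (h : ∀ a d, ∑ b, ∑ c, 𝒢.gi b c * Kmat 𝒢 p a b c d = 0) : F.weyl p
    = ∑ a, ∑ b, ∑ c, ∑ d, (-Kmat 𝒢 p a b c d) • (F.cZ a * (F.cZ c * (F.bu b * F.bZ d))) := by
  have h0 : ∑ a, ∑ b, ∑ c, ∑ d, (𝒢.gi b c * Kmat 𝒢 p a b c d) • (F.cZ a * F.bZ d) = 0 := by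
    refine Finset.sum_eq_zero fun a _ => ?_
    rw [Finset.sum_comm_cycle]
    refine Finset.sum_eq_zero fun d _ => ?_
    simp only [← Finset.sum_smul, h, zero_smul]
  rw [← sub_zero (F.weyl p), ← h0]
  simp only [weyl, Kop, op, Finset.mul_sum, ← Finset.sum_sub_distrib]
  refine Finset.sum_congr rfl fun a _ => Finset.sum_congr rfl fun b _ =>
    Finset.sum_congr rfl fun c _ => Finset.sum_congr rfl fun d _ => ?_
  rw [mul_assoc, bu_smul, cZ_smul, ← mul_assoc (F.bu b), bu_cZ, sub_mul, mul_sub, smul_mul_assoc,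
    cZ_smul, one_mul, mul_assoc, smul_sub, smul_smul, mul_comm (𝒢.gi b c), neg_smul]
  abel

lemma sum_bZ_cZ : ∑ a, F.bZ a * F.cZ a = (n : E) - F.num := by
  simp [bZ_cZ, num]

lemma sum_bu_cl : ∑ a, F.bu a * F.cl a = (n : E) - F.num := by
  simp [bu_cl, sum_cl_bu]

/-- The commutator part of `Kop_eq` is the curvature term of the Weitzenböck formula. The constant
curvature part contributes the two contractions `N` and `N(n-N) + N`; their difference, multiplied
by `-2p`, is the last term. -/
lemma weyl_eq : F.weyl p = -F.lapLC - (F.ext * F.cod + F.cod * F.ext)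
    + (2 * p) • (F.num * ((n : E) - F.num)) := by
  have h1 : ∑ a, ∑ b, F.cZ a * F.bu b * (F.cl a * F.bZ b) = F.num := by
    have : ∀ a b, F.cZ a * F.bu b * (F.cl a * F.bZ b)
        = (if b = a then F.cZ a * F.bZ b else 0)
          - F.cZ a * F.cl a * (F.bu b * F.bZ b) := fun a b => by
      rw [mul_assoc, ← mul_assoc (F.bu b), bu_cl, sub_mul, mul_sub]
      split_ifs <;> simp [mul_assoc]
    simp only [this, Finset.sum_sub_distrib, ← Finset.mul_sum, ← Finset.sum_mul]
    have h0 : ∑ a, F.cZ a * F.cl a = 0 := by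
      simp only [cl, Finset.mul_sum, cZ_smul]
      exact sum_symm_smul_skew _ 𝒢.g_symm _ F.cZ_cZ
    rw [h0]
    simp [num]
  have h2 : ∑ a, ∑ b, F.cZ a * F.bu b * (F.cl b * F.bZ a)
      = F.num * ((n : E) - F.num) + F.num := by
    have : ∀ a b, F.cZ a * F.bu b * (F.cl b * F.bZ a)
        = F.cZ a * ((F.bu b * F.cl b) * F.bZ a) := fun a b => by noncomm_ring
    simp only [this, ← Finset.mul_sum, ← Finset.sum_mul, sum_bu_cl, sub_mul, num_bZ]
    have h3 : ∀ a, F.cZ a * ((n : E) * F.bZ a - (F.bZ a * F.num - F.bZ a))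
        = F.cZ a * F.bZ a * ((n : E) - F.num) + F.cZ a * F.bZ a := fun a => by
      rw [(Nat.cast_commute n (F.bZ a)).eq]; noncomm_ring
    simp only [h3, Finset.sum_add_distrib, ← Finset.sum_mul]
    rfl
  have cs : ∀ a b (r : R) x, F.cZ a * F.bu b * (r • x) = r • (F.cZ a * F.bu b * x) :=
    fun a b r x => by rw [mul_assoc, bu_smul, cZ_smul, mul_assoc]
  simp only [weyl, Kop_eq]
  simp only [mul_sub (F.cZ _ * F.bu _) _ ((2 * p) • _), cs, Finset.sum_sub_distrib,
    ← Finset.smul_sum]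
  simp only [mul_sub (F.cZ _ * F.bu _) (F.cl _ * _), Finset.sum_sub_distrib, h1, h2]
  rw [ext_cod_add_cod_ext]
  simp only [smul_sub, smul_add]
  abel

/-! ### The tractor connection and the tractor Laplacian -/

/-- The creation operator `cY + p cX`. -/
def theta (p : R) : E := F.cY + p • F.cX

/-- The annihilation operator `p bY + bX`. -/
def beta (p : R) : E := p • F.bY + F.bX

/-- The tractor connection. -/
def tr (p : R) (a : Fin n) : E := F.nab a + (F.cl a * F.beta p - F.theta p * F.bZ a)

/-- The tractor Laplacian. -/
def lapT (p : R) : E :=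
  ∑ a, ∑ b, 𝒢.gi a b • (F.tr p a * F.tr p b - ∑ c, 𝒢.chr c a b • F.tr p c)

lemma theta_bZ (a : Fin n) : F.bZ a * F.theta p = -(F.theta p * F.bZ a) := by
  simp only [theta, mul_add, F.b_smul, add_mul, smul_mul_assoc, bZ, cY, cX, F.b_c]
  simp [add_comm]

lemma theta_theta : F.theta p * F.theta p = 0 := by
  refine eq_zero_of_eq_neg R ?_
  simp only [theta, mul_add, add_mul, smul_mul_assoc, cX, cY, F.c_smul, neg_add]
  have h1 := F.c_c (.inl ()) (.inl ())
  have h2 := F.c_c (.inl ()) (.inr (.inr ()))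
  have h3 := F.c_c (.inr (.inr ())) (.inr (.inr ()))
  nth_rw 1 [h1, h2, h3]
  simp only [h2, smul_neg, neg_neg]
  abel

lemma beta_cZ (a : Fin n) : F.beta p * F.cZ a = -(F.cZ a * F.beta p) := by
  simp only [beta, mul_add, add_mul, smul_mul_assoc, cZ, bY, bX, F.b_c, F.c_smul]
  simp [add_comm]

lemma beta_bZ (a : Fin n) : F.beta p * F.bZ a = -(F.bZ a * F.beta p) := by
  simp only [beta, mul_add, add_mul, smul_mul_assoc, bZ, bY, bX, neg_add, F.b_smul,
    F.b_b _ (.inr (.inl a)), smul_neg]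

lemma theta_smul (r : R) (x : E) : F.theta p * (r • x) = r • (F.theta p * x) := by
  simp only [theta, cX, cY, add_mul, smul_mul_assoc, F.c_smul, smul_add, smul_comm p r]

lemma beta_smul (r : R) (x : E) : F.beta p * (r • x) = r • (F.beta p * x) := by
  simp only [beta, bX, bY, add_mul, smul_mul_assoc, F.b_smul, smul_add, smul_comm p r]

lemma beta_cl (a : Fin n) : F.beta p * F.cl a = -(F.cl a * F.beta p) := by
  simp only [cl, Finset.mul_sum, Finset.sum_mul, beta_smul, beta_cZ, smul_neg, smul_mul_assoc,
    Finset.sum_neg_distrib]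

lemma beta_beta : F.beta p * F.beta p = 0 := by
  refine eq_zero_of_eq_neg R ?_
  simp only [beta, mul_add, add_mul, smul_mul_assoc, bX, bY, F.b_smul, neg_add]
  have h1 := F.b_b (.inl ()) (.inl ())
  have h2 := F.b_b (.inl ()) (.inr (.inr ()))
  have h3 := F.b_b (.inr (.inr ())) (.inr (.inr ()))
  nth_rw 1 [h1, h2, h3]
  simp only [h2, smul_neg, neg_neg]
  abel

lemma theta_beta_add : F.theta p * F.beta p + F.beta p * F.theta p = (2 * p) • 1 := by
  simp only [theta, beta, mul_add, add_mul, smul_mul_assoc, bX, bY, cX, cY, F.b_smul, F.c_smul, F.b_c]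
  simp only [reduceCtorEq, if_true, if_false, smul_sub, zero_sub, smul_neg, two_mul, add_smul]
  abel

lemma nab_theta (hp : ∀ a, 𝒢.der a p = 0) (a : Fin n) :
    F.nab a * F.theta p = F.theta p * F.nab a := by
  simp only [theta, mul_add, add_mul, nab_smul, nab_cX, nab_cY, hp, zero_smul, add_zero,
    smul_mul_assoc]

lemma nab_beta (hp : ∀ a, 𝒢.der a p = 0) (a : Fin n) :
    F.nab a * F.beta p = F.beta p * F.nab a := by
  simp only [beta, mul_add, add_mul, nab_smul, nab_bX, nab_bY, hp, zero_smul, add_zero,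
    smul_mul_assoc]

lemma num_theta : F.num * F.theta p = F.theta p * F.num := by
  simp only [theta, mul_add, add_mul, num_smul, num_cX, num_cY, smul_mul_assoc]

/-- The algebraic part `N a = cl_a β - θ bZ_a` of the tractor connection is parallel up to its
covector index, because `p` is constant. Expanding the square therefore gives the rough Laplacian,
two equal cross terms `θδ - βd`, and a term quadratic in `N`. -/
lemma lapT_eq (hp : ∀ a, 𝒢.der a p = 0) : F.lapT p = F.lapLC
    + (2 : R) • (F.theta p * F.cod - F.beta p * F.ext)
    - ((n : E) - F.num) * (F.theta p * F.beta p) - F.num * (F.beta p * F.theta p) := by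
  set N : Fin n → E := fun a => F.cl a * F.beta p - F.theta p * F.bZ a with hN
  have hnN : ∀ a b, F.nab a * N b = N b * F.nab a + ∑ e, 𝒢.chr e a b • N e := fun a b => by
    simp only [hN, mul_sub, sub_mul, ← mul_assoc, nab_cl, F.nab_theta hp, add_mul, smul_sub,
      Finset.sum_sub_distrib, Finset.sum_mul, smul_mul_assoc]
    simp only [mul_assoc, F.nab_beta hp, nab_bZ, mul_add, Finset.mul_sum, theta_smul]
    abel
  have hNn : ∑ a, ∑ b, 𝒢.gi a b • (N a * F.nab b) = F.theta p * F.cod - F.beta p * F.ext := by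
    simp only [hN, sub_mul, smul_sub, Finset.sum_sub_distrib]
    have e1 : ∑ a, ∑ b, 𝒢.gi a b • (F.cl a * F.beta p * F.nab b) = -(F.beta p * F.ext) := by
      rw [Finset.sum_comm, ext, Finset.mul_sum, ← Finset.sum_neg_distrib]
      refine Finset.sum_congr rfl fun b _ => ?_
      rw [← mul_assoc, beta_cZ, neg_mul, neg_neg, ← sum_gi_cl, Finset.sum_mul, Finset.sum_mul]
      simp only [smul_mul_assoc, 𝒢.gi_symm b]
    have e2 : ∑ a, ∑ b, 𝒢.gi a b • (F.theta p * F.bZ a * F.nab b) = -(F.theta p * F.cod) := by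
      rw [Finset.sum_comm, cod, mul_neg, neg_neg, Finset.mul_sum]
      refine Finset.sum_congr rfl fun b _ => ?_
      rw [bu, Finset.sum_mul, Finset.mul_sum]
      simp only [smul_mul_assoc, theta_smul, mul_assoc, 𝒢.gi_symm b]
    rw [e1, e2]; abel
  have hNN : ∑ a, ∑ b, 𝒢.gi a b • (N a * N b)
      = -(((n : E) - F.num) * (F.theta p * F.beta p)) - F.num * (F.beta p * F.theta p) := by
    -- The pure products vanish because `β² = 0` and `θ² = 0`; only the mixed ones survive.
    have e : ∀ a b, N a * N b = -(F.cl a * (F.beta p * F.theta p) * F.bZ b)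
        - F.theta p * (F.bZ a * F.cl b) * F.beta p := fun a b => by
      have x1 : F.cl a * F.beta p * (F.cl b * F.beta p) = 0 := by
        rw [mul_assoc, ← mul_assoc (F.beta p), beta_cl, neg_mul, mul_assoc, beta_beta]; simp
      have x2 : F.theta p * F.bZ a * (F.theta p * F.bZ b) = 0 := by
        rw [mul_assoc, ← mul_assoc (F.bZ a), theta_bZ, neg_mul, mul_neg, mul_assoc,
          ← mul_assoc (F.theta p), theta_theta]; simp
      simp only [hN, mul_sub, sub_mul, x1, x2]
      noncomm_ring
    have e1 : ∑ a, ∑ b, 𝒢.gi a b • (F.cl a * (F.beta p * F.theta p) * F.bZ b)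
        = F.num * (F.beta p * F.theta p) := by
      rw [Finset.sum_comm, num, Finset.sum_mul]
      refine Finset.sum_congr rfl fun b _ => ?_
      have : F.bZ b * (F.beta p * F.theta p) = F.beta p * F.theta p * F.bZ b := by
        have h : F.bZ b * F.beta p = -(F.beta p * F.bZ b) := by rw [beta_bZ, neg_neg]
        rw [← mul_assoc, h, neg_mul, mul_assoc, theta_bZ, mul_neg, neg_neg, mul_assoc]
      rw [mul_assoc, this, ← sum_gi_cl, Finset.sum_mul]
      simp only [smul_mul_assoc, 𝒢.gi_symm b, mul_assoc]
    have e2 : ∑ a, ∑ b, 𝒢.gi a b • (F.theta p * (F.bZ a * F.cl b) * F.beta p)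
        = ((n : E) - F.num) * (F.theta p * F.beta p) := by
      rw [← sum_bZ_cZ, sum_bZ_cZ, ← mul_assoc, sub_mul, (Nat.cast_commute n (F.theta p)).eq,
        num_theta, ← mul_sub, ← sum_bZ_cZ, Finset.mul_sum, Finset.sum_mul]
      refine Finset.sum_congr rfl fun a _ => ?_
      rw [← sum_gi_cl, Finset.mul_sum, Finset.mul_sum, Finset.sum_mul]
      simp only [bZ_smul, theta_smul, smul_mul_assoc]
    simp only [e, smul_sub, smul_neg, Finset.sum_sub_distrib, Finset.sum_neg_distrib, e1, e2]
    abel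
  have hNn' : ∑ a, ∑ b, 𝒢.gi a b • (N b * F.nab a) = F.theta p * F.cod - F.beta p * F.ext := by
    rw [← hNn, Finset.sum_comm]
    simp only [𝒢.gi_symm]
  have e0 : ∀ a b, F.tr p a * F.tr p b - ∑ c, 𝒢.chr c a b • F.tr p c
      = (F.nab a * F.nab b - ∑ c, 𝒢.chr c a b • F.nab c) + N a * F.nab b + N b * F.nab a
        + N a * N b := fun a b => by
    have : ∀ a, F.tr p a = F.nab a + N a := fun _ => rfl
    simp only [this, mul_add, add_mul, hnN, smul_add, Finset.sum_add_distrib]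
    abel
  simp only [lapT, e0, smul_add, Finset.sum_add_distrib, hNn, hNn', hNN, two_smul]
  rw [lapLC]
  abel

/-! ### The modified tractor Laplacian in terms of `d` and `δ` -/

/-- The modified tractor Laplacian `I^A 𝔻_A` on tractors of weight `w`. -/
def box (p : R) (w : R) : E :=
  -F.lapT p - (2 * p * (w * ((n : R) + w - 1))) • 1 - F.weyl p

/-- The rough Laplacian cancels between `lapT_eq` and `weyl_eq`. This is what the `W♯♯` modification
achieves: it replaces the rough Laplacian by `dδ + δd`. -/
lemma box_eq (hp : ∀ a, 𝒢.der a p = 0) (w : R) : F.box p w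
    = F.ext * F.cod + F.cod * F.ext - (2 * p) • (F.num * ((n : E) - F.num))
      - (2 * p * (w * ((n : R) + w - 1))) • 1
      - (2 : R) • (F.theta p * F.cod - F.beta p * F.ext)
      + ((n : E) - F.num) * (F.theta p * F.beta p) + F.num * (F.beta p * F.theta p) := by
  rw [box, F.lapT_eq hp, weyl_eq]
  abel

end OpCalc
end
end EinsteinTractor

namespace EinsteinTractor

noncomputable section

namespace OpCalc

set_option linter.unusedSectionVars false

variable {n : ℕ} {R : Type*} [CommRing R] [Algebra ℝ R] {𝒢 : AlgMetric n R}
  {E : Type*} [Ring E] [Module R E] [IsScalarTower R E E] (F : OpCalc 𝒢 E)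

/-! ### Action on vectors -/

lemma bY_cZ (a : Fin n) : F.bY * F.cZ a = -(F.cZ a * F.bY) := by simp [bY, cZ, F.b_c]
lemma bX_cZ (a : Fin n) : F.bX * F.cZ a = -(F.cZ a * F.bX) := by simp [bX, cZ, F.b_c]
lemma cY_cZ (a : Fin n) : F.cY * F.cZ a = -(F.cZ a * F.cY) := F.c_c _ _
lemma cX_cZ (a : Fin n) : F.cX * F.cZ a = -(F.cZ a * F.cX) := F.c_c _ _
lemma bY_bu (a : Fin n) : F.bY * F.bu a = -(F.bu a * F.bY) := by
  simp only [bu, bY, bZ, Finset.mul_sum, Finset.sum_mul, F.b_smul, F.b_b (.inl ()), smul_neg,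
    smul_mul_assoc, Finset.sum_neg_distrib]
lemma bX_bu (a : Fin n) : F.bX * F.bu a = -(F.bu a * F.bX) := by
  simp only [bu, bX, bZ, Finset.mul_sum, Finset.sum_mul, F.b_smul, F.b_b (.inr (.inr ())), smul_neg,
    smul_mul_assoc, Finset.sum_neg_distrib]
lemma cY_bu (a : Fin n) : F.cY * F.bu a = -(F.bu a * F.cY) := by
  simp [bu, cY, bZ, Finset.mul_sum, Finset.sum_mul, F.c_smul, F.b_c, smul_mul_assoc]
lemma cX_bu (a : Fin n) : F.cX * F.bu a = -(F.bu a * F.cX) := by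
  simp [bu, cX, bZ, Finset.mul_sum, Finset.sum_mul, F.c_smul, F.b_c, smul_mul_assoc]

/-- The odd frame operators in the `X` and `Y` directions are parallel and anticommute with `cZ`, so
`d` passes them with a sign; this is how the slots are separated. -/
lemma anticomm_ext {x : E} (h1 : ∀ a, x * F.cZ a = -(F.cZ a * x))
    (h2 : ∀ a, F.nab a * x = x * F.nab a) : x * F.ext = -(F.ext * x) := by
  simp only [ext, Finset.mul_sum, Finset.sum_mul, ← mul_assoc, h1]
  simp only [mul_assoc, h2, neg_mul, Finset.sum_neg_distrib]

lemma anticomm_cod {x : E} (h1 : ∀ a, x * F.bu a = -(F.bu a * x))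
    (h2 : ∀ a, F.nab a * x = x * F.nab a) : x * F.cod = -(F.cod * x) := by
  simp only [cod, mul_neg, neg_mul, Finset.mul_sum, Finset.sum_mul, ← mul_assoc, h1]
  simp only [mul_assoc, h2, Finset.sum_neg_distrib]

lemma bY_ext : F.bY * F.ext = -(F.ext * F.bY) := F.anticomm_ext F.bY_cZ F.nab_bY
lemma bX_ext : F.bX * F.ext = -(F.ext * F.bX) := F.anticomm_ext F.bX_cZ F.nab_bX
lemma cY_ext : F.cY * F.ext = -(F.ext * F.cY) := F.anticomm_ext F.cY_cZ F.nab_cY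
lemma cX_ext : F.cX * F.ext = -(F.ext * F.cX) := F.anticomm_ext F.cX_cZ F.nab_cX
lemma bY_cod : F.bY * F.cod = -(F.cod * F.bY) := F.anticomm_cod F.bY_bu F.nab_bY
lemma bX_cod : F.bX * F.cod = -(F.cod * F.bX) := F.anticomm_cod F.bX_bu F.nab_bX
lemma cY_cod : F.cY * F.cod = -(F.cod * F.cY) := F.anticomm_cod F.cY_bu F.nab_cY
lemma cX_cod : F.cX * F.cod = -(F.cod * F.cX) := F.anticomm_cod F.cX_bu F.nab_cX

lemma ext_smul {r : R} (hr : ∀ a, 𝒢.der a r = 0) (x : E) : F.ext * (r • x) = r • (F.ext * x) := by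
  simp only [ext, Finset.sum_mul, Finset.smul_sum, mul_assoc, nab_smul, hr, zero_smul, add_zero,
    cZ_smul]

lemma cod_smul {r : R} (hr : ∀ a, 𝒢.der a r = 0) (x : E) : F.cod * (r • x) = r • (F.cod * x) := by
  simp only [cod, neg_mul, smul_neg, Finset.sum_mul, Finset.smul_sum, mul_assoc, nab_smul, hr,
    zero_smul, add_zero, bu_smul]

variable {A : Type*} [AddCommGroup A] [Module E A] [Module R A] [IsScalarTower R E A]

/-- The action of an operator on a vector, as an opaque-to-`module` function. -/
def ap (x : E) (φ : A) : A := x • φ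

lemma smul_eq_ap (x : E) (φ : A) : x • φ = ap x φ := rfl

/-- Transfers linearity over `R` from operators to vectors. -/
lemma smul_vec {x : E} {r : R} (h : ∀ y : E, x * (r • y) = r • (x * y)) (φ : A) :
    x • r • φ = r • x • φ := by
  rw [← one_smul E φ, ← smul_assoc r (1 : E) φ, ← mul_smul, h, mul_one, smul_assoc, one_smul]

/-- Sections of the form part of degree `κ`. -/
structure IsForm (κ : R) (φ : A) : Prop where
  bY : F.bY • φ = 0
  bX : F.bX • φ = 0
  num : F.num • φ = κ • φ

variable {F} {κ : R} {φ ψ : A}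

lemma IsForm.add (h : F.IsForm κ φ) (h' : F.IsForm κ ψ) : F.IsForm κ (φ + ψ) :=
  ⟨by rw [smul_add, h.bY, h'.bY, add_zero], by rw [smul_add, h.bX, h'.bX, add_zero],
    by rw [smul_add, h.num, h'.num, smul_add]⟩

lemma IsForm.smul (h : F.IsForm κ φ) (r : R) : F.IsForm κ (r • φ) :=
  ⟨by rw [OpCalc.bY, smul_vec (F.b_smul _ r), ← OpCalc.bY, h.bY, smul_zero], by
    rw [OpCalc.bX, smul_vec (F.b_smul _ r), ← OpCalc.bX, h.bX, smul_zero], by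
    rw [smul_vec (F.num_smul r), h.num, smul_comm]⟩

lemma IsForm.ext (hκ : ∀ a, 𝒢.der a κ = 0) (h : F.IsForm κ φ) : F.IsForm (κ + 1) (F.ext • φ) :=
  ⟨by rw [← mul_smul, bY_ext, neg_smul, mul_smul, h.bY, smul_zero, neg_zero], by
    rw [← mul_smul, bX_ext, neg_smul, mul_smul, h.bX, smul_zero, neg_zero], by
    rw [← mul_smul, num_ext, add_smul, mul_smul, h.num, smul_vec (F.ext_smul hκ), add_smul,
      one_smul]⟩

lemma IsForm.cod (hκ : ∀ a, 𝒢.der a κ = 0) (h : F.IsForm κ φ) : F.IsForm (κ - 1) (F.cod • φ) :=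
  ⟨by rw [← mul_smul, bY_cod, neg_smul, mul_smul, h.bY, smul_zero, neg_zero], by
    rw [← mul_smul, bX_cod, neg_smul, mul_smul, h.bX, smul_zero, neg_zero], by
    rw [← mul_smul, num_cod, sub_smul, mul_smul, h.num, smul_vec (F.cod_smul hκ), sub_smul,
      one_smul]⟩

variable {p : R}

lemma IsForm.beta (h : F.IsForm κ φ) : F.beta p • φ = 0 := by
  rw [OpCalc.beta, add_smul, smul_assoc, h.bY, h.bX, smul_zero, add_zero]

lemma IsForm.beta_cY (h : F.IsForm κ φ) : F.beta p • F.cY • φ = p • φ := by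
  rw [OpCalc.beta, add_smul, smul_assoc, ← mul_smul, ← mul_smul, OpCalc.bY, OpCalc.bX, OpCalc.cY,
    F.b_c, F.b_c, sub_smul, sub_smul, mul_smul, mul_smul, ← OpCalc.bY, ← OpCalc.bX, h.bY, h.bX]
  simp

lemma IsForm.beta_cX (h : F.IsForm κ φ) : F.beta p • F.cX • φ = φ := by
  rw [OpCalc.beta, add_smul, smul_assoc, ← mul_smul, ← mul_smul, OpCalc.bY, OpCalc.bX, OpCalc.cX,
    F.b_c, F.b_c, sub_smul, sub_smul, mul_smul, mul_smul, ← OpCalc.bY, ← OpCalc.bX, h.bY, h.bX]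
  simp

lemma theta_vec (φ : A) : F.theta p • φ = F.cY • φ + p • F.cX • φ := by
  rw [OpCalc.theta, add_smul, smul_assoc]

lemma beta_theta_vec (φ : A) : F.beta p • F.theta p • φ
    = (2 * p) • φ - F.theta p • F.beta p • φ := by
  rw [← mul_smul, ← mul_smul, eq_sub_iff_add_eq, ← add_smul, add_comm, theta_beta_add,
    smul_assoc, one_smul]

lemma box_vec (hp : ∀ a, 𝒢.der a p = 0) (w : R) (φ : A) : F.box p w • φ
    = F.ext • F.cod • φ + F.cod • F.ext • φ - (2 * p) • ((n : R) • F.num • φ - F.num • F.num • φ)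
      - (2 * p * (w * ((n : R) + w - 1))) • φ
      - (2 : R) • (F.theta p • F.cod • φ - F.beta p • F.ext • φ)
      + ((n : R) • (F.theta p • F.beta p • φ) - F.num • F.theta p • F.beta p • φ)
      + F.num • ((2 * p) • φ - F.theta p • F.beta p • φ) := by
  have hn : ∀ φ : A, (n : E) • φ = (n : R) • φ := fun φ => by
    rw [Nat.cast_smul_eq_nsmul, Nat.cast_smul_eq_nsmul]
  rw [F.box_eq hp, ← beta_theta_vec]
  have e1 : F.num * ((n : E) - F.num) = (n : E) * F.num - F.num * F.num := by
    rw [mul_sub, (Nat.cast_commute n F.num).eq]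
  simp only [e1, add_smul, sub_smul, smul_assoc, mul_smul, hn, one_smul]

/-- The modified tractor Laplacian on the middle slot. -/
lemma box_mid (hp : ∀ a, 𝒢.der a p = 0) (w : R) (hκ : ∀ a, 𝒢.der a κ = 0)
    (h : F.IsForm κ φ) : F.box p w • φ
    = F.cY • (-(2 : R) • F.cod • φ) + (F.ext • F.cod • φ + F.cod • F.ext • φ
        - (2 * p * (κ * (n - κ - 1) + w * (n + w - 1))) • φ)
      + F.cX • (-(2 * p) • F.cod • φ) := by
  rw [box_vec hp]
  simp only [h.beta, (h.ext hκ).beta, smul_zero, theta_vec, sub_zero, h.num,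
    smul_vec (F.num_smul _), smul_vec (F.c_smul _ _), cX, cY]
  -- Hiding the operator action leaves an identity that is linear over `R` in finitely many vectors,
  -- which `module` decides.
  simp only [smul_eq_ap (E := E)]
  module

/-- The modified tractor Laplacian on the top slot. -/
lemma box_top (hp : ∀ a, 𝒢.der a p = 0) (w : R) (hκ : ∀ a, 𝒢.der a κ = 0)
    (h : F.IsForm (κ - 1) φ) (h0 : F.cod • φ = 0) : F.box p w • F.cY • φ
    = F.cY • (F.cod • F.ext • φ
        + (n * p - 2 * p * ((κ - 1) * (n - κ + 1) + w * (n + w - 1))) • φ)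
      + (-(2 * p) • F.ext • φ) + F.cX • (((n - 2 * κ + 2) * p ^ 2) • φ) := by
  -- A form in the top or bottom slot of a tractor form of degree `κ` has degree `κ - 1`.
  have hκ' : ∀ a, 𝒢.der a (κ - 1) = 0 := fun a => by simp [hκ]
  have e1 : ∀ φ : A, F.cod • F.cY • φ = -(F.cY • F.cod • φ) := fun φ => by
    rw [← mul_smul, ← mul_smul, cY_cod, neg_smul, neg_neg]
  have e2 : ∀ φ : A, F.ext • F.cY • φ = -(F.cY • F.ext • φ) := fun φ => by
    rw [← mul_smul, ← mul_smul, cY_ext, neg_smul, neg_neg]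
  have e3 : ∀ φ : A, F.num • F.cY • φ = F.cY • F.num • φ := fun φ => by
    rw [← mul_smul, ← mul_smul, num_cY]
  have e4 : ∀ φ : A, F.num • F.cX • φ = F.cX • F.num • φ := fun φ => by
    rw [← mul_smul, ← mul_smul, num_cX]
  rw [box_vec hp]
  simp only [e1, e2, h0, smul_neg, smul_zero, neg_neg, neg_zero, h.beta_cY, (h.ext hκ').beta_cY,
    theta_vec, e3, e4, h.num, smul_sub, smul_add, smul_vec (F.num_smul _)]
  simp only [smul_vec (F.c_smul _ _), cX, cY]
  simp only [smul_eq_ap (E := E)]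
  module

/-- The modified tractor Laplacian on the bottom slot. -/
lemma box_bot (hp : ∀ a, 𝒢.der a p = 0) (w : R) (hκ : ∀ a, 𝒢.der a κ = 0)
    (h : F.IsForm (κ - 1) φ) (h0 : F.cod • φ = 0) : F.box p w • F.cX • φ
    = F.cY • (((n : R) - 2 * κ + 2) • φ) + (-(2 : R) • F.ext • φ)
      + F.cX • (F.cod • F.ext • φ
        + (n * p - 2 * p * ((κ - 1) * (n - κ + 1) + w * (n + w - 1))) • φ) := by
  have hκ' : ∀ a, 𝒢.der a (κ - 1) = 0 := fun a => by simp [hκ]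
  have e1 : ∀ φ : A, F.cod • F.cX • φ = -(F.cX • F.cod • φ) := fun φ => by
    rw [← mul_smul, ← mul_smul, cX_cod, neg_smul, neg_neg]
  have e2 : ∀ φ : A, F.ext • F.cX • φ = -(F.cX • F.ext • φ) := fun φ => by
    rw [← mul_smul, ← mul_smul, cX_ext, neg_smul, neg_neg]
  have e3 : ∀ φ : A, F.num • F.cY • φ = F.cY • F.num • φ := fun φ => by
    rw [← mul_smul, ← mul_smul, num_cY]
  have e4 : ∀ φ : A, F.num • F.cX • φ = F.cX • F.num • φ := fun φ => by
    rw [← mul_smul, ← mul_smul, num_cX]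
  rw [box_vec hp]
  simp only [e1, e2, h0, smul_neg, smul_zero, neg_neg, neg_zero, h.beta_cX, (h.ext hκ').beta_cX,
    theta_vec, e3, e4, h.num, smul_sub, smul_add, smul_vec (F.num_smul _)]
  simp only [smul_vec (F.c_smul _ _), cX, cY]
  simp only [smul_eq_ap (E := E)]
  module

/-! ### Powers of the modified tractor Laplacian -/

/-- `∏_{i ≤ q} (T + 2 i (n - 2κ - i + 1) p)` applied to a vector. -/
def prodVec (n : ℕ) (p κ : R) (T : A → A) : ℕ → A → A
  | 0, φ => φ
  | i + 1, φ => T (prodVec n p κ T i φ)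
      + (2 * ((i : R) + 1) * ((n : R) - 2 * κ - (i + 1) + 1) * p) • prodVec n p κ T i φ

/-- Iterates of the modified tractor Laplacian. -/
def boxPow (F : OpCalc 𝒢 E) (p w : R) : ℕ → A → A
  | 0, φ => φ
  | q + 1, φ => F.box p (w - q) • boxPow F p w q φ

variable (F) in
/-- The explicit form of the powers of the modified tractor Laplacian. -/
lemma boxPow_split (hE : 𝒢.IsEinsteinWith p) (hp : ∀ a, 𝒢.der a p = 0) (k : ℕ)
    (h : F.IsForm (k : R) φ) (q : ℕ)
    (u v : A) (hu : u = prodVec n p k (fun φ => F.ext • F.cod • φ) q φ)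
    (hv : v = prodVec n p (k + 1) (fun φ => F.cod • F.ext • φ) q φ) :
    F.boxPow p (-k) (q + 1) (((n : R) - 2 * k) • φ + F.cX • F.cod • φ)
      = F.cY • (-(((q : R) + 1) * (n - 2 * k - 2 * (q + 1))) • F.cod • u)
        + (((n : R) - 2 * k - 2 * (q + 1)) • F.ext • F.cod • u
            + ((n : R) - 2 * k) • F.cod • F.ext • v)
        + F.cX • F.cod • (F.ext • F.cod • u + (((q : R) + 1) * (n - 2 * k + 2) * p) • u) := by
  have two0 : ∀ a, 𝒢.der a (2 : R) = 0 := fun a => by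
    simpa using (𝒢.der a).map_natCast 2
  have cc : ∀ φ : A, F.cod • F.cod • φ = 0 := fun φ => by
    rw [← mul_smul, F.cod_cod hE, zero_smul]
  have ee : ∀ φ : A, F.ext • F.ext • φ = 0 := fun φ => by
    rw [← mul_smul, F.ext_ext, zero_smul]
  have hk : ∀ a, 𝒢.der a (k : R) = 0 := fun a => by simp
  have hk' : ∀ a, 𝒢.der a ((k : R) - 1) = 0 := fun a => by simp
  have hk2 : ∀ a, 𝒢.der a ((k : R) + 1) = 0 := fun a => by simp
  have formdδ : ∀ {φ : A}, F.IsForm (k : R) φ → F.IsForm (k : R) (F.ext • F.cod • φ) := fun h => by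
    simpa using (h.cod hk).ext hk'
  have formδd : ∀ {φ : A}, F.IsForm (k : R) φ → F.IsForm (k : R) (F.cod • F.ext • φ) := fun h => by
    simpa using (h.ext hk).cod hk2
  have uform : ∀ q, F.IsForm (k : R) (prodVec n p k (fun φ => F.ext • F.cod • φ) q φ) := fun q => by
    induction q with
    | zero => exact h
    | succ q ih => exact (formdδ ih).add (ih.smul _)
  have vform : ∀ q, F.IsForm (k : R) (prodVec n p (k + 1) (fun φ => F.cod • F.ext • φ) q φ) :=
    fun q => by
    induction q with
    | zero => exact h
    | succ q ih => exact (formδd ih).add (ih.smul _)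
  -- The starting vector is `k` times `M f`, and the exponent is `q + 1`, so the base case is one
  -- application of the operator to the middle and bottom slots.
  induction q generalizing u v with
  | zero =>
    obtain rfl : u = φ := hu
    obtain rfl : v = u := hv
    have c1 : ∀ a, 𝒢.der a ((((0 : ℕ) : R) + 1) * (n - 2 * k + 2) * p) = 0 := fun a => by
      simp [Derivation.leibniz, hp, two0]
    simp only [boxPow, smul_add]
    rw [smul_vec (F.cod_smul c1)]
    rw [box_mid hp _ hk (h.smul _), box_bot hp _ hk (h.cod hk) (cc _)]
    have c2 : ∀ a, 𝒢.der a ((n : R) - 2 * k) = 0 := fun a => by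
      simp [Derivation.leibniz, two0]
    simp only [smul_vec (F.cod_smul c2), smul_vec (F.ext_smul c2), smul_add,
      smul_vec (F.c_smul _ _), cX, cY, Nat.cast_zero]
    simp only [smul_eq_ap (E := E)]
    module
  | succ q ih =>
    rw [boxPow, ih _ _ rfl rfl]
    have hU := uform q
    have hW := vform q
    rw [prodVec] at hu hv
    set U := prodVec n p k (fun φ => F.ext • F.cod • φ) q φ
    set W := prodVec n p (k + 1) (fun φ => F.cod • F.ext • φ) q φ
    have c1 : ∀ a, 𝒢.der a (((q : R) + 1) * (n - 2 * k + 2) * p) = 0 := fun a => by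
      simp [Derivation.leibniz, hp, two0]
    have c2 : ∀ a, 𝒢.der a (-(((q : R) + 1) * (n - 2 * k - 2 * (q + 1)))) = 0 := fun a => by
      simp [Derivation.leibniz, two0]
    have c3 : ∀ a, 𝒢.der a ((n : R) - 2 * k - 2 * (q + 1)) = 0 := fun a => by
      simp [Derivation.leibniz, two0]
    have c4 : ∀ a, 𝒢.der a ((n : R) - 2 * k) = 0 := fun a => by
      simp [Derivation.leibniz, two0]
    have c5 : ∀ a, 𝒢.der a (2 * ((q : R) + 1) * ((n : R) - 2 * k - (q + 1) + 1) * p) = 0 :=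
      fun a => by simp [Derivation.leibniz, hp, two0]
    have c6 : ∀ a, 𝒢.der a (2 * ((q : R) + 1) * ((n : R) - 2 * (k + 1) - (q + 1) + 1) * p) = 0 :=
      fun a => by simp [Derivation.leibniz, hp, two0]
    have c7 : ∀ a, 𝒢.der a ((((q + 1 : ℕ) : R) + 1) * (n - 2 * k + 2) * p) = 0 := fun a => by
      simp [Derivation.leibniz, hp, two0]
    have hcU := hU.cod hk
    -- After `q + 1` applications the weight is `-k - (q + 1)`. The top and bottom slots are
    -- coclosed because `δ² = 0`, as the slot formulas require.
    have m1 := box_top hp (-k - ((q + 1 : ℕ) : R)) hk (hcU.smul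
      (-(((q : R) + 1) * (n - 2 * k - 2 * (q + 1))))) (by
        rw [smul_vec (F.cod_smul c2), cc, smul_zero])
    have m2 := box_mid hp (-k - ((q + 1 : ℕ) : R)) hk (((formdδ hU).smul
      ((n : R) - 2 * k - 2 * (q + 1))).add ((formδd hW).smul ((n : R) - 2 * k)))
    have m3 := box_bot hp (-k - ((q + 1 : ℕ) : R)) hk (((formdδ hU).add (hU.smul
      (((q : R) + 1) * (n - 2 * k + 2) * p))).cod hk) (cc _)
    -- Since `d² = δ² = 0`, the `u` part meets only `dδ` and the `v` part only `δd`. The scalar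
    -- terms of the three slots then combine into the next factors of the two products.
    rw [smul_add, smul_add, m1, m2, m3, hu, hv]
    simp only [smul_add, smul_vec (F.cod_smul c1), smul_vec (F.cod_smul c2),
      smul_vec (F.cod_smul c3), smul_vec (F.cod_smul c4), smul_vec (F.cod_smul c5),
      smul_vec (F.cod_smul c6), smul_vec (F.cod_smul c7), smul_vec (F.ext_smul c1),
      smul_vec (F.ext_smul c2),
      smul_vec (F.ext_smul c3), smul_vec (F.ext_smul c4), smul_vec (F.ext_smul c5),
      smul_vec (F.ext_smul c6), cc, ee, smul_zero, add_zero, zero_add]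
    simp only [smul_vec (F.c_smul _ _), cX, cY, Nat.cast_add, Nat.cast_one]
    simp only [smul_eq_ap (E := E)]
    module

end OpCalc
end
end EinsteinTractor

namespace EinsteinTractor

noncomputable section

/-! ## The operator calculus on alternating tractors -/

namespace Fock

variable {n : ℕ} {R : Type*} [CommRing R] [Algebra ℝ R] {ι : Type*}

/-- A derivation acting on components. -/
def derF (d : Derivation ℝ R R) : Fock ι R →ₗ[ℝ] Fock ι R where
  toFun V := fun t L => d (V t L)
  map_add' V W := by funext t L; simp
  map_smul' r V := by funext t L; simp

@[simp] lemma derF_apply (d : Derivation ℝ R R) (V : Fock ι R) (t : ℕ) (L : Fin t → ι) :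
    derF d V t L = d (V t L) := rfl

lemma ann_derF (d : Derivation ℝ R R) (A : ι) (V : Fock ι R) :
    ann A (derF d V) = derF d (ann A V) := rfl

lemma derF_smul (d : Derivation ℝ R R) (r : R) (V : Fock ι R) :
    derF d (r • V) = r • derF d V + d r • V := by
  funext t L
  simp [Derivation.leibniz, mul_comm]

lemma IsAlt.derF {V : Fock ι R} (hV : V.IsAlt) (d : Derivation ℝ R R) : (derF d V).IsAlt :=
  fun t L i j h => by simp [hV t L i j h]

/-- A covector with constant components passes through a componentwise derivation; this is applied
to the frame covectors. -/
lemma derF_cre (d : Derivation ℝ R R) (η : ι → R) (hη : ∀ A, d (η A) = 0) (V : Fock ι R) :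
    Fock.derF d (cre η V) = cre η (Fock.derF d V) := by
  funext t
  induction t generalizing V with
  | zero => funext L; simp
  | succ t ih =>
    funext L
    have h := congrFun (ih (ann (L 0) V)) (Fin.tail L)
    change d (η (L 0) * V t (Fin.tail L) - cre η (ann (L 0) V) t (Fin.tail L))
      = η (L 0) * d (V t (Fin.tail L)) - cre η (Fock.derF d (ann (L 0) V)) t (Fin.tail L)
    rw [← h]
    simp [Derivation.leibniz, hη]

instance : IsScalarTower R (Module.End ℝ (altModule ι R)) (altModule ι R) := ⟨fun _ _ _ => rfl⟩

variable [DecidableEq ι]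

/-- The creation operators on alternating tensors. -/
def creEnd (A : ι) : Module.End ℝ (altModule ι R) where
  toFun V := ⟨cre (Pi.single A 1) V.1, V.2.cre _⟩
  map_add' _ _ := Subtype.ext (map_add _ _ _)
  map_smul' r V := Subtype.ext (LinearMap.map_smul_of_tower _ r V.1)

/-- The annihilation operators on alternating tensors. -/
def annEnd (A : ι) : Module.End ℝ (altModule ι R) where
  toFun V := ⟨ann A V.1, V.2.ann A⟩
  map_add' _ _ := Subtype.ext (map_add _ _ _)
  map_smul' r V := Subtype.ext (LinearMap.map_smul_of_tower _ r V.1)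

/-- The componentwise derivations on alternating tensors. -/
def derEnd (d : Derivation ℝ R R) : Module.End ℝ (altModule ι R) where
  toFun V := ⟨derF d V.1, V.2.derF d⟩
  map_add' _ _ := Subtype.ext (map_add _ _ _)
  map_smul' r V := Subtype.ext (LinearMap.map_smul _ r V.1)

/-- The operator calculus on alternating tractors. -/
def tcalc (𝒢 : AlgMetric n R) : OpCalc 𝒢 (Module.End ℝ (altModule (TIdx n) R)) where
  c := creEnd
  b := annEnd
  D a := derEnd (𝒢.der a)
  c_c A B := LinearMap.ext fun V => Subtype.ext (cre_anticomm _ _ V.1)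
  b_b A B := LinearMap.ext fun V => Subtype.ext (V.2.ann_anticomm A B)
  b_c A B := LinearMap.ext fun V => Subtype.ext (by
    have := ann_cre (Pi.single B 1) A V.1
    refine this.trans ?_
    rw [Pi.single_apply]
    split_ifs <;> simp <;> rfl)
  c_smul A r x := LinearMap.ext fun V => Subtype.ext (map_smul (cre _) r (x V).1)
  b_smul A r x := LinearMap.ext fun V => Subtype.ext (map_smul (ann _) r (x V).1)
  D_smul a r x := LinearMap.ext fun V => Subtype.ext (derF_smul _ r (x V).1)
  D_c a A := LinearMap.ext fun V => Subtype.ext (derF_cre _ _ (fun B => by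
    rw [Pi.single_apply]; split_ifs <;> simp) V.1)
  D_b a A := rfl
  D_D a b := LinearMap.ext fun V => Subtype.ext (by
    funext t L; exact 𝒢.der_comm a b _)

variable (𝒢 : AlgMetric n R) (V : altModule (TIdx n) R)

lemma coe_c (A : TIdx n) : ((tcalc 𝒢).c A • V).1 = cre (Pi.single A 1) V.1 := rfl
lemma coe_b (A : TIdx n) : ((tcalc 𝒢).b A • V).1 = ann A V.1 := rfl
lemma coe_D (a : Fin n) : ((tcalc 𝒢).D a • V).1 = derF (𝒢.der a) V.1 := rfl

/-- The matrix of the tractor connection. -/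
def conn (𝒢 : AlgMetric n R) (p : R) (a : Fin n) : TIdx n → TIdx n → R
  | .inl _, .inr (.inl c) => if c = a then -1 else 0
  | .inr (.inl b), .inl _ => p * 𝒢.g a b
  | .inr (.inl b), .inr (.inl c) => -𝒢.chr c a b
  | .inr (.inl b), .inr (.inr _) => 𝒢.g a b
  | .inr (.inr _), .inr (.inl c) => if c = a then -p else 0
  | _, _ => 0

/-- The extension of a matrix by zero to the tractor frame. -/
def zblock (M : Fin n → Fin n → R) : TIdx n → TIdx n → R
  | .inr (.inl b), .inr (.inl c) => M b c
  | _, _ => 0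

/-- Identifies the abstract quadratic operators with derivations of the tensor algebra, through
`IsAlt.act_eq`. -/
lemma coe_op (M : Fin n → Fin n → R) : ((tcalc 𝒢).op M • V).1 = act (zblock M) V.1 := by
  rw [V.2.act_eq]
  simp only [Fintype.sum_sum_type, Finset.univ_unique, zblock, zero_smul,
    Finset.sum_const_zero, add_zero, zero_add]
  simp only [OpCalc.op, Finset.sum_smul, Submodule.coe_sum, smul_assoc, mul_smul]
  rfl

lemma coe_nab (a : Fin n) : ((tcalc 𝒢).nab a • V).1
    = derF (𝒢.der a) V.1 + act (zblock fun b c => -𝒢.chr c a b) V.1 := by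
  have h : zblock (fun b c => -𝒢.chr c a b) = -zblock (fun b c => 𝒢.chr c a b) := by
    funext A B
    rcases A with _ | _ | _ <;> rcases B with _ | _ | _ <;> simp [zblock]
  have h2 : ∀ M : TIdx n → TIdx n → R, act (-M) V.1 = -act M V.1 := fun M => by
    rw [V.2.act_eq, V.2.act_eq]
    simp only [Pi.neg_apply, neg_smul, Finset.sum_neg_distrib]
  rw [h, h2, ← coe_op, OpCalc.nab, sub_smul, ← sub_eq_add_neg]
  rfl

/-- The tractor covariant derivative of covariant tensors. -/
def covT (𝒢 : AlgMetric n R) (p : R) (a : Fin n) (V : Fock (TIdx n) R) : Fock (TIdx n) R :=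
  derF (𝒢.der a) V + act (conn 𝒢 p a) V

/-- The blocks of the connection matrix outside the Levi-Civita part are precisely the four products
in `cl_a β - θ bZ_a`. -/
lemma coe_tr (p : R) (a : Fin n) : ((tcalc 𝒢).tr p a • V).1 = covT 𝒢 p a V.1 := by
  rw [OpCalc.tr, add_smul, Submodule.coe_add, coe_nab, covT, add_assoc]
  congr 1
  rw [V.2.act_eq, V.2.act_eq]
  simp only [Fintype.sum_sum_type, Finset.univ_unique, Finset.sum_singleton, zblock, zero_smul,
    Finset.sum_const_zero, add_zero, zero_add, conn, Finset.sum_add_distrib]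
  simp only [OpCalc.cl, OpCalc.beta, OpCalc.theta, sub_smul, add_smul, mul_smul, smul_assoc,
    Finset.sum_smul, smul_add, Submodule.coe_add, Submodule.coe_sub, Submodule.coe_smul,
    Submodule.coe_sum, ite_smul, zero_smul, neg_smul, one_smul, Finset.sum_ite_eq',
    Finset.mem_univ, if_true, OpCalc.cZ, OpCalc.bZ, OpCalc.cX, OpCalc.cY, OpCalc.bX, OpCalc.bY,
    coe_c, coe_b, map_smul, mul_comm p]
  rw [Finset.sum_comm]
  abel

/-- The tractor Laplacian of covariant tensors. -/
def lapF (𝒢 : AlgMetric n R) (p : R) (V : Fock (TIdx n) R) : Fock (TIdx n) R :=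
  ∑ a, ∑ b, 𝒢.gi a b • (covT 𝒢 p a (covT 𝒢 p b V) - ∑ c, 𝒢.chr c a b • covT 𝒢 p c V)

lemma coe_lapT (p : R) : ((tcalc 𝒢).lapT p • V).1 = lapF 𝒢 p V.1 := by
  simp only [OpCalc.lapT, lapF, Finset.sum_smul, Submodule.coe_sum, smul_assoc, sub_smul,
    Submodule.coe_smul, Submodule.coe_sub, mul_smul, coe_tr]

lemma act_single (A : TIdx n) (η : TIdx n → R) : act (fun A' B => if A' = A then η B else 0) V.1
    = ∑ B, η B • cre (Pi.single A 1) (ann B V.1) := by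
  rw [V.2.act_eq, Finset.sum_comm]
  simp

/-! ### The curvature term in components -/

/-- The covector of components of `g^{bc}` in the tractor frame. -/
def giVec (𝒢 : AlgMetric n R) (b : Fin n) : TIdx n → R
  | .inr (.inl c) => 𝒢.gi b c
  | _ => 0

lemma coe_weyl (p : R) : ((tcalc 𝒢).weyl p • V).1 = ∑ a, ∑ b,
    act (fun A B => if A = .inr (.inl a) then giVec 𝒢 b B else 0)
      (act (zblock (OpCalc.Kmat 𝒢 p a b)) V.1) := by
  simp only [OpCalc.weyl, Finset.sum_smul, Submodule.coe_sum, mul_smul, OpCalc.bu, OpCalc.Kop]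
  refine Finset.sum_congr rfl fun a _ => Finset.sum_congr rfl fun b _ => ?_
  rw [← coe_op 𝒢, act_single, OpCalc.cZ, coe_c]
  simp only [Fintype.sum_sum_type, Finset.univ_unique, Finset.sum_singleton, zero_smul,
    add_zero, zero_add, giVec]
  simp only [smul_assoc, Submodule.coe_sum, Submodule.coe_smul, map_sum, map_smul, OpCalc.bZ, coe_b]

/-- The Ricci contraction `2(n-1)p` is offset by the trace of the constant curvature part; this is
the Einstein condition. -/
lemma trace_Kmat {p : R} (hE : 𝒢.IsEinsteinWith p) (a d : Fin n) :
    ∑ b, ∑ c, 𝒢.gi b c * OpCalc.Kmat 𝒢 p a b c d = 0 := by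
  have h1 : ∑ b, ∑ c, 𝒢.gi b c * 𝒢.riem a b d c = 2 * ((n : R) - 1) * p
      * if d = a then 1 else 0 := by
    simp only [𝒢.riem_eq a _ d]
    rw [← 𝒢.gi_g d a, Finset.mul_sum]
    have : ∀ e, 2 * ((n : R) - 1) * p * (𝒢.gi d e * 𝒢.g e a)
        = ∑ b, ∑ c, 𝒢.gi b c * (𝒢.gi d e * 𝒢.riemL a b e c) := fun e => by
      have h := hE a e
      rw [← 𝒢.trace_riemL] at h
      have h2 : ∑ b, ∑ c, 𝒢.gi b c * (𝒢.gi d e * 𝒢.riemL a b e c)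
          = 𝒢.gi d e * ∑ b, ∑ c, 𝒢.gi b c * 𝒢.riemL b a c e := by
        simp only [Finset.mul_sum]
        refine Finset.sum_congr rfl fun b _ => Finset.sum_congr rfl fun c _ => ?_
        rw [𝒢.riemL_antisymm, 𝒢.riemL_antisymm']; ring
      rw [h2, h, 𝒢.g_symm e a]; ring
    symm
    rw [Finset.sum_congr rfl fun e _ => this e, Finset.sum_comm]
    refine Finset.sum_congr rfl fun b _ => ?_
    rw [Finset.sum_comm]
    exact Finset.sum_congr rfl fun c _ => by rw [Finset.mul_sum]
  have h2 : ∑ b, ∑ c, 𝒢.gi b c * (𝒢.g a c * (if d = b then 1 else 0)) = if d = a then 1 else 0 := by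
    rw [Finset.sum_comm]
    simp only [mul_ite, mul_one, mul_zero, Finset.sum_ite_eq, Finset.mem_univ, if_true]
    rw [← 𝒢.gi_g d a]
    exact Finset.sum_congr rfl fun c _ => by rw [𝒢.g_symm]
  have h3 : ∑ b, ∑ c, 𝒢.gi b c * (𝒢.g b c * (if d = a then 1 else 0))
      = n * if d = a then 1 else 0 := by
    simp only [← mul_assoc, ← Finset.sum_mul, 𝒢.trace_g]
  have h4 : ∀ b c, 𝒢.gi b c * OpCalc.Kmat 𝒢 p a b c d = -(𝒢.gi b c * 𝒢.riem a b d c)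
      - 2 * p * (𝒢.gi b c * (𝒢.g a c * (if d = b then 1 else 0))
        - 𝒢.gi b c * (𝒢.g b c * (if d = a then 1 else 0))) := fun b c => by
    rw [OpCalc.Kmat]; ring
  simp only [h4, Finset.sum_sub_distrib, Finset.sum_neg_distrib, ← Finset.mul_sum, h1, h2, h3]
  ring

/-- The curvature term vanishes on one-index tensors. -/
lemma weyl_one {p : R} (hE : 𝒢.IsEinsteinWith p) (L : Fin 1 → TIdx n) :
    ((tcalc 𝒢).weyl p • V).1 1 L = 0 := by
  rw [OpCalc.weyl_eq_sum _ (trace_Kmat 𝒢 hE)]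
  simp only [Finset.sum_smul, smul_assoc, mul_smul, Submodule.coe_sum, Submodule.coe_smul,
    OpCalc.cZ, coe_c]
  simp [cre_apply, Finset.sum_apply]

end Fock
end
end EinsteinTractor

namespace EinsteinTractor

noncomputable section

/-! ## The `W`-tractor -/

namespace AlgMetric

set_option linter.unusedSectionVars false

variable {n : ℕ} {R : Type*} [CommRing R] [Algebra ℝ R] {𝒢 : AlgMetric n R} {p : R}

/-- The Weyl curvature of an Einstein metric. -/
def weylL (𝒢 : AlgMetric n R) (p : R) (a b c d : Fin n) : R :=
  𝒢.riemL a b c d - 2 * p * (𝒢.g a c * 𝒢.g b d - 𝒢.g b c * 𝒢.g a d)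

lemma weylL_antisymm (a b c d : Fin n) : 𝒢.weylL p a b c d = -𝒢.weylL p b a c d := by
  rw [weylL, weylL, riemL_antisymm]; ring

lemma weylL_antisymm' (a b c d : Fin n) : 𝒢.weylL p a b c d = -𝒢.weylL p a b d c := by
  rw [weylL, weylL, riemL_antisymm']; ring

/-- Identifies the `Z`-block of the tractor curvature, with its index lowered, as the Weyl
curvature. -/
lemma sum_Kmat_g (a b c e : Fin n) :
    ∑ d, OpCalc.Kmat 𝒢 p a b c d * 𝒢.g d e = 𝒢.weylL p a b c e := by
  rw [weylL, riemL_antisymm', riemL]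
  simp only [OpCalc.Kmat, sub_mul, mul_sub, neg_mul, Finset.sum_sub_distrib,
    Finset.sum_neg_distrib, mul_ite, ite_mul, mul_zero, zero_mul, mul_one, Finset.sum_ite_eq',
    Finset.mem_univ, if_true, 𝒢.g_symm e, mul_comm (𝒢.riem _ _ _ _), mul_assoc]

lemma IsEinsteinWith.trace_weylL (hE : 𝒢.IsEinsteinWith p) (c f : Fin n) :
    ∑ a, ∑ b, 𝒢.gi a b * 𝒢.weylL p b c a f = 0 := by
  have h1 : ∑ a, ∑ b, 𝒢.gi a b * 𝒢.riemL b c a f = 𝒢.ric c f := by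
    rw [Finset.sum_comm, ← trace_riemL]
    simp only [𝒢.gi_symm]
  have h2 : ∑ a, ∑ b, 𝒢.gi a b * (𝒢.g b a * 𝒢.g c f) = n * 𝒢.g c f := by
    simp only [← mul_assoc, ← Finset.sum_mul, 𝒢.g_symm, ← trace_g (𝒢 := 𝒢)]
  have h3 : ∑ a, ∑ b, 𝒢.gi a b * (𝒢.g c a * 𝒢.g b f) = 𝒢.g c f := by
    have : ∀ a b, 𝒢.gi a b * (𝒢.g c a * 𝒢.g b f) = 𝒢.g c a * (𝒢.gi a b * 𝒢.g b f) :=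
      fun a b => by ring
    simp only [this, ← Finset.mul_sum, gi_g]
    simp
  have h4 : ∀ a b, 𝒢.gi a b * 𝒢.weylL p b c a f = 𝒢.gi a b * 𝒢.riemL b c a f
      - 2 * p * (𝒢.gi a b * (𝒢.g b a * 𝒢.g c f) - 𝒢.gi a b * (𝒢.g c a * 𝒢.g b f)) :=
    fun a b => by rw [weylL]; ring
  simp only [h4, Finset.sum_sub_distrib, ← Finset.mul_sum, h1, h2, h3, hE c f]
  ring

lemma cov4_g_g (a b c d e : Fin n) :
    𝒢.cov4 (fun b c d e => 𝒢.g b d * 𝒢.g c e) a b c d e = 0 := by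
  have h : ∀ (x y : Fin n → R) (r : R), ∑ f, x f * (y f * r) = r * ∑ f, x f * y f := fun x y r => by
    rw [Finset.mul_sum]; exact Finset.sum_congr rfl fun _ _ => by ring
  have h' : ∀ (x y : Fin n → R) (r : R), ∑ f, x f * (r * y f) = r * ∑ f, x f * y f := fun x y r => by
    rw [Finset.mul_sum]; exact Finset.sum_congr rfl fun _ _ => by ring
  simp only [cov4, Derivation.leibniz, smul_eq_mul, der_g', h, h']
  ring

/-- The Weyl and Riemann curvatures differ by a constant multiple of products of the parallel
metric. -/
lemma cov4_weylL (hp : ∀ a, 𝒢.der a p = 0) (a b c d e : Fin n) :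
    𝒢.cov4 (𝒢.weylL p) a b c d e = 𝒢.cov4 𝒢.riemL a b c d e := by
  have h1 := 𝒢.cov4_g_g a b c d e
  have h2 := 𝒢.cov4_g_g a c b d e
  have two0 : ∀ a, 𝒢.der a (2 : R) = 0 := fun a => by simpa using (𝒢.der a).map_natCast 2
  have h : ∀ (x y : Fin n → R) (r : R), ∑ f, x f * (r * y f) = r * ∑ f, x f * y f := fun x y r => by
    rw [Finset.mul_sum]; exact Finset.sum_congr rfl fun _ _ => by ring
  simp only [cov4] at h1 h2 ⊢
  simp only [weylL, map_sub, Derivation.leibniz, smul_eq_mul, hp, two0, mul_sub (𝒢.chr _ _ _),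
    Finset.sum_sub_distrib, h] at h1 h2 ⊢
  linear_combination -(2 * p) * h1 + 2 * p * h2

lemma IsEinsteinWith.div_weylL (hE : 𝒢.IsEinsteinWith p) (hn : 3 ≤ n) (c e f : Fin n) :
    ∑ a, ∑ b, 𝒢.gi a b * 𝒢.cov4 (𝒢.weylL p) a b c e f = 0 := by
  simp only [cov4_weylL (hE.der_eq_zero hn), hE.div_riemL hn]

end AlgMetric

namespace Fock

set_option linter.unusedSectionVars false

variable {n : ℕ} {R : Type*} [CommRing R] [Algebra ℝ R] {𝒢 : AlgMetric n R} {p : R}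

lemma ann_single {ι : Type*} (A : ι) (t : ℕ) (v : (Fin (t + 1) → ι) → R) :
    ann A (Pi.single (t + 1) v : Fock ι R) = Pi.single t fun L => v (Fin.cons A L) := by
  funext s L
  rcases eq_or_ne s t with rfl | h
  · simp
  · rw [ann_apply, Pi.single_eq_of_ne (by omega), Pi.single_eq_of_ne h]; rfl

lemma act_add {ι : Type*} [Fintype ι] [DecidableEq ι] (M : ι → ι → R) (V W : Fock ι R) :
    act M (V + W) = act M V + act M W := by
  funext t L
  simp [act_apply, mul_add, Finset.sum_add_distrib]

lemma act_smul {ι : Type*} [Fintype ι] [DecidableEq ι] (M : ι → ι → R) (r : R) (V : Fock ι R) :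
    act M (r • V) = r • act M V := by
  funext t L
  simp only [act_apply, Pi.smul_apply, smul_eq_mul, Finset.mul_sum]
  exact Finset.sum_congr rfl fun _ _ => Finset.sum_congr rfl fun _ _ => by ring

lemma covT_add (a : Fin n) (V W : Fock (TIdx n) R) :
    covT 𝒢 p a (V + W) = covT 𝒢 p a V + covT 𝒢 p a W := by
  simp only [covT, map_add, act_add]; abel

lemma covT_neg (a : Fin n) (V : Fock (TIdx n) R) : covT 𝒢 p a (-V) = -covT 𝒢 p a V := by
  have h : act (conn 𝒢 p a) (-V) = -act (conn 𝒢 p a) V := by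
    rw [← neg_one_smul R V, act_smul, neg_one_smul]
  simp only [covT, map_neg, h]; abel

lemma covT_zero (a : Fin n) : covT 𝒢 p a 0 = 0 := by
  have := covT_add (𝒢 := 𝒢) (p := p) a 0 0
  simpa using this

/-- The frame elements are not parallel, so exchanging an insertion with the derivative costs one
connection term. These terms produce all the numerical constants in the `W`-tractor. -/
lemma ann_covT (A : TIdx n) (a : Fin n) (V : Fock (TIdx n) R) : ann A (covT 𝒢 p a V)
    = covT 𝒢 p a (ann A V) + ∑ B, conn 𝒢 p a A B • ann B V := by
  simp only [covT, map_add, ann_derF, ann_act]; abel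

/-- The components of the Weyl curvature in the tractor frame. -/
def weyl4 (𝒢 : AlgMetric n R) (p : R) : TIdx n → TIdx n → TIdx n → TIdx n → R
  | .inr (.inl b), .inr (.inl c), .inr (.inl e), .inr (.inl f) => 𝒢.weylL p b c e f
  | _, _, _, _ => 0

/-- The Weyl curvature as a tensor in its last two slots. -/
def weylOm (𝒢 : AlgMetric n R) (p : R) (B C : TIdx n) : Fock (TIdx n) R :=
  Pi.single 2 fun L => weyl4 𝒢 p B C (L 0) (L 1)

/-- The components of `X_A`. -/
def pX (A : TIdx n) : R := if A = .inr (.inr ()) then 1 else 0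

/-- Three times `X_{[A} Ω_{BC]EF}`. -/
def skewXOm (𝒢 : AlgMetric n R) (p : R) : Fock (TIdx n) R :=
  Pi.single 5 fun L => pX (L 0) * weyl4 𝒢 p (L 1) (L 2) (L 3) (L 4)
    + pX (L 1) * weyl4 𝒢 p (L 2) (L 0) (L 3) (L 4) + pX (L 2) * weyl4 𝒢 p (L 0) (L 1) (L 3) (L 4)

lemma ann_skewXOm (A B C : TIdx n) : ann C (ann B (ann A (skewXOm 𝒢 p)))
    = pX (R := R) A • weylOm 𝒢 p B C + pX (R := R) B • weylOm 𝒢 p C A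
      + pX (R := R) C • weylOm 𝒢 p A B := by
  simp only [skewXOm, ann_single, weylOm, ← Pi.single_smul, ← Pi.single_add]
  rfl

lemma ext_two {t : ℕ} {v : (Fin (t + 2) → TIdx n) → R} {W : Fock (TIdx n) R} (h0 : W 0 = 0)
    (h1 : ∀ A, ann A W 0 = 0)
    (h : ∀ A B, ann B (ann A (Pi.single (t + 2) v)) = ann B (ann A W)) :
    (Pi.single (t + 2) v : Fock (TIdx n) R) = W := by
  refine ext_ann ?_ fun A => ext_ann ?_ fun B => h A B
  · rw [h0, Pi.single_eq_of_ne (by omega)]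
  · rw [h1, ann_single, Pi.single_eq_of_ne (by omega)]

lemma weylOm_antisymm (B C : TIdx n) : weylOm 𝒢 p B C = -weylOm 𝒢 p C B := by
  simp only [weylOm, ← Pi.single_neg]
  congr 1
  funext L
  simp only [Pi.neg_apply]
  generalize L 0 = E
  generalize L 1 = F
  rcases B with _ | _ | _ <;> rcases C with _ | _ | _ <;> rcases E with _ | _ | _ <;>
    rcases F with _ | _ | _ <;> simp [weyl4, ← AlgMetric.weylL_antisymm (𝒢 := 𝒢) (p := p)]

@[simp] lemma weylOm_Y_left (u : Unit) (C : TIdx n) : weylOm 𝒢 p (.inl u) C = 0 := by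
  simp [weylOm, weyl4]; rfl
@[simp] lemma weylOm_X_left (u : Unit) (C : TIdx n) : weylOm 𝒢 p (.inr (.inr u)) C = 0 := by
  simp [weylOm, weyl4]; rfl
@[simp] lemma weylOm_Y_right (u : Unit) (C : TIdx n) : weylOm 𝒢 p C (.inl u) = 0 := by
  rw [weylOm_antisymm]; simp
@[simp] lemma weylOm_X_right (u : Unit) (C : TIdx n) : weylOm 𝒢 p C (.inr (.inr u)) = 0 := by
  rw [weylOm_antisymm]; simp

/-- The Weyl curvature is divergence free with respect to the tractor connection. -/
lemma div_weylOm (hE : 𝒢.IsEinsteinWith p) (hn : 3 ≤ n) (c : Fin n) :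
    ∑ a, ∑ b, 𝒢.gi a b • (covT 𝒢 p a (weylOm 𝒢 p (.inr (.inl b)) (.inr (.inl c)))
      - ∑ e, 𝒢.chr e a b • weylOm 𝒢 p (.inr (.inl e)) (.inr (.inl c))
      - ∑ e, 𝒢.chr e a c • weylOm 𝒢 p (.inr (.inl b)) (.inr (.inl e))) = 0 := by
  have tr1 := hE.trace_weylL
  have tr2 : ∀ c f, ∑ a, ∑ b, 𝒢.gi a b * 𝒢.weylL p b c f a = 0 := fun c f => by
    simp only [fun b a => AlgMetric.weylL_antisymm' (𝒢 := 𝒢) (p := p) b c f a, mul_neg,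
      Finset.sum_neg_distrib, tr1, neg_zero]
  funext t L
  by_cases ht : t = 2
  · subst ht
    simp only [Finset.sum_apply, Pi.smul_apply, Pi.sub_apply, covT, Pi.add_apply, derF_apply,
      act_apply, weylOm, Pi.single_eq_same, Fin.sum_univ_two, Function.update_self, ne_eq,
      zero_ne_one, one_ne_zero, not_false_eq_true, Function.update_of_ne, smul_eq_mul,
      Pi.zero_apply]
    generalize L 0 = A
    generalize L 1 = B
    -- Only the block with both indices along `Z` uses that the Weyl curvature is divergence free.
    -- In the mixed blocks the connection turns the sum into a trace, which vanishes.
    rcases A with _ | e | _ <;> rcases B with _ | f | _ <;>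
      simp only [weyl4, Fintype.sum_sum_type, conn, mul_zero, Finset.sum_const_zero, add_zero,
        zero_add, sub_zero, map_zero, ite_mul, zero_mul, Finset.sum_ite_eq', Finset.mem_univ,
        if_true, neg_mul, one_mul, mul_neg, Finset.sum_neg_distrib, neg_eq_zero, tr1, tr2,
        Finset.univ_unique]
    · rw [← hE.div_weylL hn c e f]
      refine Finset.sum_congr rfl fun a _ => Finset.sum_congr rfl fun b _ => ?_
      rw [AlgMetric.cov4]
      ring
    · simp only [mul_left_comm _ p, ← Finset.mul_sum, tr2, mul_zero]
    · simp only [mul_left_comm _ p, ← Finset.mul_sum, tr1, mul_zero]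
  · simp [covT, act_apply, weylOm, Pi.single_eq_of_ne ht]

lemma div_weylOm' (hE : 𝒢.IsEinsteinWith p) (hn : 3 ≤ n) (d : Fin n) :
    ∑ a, ∑ b, 𝒢.gi a b • (covT 𝒢 p a (weylOm 𝒢 p (.inr (.inl d)) (.inr (.inl b)))
      - ∑ e, 𝒢.chr e a b • weylOm 𝒢 p (.inr (.inl d)) (.inr (.inl e))
      - ∑ e, 𝒢.chr e a d • weylOm 𝒢 p (.inr (.inl e)) (.inr (.inl b))) = 0 := by
  have h : ∀ (x : Fin n → R) (B : Fin n → TIdx n) (C : Fin n → TIdx n),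
      ∑ e, x e • weylOm 𝒢 p (B e) (C e) = -∑ e, x e • weylOm 𝒢 p (C e) (B e) := fun x B C => by
    rw [← Finset.sum_neg_distrib]
    exact Finset.sum_congr rfl fun e _ => by rw [weylOm_antisymm, smul_neg]
  rw [← neg_eq_zero, ← div_weylOm hE hn d]
  simp only [← Finset.sum_neg_distrib]
  refine Finset.sum_congr rfl fun a _ => Finset.sum_congr rfl fun b _ => ?_
  rw [weylOm_antisymm, covT_neg, h _ (fun _ => .inr (.inl d)), h _ _ (fun _ => .inr (.inl b)),
    ← smul_neg]
  congr 1
  abel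

/-! ### The tractor divergence of `X_{[A} Ω_{BC]EF}` -/

/-- The divergence of `skewXOm`. -/
def divSkew (𝒢 : AlgMetric n R) (p : R) : Fock (TIdx n) R :=
  ∑ a, ∑ b, 𝒢.gi a b • (covT 𝒢 p a (ann (.inr (.inl b)) (skewXOm 𝒢 p))
    - ∑ c, 𝒢.chr c a b • ann (.inr (.inl c)) (skewXOm 𝒢 p))

lemma ann_Y_skewXOm : ann (.inl ()) (skewXOm 𝒢 p) = 0 := by
  have h : ann (.inl ()) (skewXOm 𝒢 p) = Pi.single 4 fun L => skewXOm 𝒢 p 5 (Fin.cons (.inl ()) L) := by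
    simp only [skewXOm, ann_single, Pi.single_eq_same]
  rw [h]
  refine ext_two rfl (fun _ => rfl) fun A B => ?_
  rw [← h, ann_skewXOm]
  simp [pX]

lemma ann_X_skewXOm (B C : TIdx n) :
    ann C (ann B (ann (.inr (.inr ())) (skewXOm 𝒢 p))) = weylOm 𝒢 p B C := by
  rw [ann_skewXOm]
  simp [pX]

/-- When one of `B`, `C` is along `X` and the other along `Z`, the result is a divergence of the
Weyl curvature and vanishes. When both are along `Z`, the entry `g_{ab}` of the connection on each
of the two free indices contributes one copy of the Weyl curvature, with negative sign. -/
lemma ann_divSkew (hE : 𝒢.IsEinsteinWith p) (hn : 3 ≤ n) (B C : TIdx n) :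
    ann C (ann B (divSkew 𝒢 p)) = -(2 : R) • weylOm 𝒢 p B C := by
  have hU : ∀ a b, ann C (ann B (covT 𝒢 p a (ann (.inr (.inl b)) (skewXOm 𝒢 p))))
      = covT 𝒢 p a (ann C (ann B (ann (.inr (.inl b)) (skewXOm 𝒢 p))))
        + ∑ C', conn 𝒢 p a C C' • ann C' (ann B (ann (.inr (.inl b)) (skewXOm 𝒢 p)))
        + ∑ B', conn 𝒢 p a B B' • ann C (ann B' (ann (.inr (.inl b)) (skewXOm 𝒢 p))) := by
    intro a b
    simp only [ann_covT, map_add, map_sum, map_smul]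
  have sk : ∀ x : TIdx n → TIdx n → Fock (TIdx n) R, (∀ A B, x A B = -x B A) →
      ∑ a, ∑ b, 𝒢.gi a b • x (.inr (.inl a)) (.inr (.inl b)) = 0 := by
    intro x hx
    have h1 : ∑ a, ∑ b, 𝒢.gi a b • x (.inr (.inl a)) (.inr (.inl b))
        = -∑ a, ∑ b, 𝒢.gi a b • x (.inr (.inl a)) (.inr (.inl b)) := by
      conv_lhs => rw [Finset.sum_comm]
      simp only [← Finset.sum_neg_distrib]
      refine Finset.sum_congr rfl fun a _ => Finset.sum_congr rfl fun b _ => ?_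
      rw [𝒢.gi_symm, hx, smul_neg]
    have h2 : (2 : R) • ∑ a, ∑ b, 𝒢.gi a b • x (.inr (.inl a)) (.inr (.inl b)) = 0 := by
      rw [two_smul]; nth_rw 1 [h1]; simp
    rw [← one_smul R (∑ a, _), ← AlgMetric.two_half, mul_comm, mul_smul, h2, smul_zero]
  have sk0 := sk (weylOm 𝒢 p) weylOm_antisymm
  have sk1 : ∑ a, ∑ b, 𝒢.gi a b • weylOm 𝒢 p (.inr (.inl b)) (.inr (.inl a)) = 0 := by
    rw [Finset.sum_comm]; simpa only [𝒢.gi_symm] using sk0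
  have gg : ∀ (c : Fin n) (x : Fin n → Fock (TIdx n) R),
      ∑ a, ∑ b, 𝒢.gi a b • 𝒢.g a c • x b = x c := fun c x => by
    simp only [smul_smul]
    have : ∀ b, ∑ a, (𝒢.gi a b * 𝒢.g a c) • x b = (if b = c then (1 : R) else 0) • x b :=
      fun b => by
        rw [← Finset.sum_smul, ← 𝒢.gi_g]
        simp only [𝒢.gi_symm]
    rw [Finset.sum_comm]
    simp only [this, ite_smul, one_smul, zero_smul, Finset.sum_ite_eq', Finset.mem_univ, if_true]
  simp only [divSkew, map_sum, map_smul, map_sub, hU]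
  rcases B with ⟨⟩ | c | ⟨⟩ <;> rcases C with ⟨⟩ | d | ⟨⟩ <;>
    simp only [ann_skewXOm, pX, Fintype.sum_sum_type, Finset.univ_unique, Finset.sum_singleton, conn,
      reduceCtorEq, if_true, if_false, zero_smul, one_smul, weylOm_Y_left, weylOm_X_left,
      weylOm_Y_right, weylOm_X_right, smul_zero, zero_add, add_zero, covT_zero,
      Finset.sum_const_zero, sub_zero, Sum.inr.injEq, ite_smul, Finset.sum_ite_eq',
      Finset.mem_univ, neg_smul, smul_neg, Finset.sum_neg_distrib, sk0, sk1, neg_zero]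
  · simp only [smul_add, Finset.sum_add_distrib, gg d (fun b => weylOm 𝒢 p (.inr (.inl b)) _),
      gg c (fun b => weylOm 𝒢 p _ (.inr (.inl b)))]
    rw [two_smul, weylOm_antisymm (.inr (.inl d)) (.inr (.inl c))]
    abel
  · rw [← div_weylOm hE hn c]
    refine Finset.sum_congr rfl fun a _ => Finset.sum_congr rfl fun b _ => ?_
    congr 1
    abel
  · rw [← div_weylOm' hE hn d]
    refine Finset.sum_congr rfl fun a _ => Finset.sum_congr rfl fun b _ => ?_
    congr 1
    abel

  · refine Finset.sum_eq_zero fun a _ => Finset.sum_eq_zero fun b _ => ?_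
    rw [weylOm_antisymm]
    simp

lemma sum_gi_ann_covT : ∑ a, ∑ b, 𝒢.gi a b • ann (.inr (.inl b)) (covT 𝒢 p a (skewXOm 𝒢 p))
    = divSkew 𝒢 p + (n : R) • ann (.inr (.inr ())) (skewXOm 𝒢 p) := by
  rw [← AlgMetric.trace_g (𝒢 := 𝒢), divSkew]
  simp only [Finset.sum_smul, ← Finset.sum_add_distrib, mul_smul, ← smul_add]
  refine Finset.sum_congr rfl fun a _ => Finset.sum_congr rfl fun b _ => ?_
  rw [ann_covT]
  simp only [Fintype.sum_sum_type, Finset.univ_unique, Finset.sum_singleton, conn, neg_smul,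
    Finset.sum_neg_distrib, PUnit.default_eq_unit, ann_Y_skewXOm, smul_zero, zero_add]
  congr 1
  abel

/-- The `Y`-component of a tractor derivative is the derivative of the `Y`-component minus a
`Z`-component. As `skewXOm` has no `Y`-component, the Laplacian gives minus one divergence from each
of its two derivatives, the outer one accompanied by a metric trace. -/
lemma ann_Y_lapF_skewXOm : ann (.inl ()) (lapF 𝒢 p (skewXOm 𝒢 p))
    = -((2 : R) • divSkew 𝒢 p + (n : R) • ann (.inr (.inr ())) (skewXOm 𝒢 p)) := by
  have hY : ∀ a (V : Fock (TIdx n) R), ann (.inl ()) (covT 𝒢 p a V)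
      = covT 𝒢 p a (ann (.inl ()) V) - ann (.inr (.inl a)) V := fun a V => by
    rw [ann_covT]
    simp [conn, sub_eq_add_neg]
  have h2 : ∑ a, ∑ b, 𝒢.gi a b • ann (.inr (.inl a)) (covT 𝒢 p b (skewXOm 𝒢 p))
      = divSkew 𝒢 p + (n : R) • ann (.inr (.inr ())) (skewXOm 𝒢 p) := by
    rw [← sum_gi_ann_covT, Finset.sum_comm]
    simp only [𝒢.gi_symm]
  rw [two_smul, add_assoc, ← h2, divSkew, lapF]
  simp only [map_sum, map_smul, map_sub, ← Finset.sum_add_distrib, ← Finset.sum_neg_distrib,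
    ← smul_add, ← smul_neg]
  refine Finset.sum_congr rfl fun a _ => Finset.sum_congr rfl fun b _ => ?_
  simp only [hY, ann_Y_skewXOm, covT_zero, zero_sub, covT_neg, smul_neg, Finset.sum_neg_distrib]
  rw [← smul_neg]
  congr 1
  abel

/-- `(n - 2)` times the `W`-tractor, as the tractor divergence of `skewXOm`. -/
def wDiv (𝒢 : AlgMetric n R) (p : R) : Fock (TIdx n) R :=
  -((n : R) - 4) • ann (.inr (.inr ())) (skewXOm 𝒢 p)
    + ((n : R) - 4) • ∑ a, ∑ b, 𝒢.gi a b • ann (.inr (.inl b)) (covT 𝒢 p a (skewXOm 𝒢 p))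
    - ann (.inl ()) (lapF 𝒢 p (skewXOm 𝒢 p))

/-- With divergence `-2` and `X`-component `1` in units of the Weyl curvature, the three terms sum
to `-(n-4) + (n-4)(n-2) + (n-4) = (n-4)(n-2)`. -/
lemma ann_wDiv (hE : 𝒢.IsEinsteinWith p) (hn : 3 ≤ n) (B C : TIdx n) :
    ann C (ann B (wDiv 𝒢 p)) = (((n : R) - 2) * ((n : R) - 4)) • weylOm 𝒢 p B C := by
  rw [wDiv, sum_gi_ann_covT, ann_Y_lapF_skewXOm]
  simp only [map_add, map_sub, map_neg, map_smul, ann_divSkew hE hn, ann_X_skewXOm]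
  module

lemma wDiv_apply (hE : 𝒢.IsEinsteinWith p) (hn : 3 ≤ n) (B C E F : TIdx n) :
    wDiv 𝒢 p 4 ![B, C, E, F] = (((n : R) - 2) * ((n : R) - 4)) * weyl4 𝒢 p B C E F := by
  have h := congrFun (congrFun (ann_wDiv hE hn B C) 2) ![E, F]
  simpa [weylOm] using h

end Fock
end
end EinsteinTractor

namespace EinsteinTractor

noncomputable section

/-! ## The operator `W♯♯` -/

namespace Fock

set_option linter.unusedSectionVars false

variable {n : ℕ} {R : Type*} [CommRing R] [Algebra ℝ R] {𝒢 : AlgMetric n R} {p : R}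

/-- The inverse tractor metric. -/
def hInv (𝒢 : AlgMetric n R) : TIdx n → TIdx n → R
  | .inl _, .inr (.inr _) => 1
  | .inr (.inr _), .inl _ => 1
  | .inr (.inl a), .inr (.inl b) => 𝒢.gi a b
  | _, _ => 0

/-- The action of the endomorphism obtained from `S` by raising its first index. -/
def sharpF (𝒢 : AlgMetric n R) (S : TIdx n → TIdx n → R) (V : Fock (TIdx n) R) :
    Fock (TIdx n) R :=
  act (fun A B => -∑ C, hInv 𝒢 B C * S C A) V

/-- The two index pairs of `W` acting successively. -/
def sharpSharpF (𝒢 : AlgMetric n R) (W : TIdx n → TIdx n → TIdx n → TIdx n → R)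
    (V : Fock (TIdx n) R) : Fock (TIdx n) R := fun t A =>
  -∑ j, ∑ B, ∑ C, hInv 𝒢 B C * sharpF 𝒢 (W C (A j)) V t (Function.update A j B)

lemma Kmat_eq (a b c d : Fin n) : OpCalc.Kmat 𝒢 p a b c d
    = -∑ e, 𝒢.gi d e * 𝒢.weylL p a b e c := by
  have h : ∀ e, 𝒢.gi d e * 𝒢.weylL p a b e c
      = -∑ f, OpCalc.Kmat 𝒢 p a b c f * (𝒢.g f e * 𝒢.gi e d) := fun e => by
    rw [AlgMetric.weylL_antisymm', ← AlgMetric.sum_Kmat_g, mul_neg, Finset.mul_sum, 𝒢.gi_symm]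
    congr 1
    exact Finset.sum_congr rfl fun f _ => by ring
  simp only [h, Finset.sum_neg_distrib, neg_neg]
  rw [Finset.sum_comm]
  simp only [← Finset.mul_sum, 𝒢.g_gi]
  simp

lemma Kmat_antisymm (a b : Fin n) : OpCalc.Kmat 𝒢 p a b = -OpCalc.Kmat 𝒢 p b a := by
  funext c d
  simp only [Pi.neg_apply, Kmat_eq, fun e => AlgMetric.weylL_antisymm (𝒢 := 𝒢) (p := p) a b e c,
    mul_neg, Finset.sum_neg_distrib]

lemma sharpF_weyl4 (c a : Fin n) (V : Fock (TIdx n) R) :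
    sharpF 𝒢 (weyl4 𝒢 p (.inr (.inl c)) (.inr (.inl a))) V
      = act (zblock (OpCalc.Kmat 𝒢 p c a)) V := by
  rw [sharpF]
  congr 1
  funext A B
  rcases A with _ | _ | _ <;> rcases B with _ | _ | _ <;>
    simp [hInv, weyl4, zblock, Kmat_eq]

lemma sharpF_zero (V : Fock (TIdx n) R) : sharpF 𝒢 (fun _ _ => 0) V = 0 := by
  funext t L
  simp [sharpF, act_apply]

lemma sharpF_mul (r : R) (S : TIdx n → TIdx n → R) (V : Fock (TIdx n) R) :
    sharpF 𝒢 (fun E F => r * S E F) V = r • sharpF 𝒢 S V := by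
  funext t L
  simp only [sharpF, act_apply, Pi.smul_apply, smul_eq_mul, mul_left_comm _ r, ← Finset.mul_sum,
    ← mul_neg, mul_assoc]

lemma sharpSharpF_mul (r : R) (W : TIdx n → TIdx n → TIdx n → TIdx n → R)
    (V : Fock (TIdx n) R) :
    sharpSharpF 𝒢 (fun B C E F => r * W B C E F) V = r • sharpSharpF 𝒢 W V := by
  funext t L
  simp only [sharpSharpF, sharpF_mul, Pi.smul_apply, smul_eq_mul, mul_left_comm _ r,
    ← Finset.mul_sum, ← mul_neg]

/-- Each `♯` carries a minus sign. The inner one is absorbed in the relation between the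
endomorphism `K` and the lowered Weyl tensor, the outer one in the skew-symmetry of the first index
pair. -/
lemma sharpSharpF_weyl4 (V : altModule (TIdx n) R) :
    sharpSharpF 𝒢 (weyl4 𝒢 p) V.1 = ((tcalc 𝒢).weyl p • V).1 := by
  have hY : ∀ (u : Unit) C, weyl4 𝒢 p C (.inl u) = fun _ _ => 0 := fun u C => by
    funext E F; rcases C with _ | _ | _ <;> rfl
  have hX : ∀ (u : Unit) C, weyl4 𝒢 p C (.inr (.inr u)) = fun _ _ => 0 := fun u C => by
    funext E F; rcases C with _ | _ | _ <;> rfl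
  have hY' : ∀ (u : Unit) C, weyl4 𝒢 p (.inl u) C = fun _ _ => 0 := fun u C => by
    funext E F; rfl
  have hX' : ∀ (u : Unit) C, weyl4 𝒢 p (.inr (.inr u)) C = fun _ _ => 0 := fun u C => by
    funext E F; rfl
  have hz : ∀ c a : Fin n, zblock (OpCalc.Kmat 𝒢 p c a) = -zblock (OpCalc.Kmat 𝒢 p a c) := by
    intro c a
    rw [Kmat_antisymm]
    funext A B
    rcases A with _ | _ | _ <;> rcases B with _ | _ | _ <;> simp [zblock]
  have hneg : ∀ (c a : Fin n) t L, act (zblock (OpCalc.Kmat 𝒢 p c a)) V.1 t L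
      = -act (zblock (OpCalc.Kmat 𝒢 p a c)) V.1 t L := fun c a t L => by
    rw [hz]
    simp only [act_apply, Pi.neg_apply, neg_mul, Finset.sum_neg_distrib]
  rw [coe_weyl]
  funext t L
  simp only [sharpSharpF, Finset.sum_apply]
  simp only [act_apply _ (act _ _)]
  have key : ∀ (A B : TIdx n) (L : Fin t → TIdx n),
      -∑ C, hInv 𝒢 B C * sharpF 𝒢 (weyl4 𝒢 p C A) V.1 t L
        = ∑ a, ∑ b, (if A = .inr (.inl a) then giVec 𝒢 b B else 0)
          * act (zblock (OpCalc.Kmat 𝒢 p a b)) V.1 t L := by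
    intro A B L
    rcases A with u | a | u
    · simp [hY, sharpF_zero]
    · rcases B with u | b | u <;>
        simp [hInv, giVec, hY', hX', sharpF_zero, sharpF_weyl4, fun c c' => 𝒢.gi_symm c c', fun c => hneg c a t L]
    · simp [hX, sharpF_zero]
  have comm4 : ∀ f : Fin n → Fin n → Fin t → TIdx n → R,
      ∑ a, ∑ b, ∑ j, ∑ B, f a b j B = ∑ j, ∑ B, ∑ a, ∑ b, f a b j B := fun f =>
    calc _ = ∑ a, ∑ j, ∑ b, ∑ B, f a b j B := Finset.sum_congr rfl fun a _ => Finset.sum_comm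
      _ = ∑ j, ∑ a, ∑ b, ∑ B, f a b j B := Finset.sum_comm
      _ = ∑ j, ∑ a, ∑ B, ∑ b, f a b j B :=
        Finset.sum_congr rfl fun j _ => Finset.sum_congr rfl fun a _ => Finset.sum_comm
      _ = _ := Finset.sum_congr rfl fun j _ => Finset.sum_comm
  rw [comm4]
  simp only [← key, Finset.sum_neg_distrib]

end Fock
end
end EinsteinTractor

namespace EinsteinTractor

noncomputable section

/-! ## The algebra of smooth functions on an open set -/

section SmoothAlg

variable {n : ℕ} {U : Set (Space n)}

/-- The functions that are smooth on `U`. -/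
def smoothAlg (U : Set (Space n)) : Subalgebra ℝ (Space n → ℝ) where
  carrier := {φ | ContDiffOn ℝ ∞ φ U}
  mul_mem' h h' := ContDiffOn.mul h h'
  add_mem' h h' := ContDiffOn.add h h'
  algebraMap_mem' _ := contDiffOn_const

/-- Evaluation at a point. -/
def evalAlg (y : Space n) : smoothAlg U →ₐ[ℝ] ℝ :=
  (Pi.evalAlgHom ℝ (fun _ : Space n => ℝ) y).comp (smoothAlg U).val

lemma two_le_infty : (2 : WithTop ℕ∞) ≤ ∞ := by
  have h : ((2 : ℕ∞) : WithTop ℕ∞) ≤ ((⊤ : ℕ∞) : WithTop ℕ∞) := WithTop.coe_le_coe.mpr le_top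
  exact h

lemma evalAlg_def (y : Space n) (x : smoothAlg U) : evalAlg y x = x.1 y := rfl

lemma smoothAlg_ext {x x' : smoothAlg U} (h : ∀ y, evalAlg y x = evalAlg y x') : x = x' :=
  Subtype.ext (funext h)

lemma pd_congr (hU : IsOpen U) {F F' : Space n → ℝ} (h : ∀ y ∈ U, F y = F' y) (a : Fin n)
    {y : Space n} (hy : y ∈ U) : pd a F y = pd a F' y := by
  rw [pd, pd, Filter.EventuallyEq.fderiv_eq]
  filter_upwards [hU.mem_nhds hy] with z hz using h z hz

lemma contDiffAt_smoothAlg (hU : IsOpen U) (x : smoothAlg U) {y : Space n} (hy : y ∈ U) :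
    ContDiffAt ℝ ∞ x.1 y :=
  ContDiffOn.contDiffAt x.2 (hU.mem_nhds hy)

lemma differentiableAt_smoothAlg (hU : IsOpen U) (x : smoothAlg U) {y : Space n} (hy : y ∈ U) :
    DifferentiableAt ℝ x.1 y :=
  (contDiffAt_smoothAlg hU x hy).differentiableAt (by simp)

open scoped Classical in
/-- The partial derivatives as derivations. -/
def pder (hU : IsOpen U) (a : Fin n) : Derivation ℝ (smoothAlg U) (smoothAlg U) :=
  Derivation.mk'
    -- Elements of the algebra are arbitrary off `U`. Setting the derivative to zero there keeps the
    -- Leibniz rule and commutativity valid at every point.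
    { toFun := fun x => ⟨fun y => if y ∈ U then pd a x.1 y else 0, by
        have h : ContDiffOn ℝ ∞ (pd a x.1) U :=
          ((ContDiffOn.fderiv_of_isOpen (m := ∞) x.2 hU (by simp)).clm_apply contDiffOn_const)
        exact h.congr fun y hy => if_pos hy⟩
      map_add' := fun x x' => smoothAlg_ext fun y => by
        simp only [map_add, evalAlg_def]
        split_ifs with hy
        · simp only [pd]
          erw [fderiv_add (differentiableAt_smoothAlg hU x hy) (differentiableAt_smoothAlg hU x' hy)]
          rfl
        · simp
      map_smul' := fun r x => smoothAlg_ext fun y => by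
        simp only [map_smul, evalAlg_def, RingHom.id_apply]
        split_ifs with hy
        · simp only [pd]
          erw [fderiv_const_smul (differentiableAt_smoothAlg hU x hy) r]
          rfl
        · simp }
    (fun x x' => smoothAlg_ext fun y => by
      simp only [LinearMap.coe_mk, AddHom.coe_mk, smul_eq_mul, map_add, map_mul, evalAlg_def]
      split_ifs with hy
      · simp only [pd]
        erw [fderiv_mul (differentiableAt_smoothAlg hU x hy) (differentiableAt_smoothAlg hU x' hy)]
        rfl
      · simp)

lemma evalAlg_pder (hU : IsOpen U) (a : Fin n) (x : smoothAlg U) {y : Space n} (hy : y ∈ U) :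
    evalAlg y (pder hU a x) = pd a x.1 y :=
  if_pos hy

lemma evalAlg_pder_of_notMem (hU : IsOpen U) (a : Fin n) (x : smoothAlg U) {y : Space n}
    (hy : y ∉ U) : evalAlg y (pder hU a x) = 0 :=
  if_neg hy

lemma pder_comm (hU : IsOpen U) (a b : Fin n) (x : smoothAlg U) :
    pder hU a (pder hU b x) = pder hU b (pder hU a x) := by
  refine smoothAlg_ext fun y => ?_
  by_cases hy : y ∈ U
  · have key : ∀ a b, evalAlg y (pder hU a (pder hU b x))
        = fderiv ℝ (fderiv ℝ x.1) y (EuclideanSpace.single a 1) (EuclideanSpace.single b 1) := by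
      intro a b
      rw [evalAlg_pder hU _ _ hy, pd_congr hU (F := (pder hU b x).1) (F' := pd b x.1)
        (fun z hz => evalAlg_pder hU b x hz) a hy]
      have hd : DifferentiableAt ℝ (fderiv ℝ x.1) y :=
        ((contDiffAt_smoothAlg hU x hy).fderiv_right (m := 1)
          (by norm_num; exact two_le_infty)).differentiableAt (by simp)
      change fderiv ℝ (fun z => fderiv ℝ x.1 z (EuclideanSpace.single b 1)) y _ = _
      rw [fderiv_clm_apply hd (differentiableAt_const _)]
      simp
    rw [key, key]
    exact (contDiffAt_smoothAlg hU x hy).isSymmSndFDerivAt (by simp; exact two_le_infty) _ _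
  · rw [evalAlg_pder_of_notMem hU _ _ hy, evalAlg_pder_of_notMem hU _ _ hy]

/-- The type of functions that are smooth on `U`. -/
def SmoothFn (U : Set (Space n)) : Type := smoothAlg U

instance : CommRing (SmoothFn U) := inferInstanceAs (CommRing (smoothAlg U))

instance : Algebra ℝ (SmoothFn U) := inferInstanceAs (Algebra ℝ (smoothAlg U))

/-- A smooth function as an element of `SmoothFn U`. -/
def SmoothFn.of (φ : Space n → ℝ) (h : ContDiffOn ℝ ∞ φ U) : SmoothFn U :=
  (⟨φ, h⟩ : smoothAlg U)

/-- Evaluation at a point. -/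
def evalAt (y : Space n) : SmoothFn U →ₐ[ℝ] ℝ := evalAlg (U := U) y

lemma evalAt_of (y : Space n) (φ : Space n → ℝ) (h : ContDiffOn ℝ ∞ φ U) :
    evalAt y (SmoothFn.of φ h) = φ y := rfl

lemma SmoothFn.ext {x x' : SmoothFn U} (h : ∀ y, evalAt y x = evalAt y x') : x = x' :=
  smoothAlg_ext h

/-- The partial derivatives as derivations. -/
def SmoothFn.der (hU : IsOpen U) (a : Fin n) : Derivation ℝ (SmoothFn U) (SmoothFn U) :=
  pder hU a

lemma pd_eq_evalAt (hU : IsOpen U) {F : Space n → ℝ} {x : SmoothFn U}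
    (h : ∀ y ∈ U, F y = evalAt y x) (a : Fin n) {y : Space n} (hy : y ∈ U) :
    pd a F y = evalAt y (SmoothFn.der hU a x) :=
  (pd_congr hU h a hy).trans (evalAlg_pder hU a x hy).symm

lemma evalAt_der_of_notMem (hU : IsOpen U) (a : Fin n) (x : SmoothFn U) {y : Space n}
    (hy : y ∉ U) : evalAt y (SmoothFn.der hU a x) = 0 :=
  evalAlg_pder_of_notMem hU a x hy

end SmoothAlg

/-! ### Metrics in a coordinate patch and their algebraic counterparts -/

/-- A pseudo-Riemannian metric in a coordinate patch. -/
structure PatchMetric (n : ℕ) where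
  /-- the coordinate patch -/
  dom : Set (Space n)
  isOpen : IsOpen dom
  /-- the components -/
  comp : LMetric n
  smooth : ∀ a b, ContDiffOn ℝ ∞ (fun y => comp y a b) dom
  symm : ∀ y ∈ dom, ∀ a b, comp y a b = comp y b a
  det_ne : ∀ y ∈ dom, (comp y).det ≠ 0

namespace PatchMetric

variable {n : ℕ} (Q : PatchMetric n)

lemma contDiffOn_det {ι : Type*} [Fintype ι] [DecidableEq ι] {U : Set (Space n)}
    {A : Space n → Matrix ι ι ℝ} (h : ∀ a b, ContDiffOn ℝ ∞ (fun y => A y a b) U) :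
    ContDiffOn ℝ ∞ (fun y => (A y).det) U := by
  simp only [Matrix.det_apply]
  exact ContDiffOn.sum fun σ _ => (contDiffOn_prod fun i _ => h _ _).const_smul _

lemma contDiffOn_ginv (a b : Fin n) : ContDiffOn ℝ ∞ (fun y => ginv Q.comp y a b) Q.dom := by
  simp only [ginv, Matrix.inv_def, Ring.inverse_eq_inv', Matrix.smul_apply, smul_eq_mul,
    Matrix.adjugate_apply]
  refine ((contDiffOn_det Q.smooth).inv Q.det_ne).mul (contDiffOn_det fun c d => ?_)
  simp only [Matrix.updateRow_apply]
  split_ifs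
  · exact contDiffOn_const
  · exact Q.smooth _ _

lemma ginv_symm {y : Space n} (hy : y ∈ Q.dom) (a b : Fin n) :
    ginv Q.comp y a b = ginv Q.comp y b a := by
  have h : (Q.comp y).transpose = Q.comp y := Matrix.ext fun a b => Q.symm y hy b a
  rw [ginv, ginv, ← Matrix.transpose_apply (Q.comp y)⁻¹, Matrix.transpose_nonsing_inv, h]

open scoped Classical in
/-- The metric over the algebra of smooth functions on the patch. -/
def alg : AlgMetric n (SmoothFn Q.dom) where
  der := SmoothFn.der Q.isOpen
  der_comm := pder_comm Q.isOpen
  -- The axioms must hold as equalities of functions on the whole coordinate space, so the metric is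
  -- replaced by the identity matrix off the patch.
  g a b := SmoothFn.of (fun y => if y ∈ Q.dom then Q.comp y a b else (1 : Matrix _ _ ℝ) a b)
    ((Q.smooth a b).congr fun y hy => if_pos hy)
  gi a b := SmoothFn.of (fun y => if y ∈ Q.dom then ginv Q.comp y a b else (1 : Matrix _ _ ℝ) a b)
    ((Q.contDiffOn_ginv a b).congr fun y hy => if_pos hy)
  g_symm a b := SmoothFn.ext fun y => by
    simp only [evalAt_of]
    split_ifs with hy
    · exact Q.symm y hy a b
    · simp [Matrix.one_apply, eq_comm]
  gi_symm a b := SmoothFn.ext fun y => by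
    simp only [evalAt_of]
    split_ifs with hy
    · exact Q.ginv_symm hy a b
    · simp [Matrix.one_apply, eq_comm]
  gi_g a c := SmoothFn.ext fun y => by
    have h1 : evalAt y (if a = c then (1 : SmoothFn Q.dom) else 0) = (1 : Matrix _ _ ℝ) a c := by
      rw [Matrix.one_apply]; split_ifs <;> simp
    rw [h1]
    simp only [map_sum, map_mul, evalAt_of]
    split_ifs with hy
    · rw [← Matrix.nonsing_inv_mul (Q.comp y) (isUnit_iff_ne_zero.mpr (Q.det_ne y hy))]; rfl
    · simp [Matrix.one_apply]

variable {Q} {y : Space n}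

lemma evalAt_g (hy : y ∈ Q.dom) (a b : Fin n) : evalAt y (Q.alg.g a b) = Q.comp y a b :=
  if_pos hy

lemma evalAt_gi (hy : y ∈ Q.dom) (a b : Fin n) : evalAt y (Q.alg.gi a b) = ginv Q.comp y a b :=
  if_pos hy

lemma pd_eq {F : Space n → ℝ} {x : SmoothFn Q.dom} (h : ∀ y ∈ Q.dom, F y = evalAt y x)
    (hy : y ∈ Q.dom) (a : Fin n) : pd a F y = evalAt y (Q.alg.der a x) :=
  pd_eq_evalAt Q.isOpen h a hy

lemma christoffel_eq (c a b : Fin n) (hy : y ∈ Q.dom) :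
    christoffel Q.comp c a b y = evalAt y (Q.alg.chr c a b) := by
  have hg : ∀ a b c, pd c (fun z => Q.comp z a b) y = evalAt y (Q.alg.der c (Q.alg.g a b)) :=
    fun a b c => pd_eq (fun z hz => (evalAt_g hz a b).symm) hy c
  simp only [christoffel, AlgMetric.chr, AlgMetric.chl, map_sum, map_mul, map_sub, map_add,
    evalAt_gi hy, hg, AlgMetric.half, AlgHom.commutes, Finset.mul_sum]
  refine Finset.sum_congr rfl fun d _ => ?_
  simp only [Algebra.algebraMap_self, RingHom.id_apply]
  ring

lemma riemann_eq (a b c d : Fin n) (hy : y ∈ Q.dom) :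
    riemann Q.comp a b c d y = evalAt y (Q.alg.riem a b c d) := by
  have h : ∀ a b c d, pd d (christoffel Q.comp c a b) y = evalAt y (Q.alg.der d (Q.alg.chr c a b)) :=
    fun a b c d => pd_eq (fun z hz => christoffel_eq c a b hz) hy d
  simp only [riemann, AlgMetric.riem, map_sum, map_mul, map_sub, map_add, h, christoffel_eq _ _ _ hy]

lemma ricci_eq (b d : Fin n) (hy : y ∈ Q.dom) :
    ricci Q.comp b d y = evalAt y (Q.alg.ric b d) := by
  simp only [ricci, AlgMetric.ric, map_sum, riemann_eq _ _ _ _ hy]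

/-- The trace of the Schouten tensor divided by the dimension. -/
def pJ (Q : PatchMetric n) : SmoothFn Q.dom :=
  algebraMap ℝ _ (1 / (2 * n * ((n : ℝ) - 1))) * ∑ a, ∑ b, Q.alg.gi a b * Q.alg.ric a b

lemma scal_eq (hn : 3 ≤ n) (hy : y ∈ Q.dom) :
    scal Q.comp y = 2 * n * ((n : ℝ) - 1) * evalAt y Q.pJ := by
  have h3 : (3 : ℝ) ≤ n := by exact_mod_cast hn
  have h0 : (n : ℝ) ≠ 0 := by linarith
  have h1 : (n : ℝ) - 1 ≠ 0 := by linarith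
  simp only [scal, pJ, map_mul, map_sum, AlgHom.commutes, evalAt_gi hy, ricci_eq _ _ hy,
    Algebra.algebraMap_self, RingHom.id_apply]
  field_simp

lemma sum_ginv_comp (hy : y ∈ Q.dom) : ∑ a, ∑ b, ginv Q.comp y a b * Q.comp y a b = n := by
  have h := congrArg (evalAt y) (AlgMetric.trace_g (𝒢 := Q.alg))
  simpa only [map_sum, map_mul, map_natCast, evalAt_gi hy, evalAt_g hy] using h

lemma schoutenTrace_eq (hn : 3 ≤ n) (hy : y ∈ Q.dom) :
    schoutenTrace Q.comp y = n * evalAt y Q.pJ := by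
  have h3 : (3 : ℝ) ≤ n := by exact_mod_cast hn
  have h1 : (n : ℝ) - 1 ≠ 0 := by linarith
  have h2 : (n : ℝ) - 2 ≠ 0 := by linarith
  have h : schoutenTrace Q.comp y = (1 / ((n : ℝ) - 2)) * (scal Q.comp y
      - scal Q.comp y / (2 * ((n : ℝ) - 1)) * ∑ a, ∑ b, ginv Q.comp y a b * Q.comp y a b) := by
    conv_rhs => enter [2, 1]; rw [scal]
    simp only [schoutenTrace, schouten, Finset.mul_sum, ← Finset.sum_sub_distrib]
    exact Finset.sum_congr rfl fun a _ => Finset.sum_congr rfl fun b _ => by ring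
  rw [h, sum_ginv_comp hy, scal_eq hn hy]
  field_simp
  ring

/-- The Einstein condition in a patch. -/
def IsEinstein (Q : PatchMetric n) : Prop :=
  ∀ y ∈ Q.dom, ∀ a b, schouten Q.comp a b y = schoutenTrace Q.comp y / (n : ℝ) * Q.comp y a b

lemma IsEinstein.schouten_eq (hQ : Q.IsEinstein) (hn : 3 ≤ n) (hy : y ∈ Q.dom) (a b : Fin n) :
    schouten Q.comp a b y = evalAt y (Q.pJ * Q.alg.g a b) := by
  have h0 : (n : ℝ) ≠ 0 := by positivity
  rw [hQ y hy, schoutenTrace_eq hn hy, map_mul, evalAt_g hy, mul_div_cancel_left₀ _ h0]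

/-- On the patch this is the relation between the Schouten and Ricci tensors. Off the patch the
derivations are zero, so curvature and `p` vanish and the equation is trivial. -/
lemma IsEinstein.isEinsteinWith (hQ : Q.IsEinstein) (hn : 3 ≤ n) :
    Q.alg.IsEinsteinWith Q.pJ := by
  have h3 : (3 : ℝ) ≤ n := by exact_mod_cast hn
  have h1 : (n : ℝ) - 1 ≠ 0 := by linarith
  have h2 : (n : ℝ) - 2 ≠ 0 := by linarith
  refine fun b d => SmoothFn.ext fun y => ?_
  by_cases hy : y ∈ Q.dom
  · have h := hQ.schouten_eq hn hy b d
    rw [schouten, scal_eq hn hy, map_mul, ricci_eq _ _ hy, evalAt_g hy] at h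
    simp only [map_mul, map_sub, map_natCast, map_one, evalAt_g hy, map_ofNat]
    field_simp at h
    linear_combination h
  · have hd : ∀ a x, evalAt y (Q.alg.der a x) = 0 := fun a x =>
      evalAt_der_of_notMem Q.isOpen a x hy
    have hr : ∀ b d, evalAt y (Q.alg.ric b d) = 0 := by
      intro b d
      simp only [AlgMetric.ric, AlgMetric.riem, AlgMetric.chr, AlgMetric.chl, map_sum, map_add,
        map_sub, map_mul, hd]
      simp
    simp [hr, pJ]

end PatchMetric
end
end EinsteinTractor

namespace EinsteinTractor

noncomputable section

/-! ## The tractor calculus in a patch -/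

namespace Fock

/-- The curvature of the tractor connection. -/
lemma conn_curv {n : ℕ} {R : Type*} [CommRing R] [Algebra ℝ R] {𝒢 : AlgMetric n R} {p : R}
    (hp : ∀ a, 𝒢.der a p = 0) (a b : Fin n) (C B : TIdx n) :
    𝒢.der a (conn 𝒢 p b C B) - 𝒢.der b (conn 𝒢 p a C B)
      + ∑ F, (conn 𝒢 p a C F * conn 𝒢 p b F B - conn 𝒢 p b C F * conn 𝒢 p a F B)
      = zblock (OpCalc.Kmat 𝒢 p a b) C B := by
  have d1 : ∀ a (c d : Fin n) (x : R), 𝒢.der a x = 0 →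
      𝒢.der a (if c = d then x else 0) = 0 := fun a c d x hx => by split_ifs <;> simp [hx]
  have hg2 : ∀ c, 𝒢.der a (𝒢.g b c) - 𝒢.der b (𝒢.g a c)
      = ∑ f, 𝒢.chr f a c * 𝒢.g b f - ∑ f, 𝒢.chr f b c * 𝒢.g a f := fun c => by
    rw [𝒢.der_g', 𝒢.der_g']
    simp only [fun f => 𝒢.chr_symm f b a]
    ring
  have hc : ∀ c d a b, ∑ f, 𝒢.chr f a c * 𝒢.chr d b f = ∑ f, 𝒢.chr d b f * 𝒢.chr f a c :=
    fun c d a b => Finset.sum_congr rfl fun f _ => mul_comm _ _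
  rcases C with u | c | u <;> rcases B with u | d | u <;>
    simp only [conn, zblock, map_zero, map_neg, d1, hp, Fintype.sum_sum_type, Finset.univ_unique,
      Finset.sum_singleton, mul_zero, zero_mul, add_zero, zero_add, Finset.sum_const_zero,
      sub_self, neg_zero, ite_mul, mul_ite, Finset.sum_sub_distrib, Finset.sum_ite_eq',
      Finset.mem_univ, if_true, Derivation.leibniz, smul_eq_mul, d1 _ _ _ (-1) (by simp)]
  · rw [𝒢.g_symm b a]; ring
  · rw [𝒢.chr_symm d b a]; simp
  · rw [𝒢.g_symm b a]; ring
  · simp only [neg_mul, Finset.sum_neg_distrib, mul_left_comm _ p, ← Finset.mul_sum]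
    linear_combination p * hg2 c
  · simp only [OpCalc.Kmat, AlgMetric.riem, Finset.sum_sub_distrib, neg_mul_neg, hc]
    split_ifs <;> ring
  · simp only [neg_mul, Finset.sum_neg_distrib]
    linear_combination hg2 c
  · rw [𝒢.g_symm b a]; ring
  · rw [𝒢.chr_symm d b a]; simp
  · rw [𝒢.g_symm b a]; ring

end Fock

namespace PatchMetric

open Fock

variable {n : ℕ} {Q : PatchMetric n} {y : Space n} {s t : ℕ}

/-- The components of `V` in the patch are given by `W`. -/
def Rep (V : TField n s t) (W : (Fin s → Fin n) → (Fin t → TIdx n) → SmoothFn Q.dom) : Prop :=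
  ∀ y ∈ Q.dom, ∀ a A, V y a A = evalAt y (W a A)

/-- The components of `V` in the patch are those of a tensor `W` of the relevant degree. -/
def RepT (V : Tractor n t) (W : Fock (TIdx n) (SmoothFn Q.dom)) : Prop :=
  Rep V fun _ A => W t A

variable (hQ : Q.IsEinstein) (hn : 3 ≤ n)
include hQ hn

lemma tractorConn_eq (hy : y ∈ Q.dom) (a : Fin n) (A B : TIdx n) :
    tractorConn Q.comp a y A B = evalAt y (conn Q.alg Q.pJ a A B) := by
  have hs := fun a b => hQ.schouten_eq hn hy a b
  rcases A with _ | b | _ <;> rcases B with _ | c | _ <;>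
    simp only [tractorConn, conn, map_zero, map_neg, hs, evalAt_g hy, christoffel_eq _ _ _ hy]
  · split_ifs <;> simp
  · have h : ∑ b, ginv Q.comp y b c * evalAt y (Q.pJ * Q.alg.g a b)
        = evalAt y (Q.pJ * ∑ b, Q.alg.g a b * Q.alg.gi b c) := by
      simp only [map_mul, map_sum, Finset.mul_sum, evalAt_gi hy]
      exact Finset.sum_congr rfl fun b _ => by ring
    rw [h, AlgMetric.g_gi]
    by_cases hc : c = a
    · simp [hc]
    · simp [hc, Ne.symm hc]

/-- The coupled covariant derivative in components. -/
def covR (Q : PatchMetric n) (W : (Fin s → Fin n) → (Fin t → TIdx n) → SmoothFn Q.dom)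
    (a : Fin (s + 1) → Fin n) (A : Fin t → TIdx n) : SmoothFn Q.dom :=
  Q.alg.der (a 0) (W (Fin.tail a) A)
    - ∑ i, ∑ c, Q.alg.chr c (a 0) (Fin.tail a i) * W (Function.update (Fin.tail a) i c) A
    + ∑ j, ∑ B, conn Q.alg Q.pJ (a 0) (A j) B * W (Fin.tail a) (Function.update A j B)

lemma Rep.covD {V : TField n s t} {W} (h : Rep (Q := Q) V W) : Rep (covD Q.comp V) (Q.covR W) := by
  intro y hy a A
  simp only [EinsteinTractor.covD, covR, map_add, map_sub, map_sum, map_mul,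
    tractorConn_eq hQ hn hy, christoffel_eq _ _ _ hy, h y hy,
    pd_eq (Q := Q) (fun z hz => h z hz (Fin.tail a) A) hy]

lemma Rep.lap {V : TField n s t} {W} (h : Rep (Q := Q) V W) : Rep (lap Q.comp V)
    fun a A => ∑ b, ∑ c, Q.alg.gi b c * Q.covR (Q.covR W) (Fin.cons b (Fin.cons c a)) A := by
  intro y hy a A
  simp only [EinsteinTractor.lap, map_sum, map_mul, evalAt_gi hy,
    ((h.covD hQ hn).covD hQ hn) y hy]

omit hQ hn in
lemma covR_covT (V : Fock (TIdx n) (SmoothFn Q.dom)) :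
    Q.covR (fun (_ : Fin 0 → Fin n) A => V t A) = fun a A => covT Q.alg Q.pJ (a 0) V t A := by
  funext a A
  simp [covR, covT, act_apply]

lemma RepT.covD {V : Tractor n t} {W} (h : RepT (Q := Q) V W) :
    Rep (covD Q.comp V) fun a A => covT Q.alg Q.pJ (a 0) W t A := by
  rw [← covR_covT]
  exact Rep.covD hQ hn h

/-- The second derivative acts on a field with one coordinate index; its Christoffel term on that
index is the correction built into `lapF`. -/
lemma RepT.lap {V : Tractor n t} {W} (h : RepT (Q := Q) V W) :
    RepT (lap Q.comp V) (lapF Q.alg Q.pJ W) := by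
  intro y hy a A
  rw [Rep.lap hQ hn h y hy]
  congr 1
  simp only [lapF, Finset.sum_apply, Pi.smul_apply, smul_eq_mul, covR_covT]
  refine Finset.sum_congr rfl fun b _ => Finset.sum_congr rfl fun c _ => ?_
  congr 1
  simp only [covR, Fin.cons_zero, Fin.tail_cons, Fin.sum_univ_succ, Finset.univ_eq_empty,
    Finset.sum_empty, add_zero, Function.update_self, Pi.sub_apply, Finset.sum_apply, Pi.smul_apply,
    smul_eq_mul]
  conv_rhs => rw [covT]
  simp only [Pi.add_apply, derF_apply, act_apply]
  ring

/-- The tractor-`D` operator in terms of tensors over the algebra of smooth functions. -/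
lemma RepT.tractorD {V : Tractor n t} {W} (h : RepT (Q := Q) V W) (w : ℝ) (hy : y ∈ Q.dom)
    (a : Fin 0 → Fin n) (A : Fin (t + 1) → TIdx n) : tractorD Q.comp w V y a A
    = ((n : ℝ) + 2 * w - 2) * w * projY (A 0) * evalAt y (W t (Fin.tail A))
      + ((n : ℝ) + 2 * w - 2) * ∑ b, projZ b (A 0)
        * evalAt y (covT Q.alg Q.pJ b W t (Fin.tail A))
      - projX (A 0) * (evalAt y (lapF Q.alg Q.pJ W t (Fin.tail A))
        + w * (n * evalAt y Q.pJ) * evalAt y (W t (Fin.tail A))) := by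
  simp only [EinsteinTractor.tractorD, h y hy, (h.covD hQ hn) y hy, (h.lap hQ hn) y hy,
    schoutenTrace_eq hn hy, Fin.cons_zero, mul_assoc]

/-! ### The tractor curvature and the `W`-tractor -/

/-- For an Einstein metric with constant `p` the Cotton part of the tractor curvature is absent, and
only the Weyl block remains. -/
lemma tractorCurv_eq (hy : y ∈ Q.dom) (a b : Fin n) (C E : TIdx n) :
    tractorCurv Q.comp a b y C E
      = evalAt y (weyl4 Q.alg Q.pJ (.inr (.inl a)) (.inr (.inl b)) C E) := by
  have h : ∀ B, pd a (fun z => tractorConn Q.comp b z C B) y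
      - pd b (fun z => tractorConn Q.comp a z C B) y
      + ∑ F, (tractorConn Q.comp a y C F * tractorConn Q.comp b y F B
        - tractorConn Q.comp b y C F * tractorConn Q.comp a y F B)
      = evalAt y (zblock (OpCalc.Kmat Q.alg Q.pJ a b) C B) := fun B => by
    rw [← conn_curv ((hQ.isEinsteinWith hn).der_eq_zero hn)]
    simp only [pd_eq (Q := Q) (fun z hz => tractorConn_eq hQ hn hz _ C B) hy, map_add, map_sub,
      map_sum, map_mul, tractorConn_eq hQ hn hy]
  simp only [tractorCurv, h]
  rcases C with u | c | u <;> rcases E with u | d | u <;>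
    simp [zblock, weyl4, hLower, projX, projY, projZ]
  rw [← AlgMetric.sum_Kmat_g]
  simp [evalAt_g hy]

lemma tractorCurv4_eq (hy : y ∈ Q.dom) (B C E F : TIdx n) :
    tractorCurv4 Q.comp y B C E F = evalAt y (weyl4 Q.alg Q.pJ B C E F) := by
  simp only [tractorCurv4, tractorCurv_eq hQ hn hy]
  rcases B with u | b | u <;> rcases C with u | c | u <;> simp [projZ] <;> simp [weyl4]

omit hQ hn in
lemma projX_eq (A : TIdx n) : projX A = evalAt y (pX (R := SmoothFn Q.dom) A) := by
  rcases A with _ | _ | _ <;> simp [projX, pX]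

lemma repT_skewXΩ : RepT (skewXΩ Q.comp)
    (algebraMap ℝ (SmoothFn Q.dom) (1 / 3) • skewXOm Q.alg Q.pJ) := by
  intro y hy a A
  simp only [skewXΩ, tractorCurv4_eq hQ hn hy, projX_eq (Q := Q) (y := y), skewXOm, Pi.smul_apply,
    Pi.single_eq_same, smul_eq_mul, map_mul, map_add, AlgHom.commutes, Algebra.algebraMap_self,
    RingHom.id_apply]

omit hQ hn in
lemma hUpper_eq (hy : y ∈ Q.dom) (A B : TIdx n) :
    hUpper Q.comp y A B = evalAt y (hInv Q.alg A B) := by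
  rcases A with _ | _ | _ <;> rcases B with _ | _ | _ <;> simp [hUpper, hInv, evalAt_gi hy]

omit hQ hn in
lemma covT_algebraMap_smul (a : Fin n) (r : ℝ) (V : Fock (TIdx n) (SmoothFn Q.dom)) :
    covT Q.alg Q.pJ a (algebraMap ℝ (SmoothFn Q.dom) r • V)
      = algebraMap ℝ (SmoothFn Q.dom) r • covT Q.alg Q.pJ a V := by
  rw [covT, covT, derF_smul, act_smul, Derivation.map_algebraMap, zero_smul, add_zero, smul_add]

omit hQ hn in
lemma lapF_algebraMap_smul (r : ℝ) (V : Fock (TIdx n) (SmoothFn Q.dom)) :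
    lapF Q.alg Q.pJ (algebraMap ℝ (SmoothFn Q.dom) r • V)
      = algebraMap ℝ (SmoothFn Q.dom) r • lapF Q.alg Q.pJ V := by
  simp only [lapF, covT_algebraMap_smul, Finset.smul_sum, smul_sub, smul_comm (algebraMap ℝ _ r)]

/-- For weight `-1` the factor `n + 2w - 2` is `n - 4`, so the divergence is `wDiv`. The factor `3`
cancels the `1/3` of the skew-symmetrisation and `n - 2` cancels, which leaves `(n-4)` times the
Weyl curvature. -/
lemma tractorW_eq (hy : y ∈ Q.dom) (B C E F : TIdx n) : tractorW Q.comp y B C E F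
    = evalAt y (((n : SmoothFn Q.dom) - 4) * weyl4 Q.alg Q.pJ B C E F) := by
  have h3 : (3 : ℝ) ≤ n := by exact_mod_cast hn
  have h2 : (n : ℝ) - 2 ≠ 0 := by linarith
  have key := congrArg (evalAt y) (wDiv_apply (hQ.isEinsteinWith hn) hn B C E F)
  have hT : ∀ L, skewXOm Q.alg Q.pJ 5 (Fin.cons (.inl ()) L) = 0 := fun L =>
    congrFun (congrFun (ann_Y_skewXOm (𝒢 := Q.alg) (p := Q.pJ)) 4) L
  simp only [tractorW, (repT_skewXΩ hQ hn).tractorD hQ hn _ hy, hUpper_eq hy, covT_algebraMap_smul,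
    lapF_algebraMap_smul]
  rw [map_mul, map_sub, map_natCast, map_ofNat]
  simp only [map_mul, map_sub, map_natCast, map_ofNat, wDiv, Pi.sub_apply, Pi.add_apply,
    Pi.smul_apply, Finset.sum_apply, ann_apply, smul_eq_mul, map_add, map_neg, map_sum] at key
  have key' : -((n : ℝ) - 4) * evalAt y (skewXOm Q.alg Q.pJ 5 ![.inr (.inr ()), B, C, E, F])
      + ((n : ℝ) - 4) * ∑ b, ∑ c, evalAt y (Q.alg.gi b c)
        * evalAt y (covT Q.alg Q.pJ b (skewXOm Q.alg Q.pJ) 5 ![.inr (.inl c), B, C, E, F])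
      - evalAt y (lapF Q.alg Q.pJ (skewXOm Q.alg Q.pJ) 5 ![.inl (), B, C, E, F])
      = ((n : ℝ) - 2) * ((n : ℝ) - 4) * evalAt y (weyl4 Q.alg Q.pJ B C E F) := key
  have hT' : skewXOm Q.alg Q.pJ 5 ![.inl (), B, C, E, F] = 0 := hT _
  have hs : ∀ (r : ℝ) (x x' : Fin n → Fin n → ℝ),
      ∑ b, ∑ c, x b c * (r * (3⁻¹ * x' b c)) = r / 3 * ∑ b, ∑ c, x b c * x' b c := fun r x x' => by
    simp only [Finset.mul_sum]
    exact Finset.sum_congr rfl fun b _ => Finset.sum_congr rfl fun c _ => by ring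
  simp only [Fintype.sum_sum_type, Finset.univ_unique, Finset.sum_singleton, hInv, map_zero,
    zero_mul, Finset.sum_const_zero, add_zero, zero_add, map_one, one_mul]
  simp [projX, projY, projZ, hT', hs]
  field_simp
  linear_combination key'

end PatchMetric
end
end EinsteinTractor

namespace EinsteinTractor

noncomputable section

/-! ## The operator `I^A 𝔻_A` in a patch -/

namespace PatchMetric

open Fock

variable {n : ℕ} {Q : PatchMetric n} {y : Space n} {t : ℕ}
variable (hQ : Q.IsEinstein) (hn : 3 ≤ n)
include hQ hn

lemma sharpSharpW_eq {V : Tractor n t} {x : altModule (TIdx n) (SmoothFn Q.dom)}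
    (h : RepT V x.1) (hy : y ∈ Q.dom) (a : Fin 0 → Fin n) (A : Fin t → TIdx n) :
    sharpSharpW Q.comp V y a A
      = ((n : ℝ) - 4) * evalAt y (((tcalc Q.alg).weyl Q.pJ • x).1 t A) := by
  have hs : ∀ (C A' : TIdx n) (L : Fin t → TIdx n),
      sharp Q.comp y (fun E F => tractorW Q.comp y C A' E F) (V y a) L
        = evalAt y (sharpF Q.alg (fun E F => ((n : SmoothFn Q.dom) - 4)
          * weyl4 Q.alg Q.pJ C A' E F) x.1 t L) := fun C A' L => by
    simp only [sharp, sharpF, act_apply, tractorW_eq hQ hn hy, hUpper_eq hy, h y hy]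
    simp only [map_sum, map_mul, map_neg, neg_mul, Finset.sum_neg_distrib]
  have h1 : sharpSharpW Q.comp V y a A = evalAt y (sharpSharpF Q.alg
      (fun B C E F => ((n : SmoothFn Q.dom) - 4) * weyl4 Q.alg Q.pJ B C E F) x.1 t A) := by
    simp only [sharpSharpW, sharpSharpF, hs, hUpper_eq hy]
    simp only [map_sum, map_mul, map_neg]
  rw [h1, sharpSharpF_mul, sharpSharpF_weyl4]
  simp only [Pi.smul_apply, smul_eq_mul, map_mul, map_sub, map_natCast, map_ofNat]

/-- In its own scale `σ` is the constant `1`, so the derivative terms drop out and `D_A σ = n Y_A -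
J X_A`. -/
lemma scaleTractor_eq (hy : y ∈ Q.dom) (a : Fin 0 → Fin n) (B : TIdx n) :
    scaleTractor Q.comp y a ![B] = projY B - evalAt y Q.pJ * projX B := by
  have h0 : (n : ℝ) ≠ 0 := by positivity
  have hW : RepT (Q := Q) scaleDensity (Pi.single 0 fun _ => 1) := fun y _ a A => by
    simp [scaleDensity]
  have hc : ∀ b (W : Fock (TIdx n) (SmoothFn Q.dom)) L,
      covT Q.alg Q.pJ b W 0 L = Q.alg.der b (W 0 L) := fun b W L => by
    simp [covT]
  have hl : ∀ L, lapF Q.alg Q.pJ (Pi.single 0 fun _ => 1) 0 L = 0 := fun L => by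
    simp [lapF, hc]
  rw [scaleTractor, hW.tractorD hQ hn _ hy]
  simp only [hc, Matrix.cons_val_zero, Pi.single_eq_same, map_one, Derivation.map_one_eq_zero,
    map_zero, mul_zero, Finset.sum_const_zero, add_zero]
  have hl' := hl (Fin.tail ![B])
  rw [hl', map_zero]
  field_simp
  ring

/-- Contraction with `I` pairs the `Y`-component of `I` with the `X`-component of `𝔻` and
conversely, giving `-Δ - wJ - pw(n+2w-2) = -Δ - 2pw(n+w-1)`. For `n ≠ 4` the factor `n - 4` of `W♯♯`
cancels its coefficient. For `n = 4` there is one index, and `weyl` vanishes on it. -/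
lemma RepT.modBox {V : Tractor n t} {x : altModule (TIdx n) (SmoothFn Q.dom)}
    (h : RepT V x.1) (hnt : n ≠ 4 ∨ t = 1) (w : ℝ) :
    RepT (modBox Q.comp w V)
      ((tcalc Q.alg).box Q.pJ (algebraMap ℝ (SmoothFn Q.dom) w) • x).1 := by
  intro y hy a A
  have hb : ((tcalc Q.alg).box Q.pJ (algebraMap ℝ (SmoothFn Q.dom) w) • x).1
      = -lapF Q.alg Q.pJ x.1 - (2 * Q.pJ * (algebraMap ℝ (SmoothFn Q.dom) w
        * ((n : SmoothFn Q.dom) + algebraMap ℝ (SmoothFn Q.dom) w - 1))) • x.1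
        - ((tcalc Q.alg).weyl Q.pJ • x).1 := by
    rw [OpCalc.box, sub_smul, sub_smul, neg_smul, smul_assoc, one_smul]
    simp only [Submodule.coe_sub, Submodule.coe_neg, Submodule.coe_smul, coe_lapT]
  have hX : EinsteinTractor.modD Q.comp w V y a (Fin.cons (.inr (.inr ())) A)
      = -(evalAt y (lapF Q.alg Q.pJ x.1 t A)
          + w * (n * evalAt y Q.pJ) * evalAt y (x.1 t A))
        - evalAt y (((tcalc Q.alg).weyl Q.pJ • x).1 t A) := by
    rw [modD]
    split_ifs with h4
    · obtain rfl : t = 1 := hnt.resolve_left (not_not.mpr h4)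
      rw [h.tractorD hQ hn _ hy, weyl_one _ x (hQ.isEinsteinWith hn)]
      simp [projX, projY, projZ]
    · have h4' : (n : ℝ) - 4 ≠ 0 := sub_ne_zero.mpr (by exact_mod_cast h4)
      simp only [h.tractorD hQ hn _ hy, Fin.cons_zero, Fin.tail_cons, sharpSharpW_eq hQ hn h hy]
      simp only [projX, projY, projZ]
      field_simp
      simp
  have hY : EinsteinTractor.modD Q.comp w V y a (Fin.cons (.inl ()) A)
      = ((n : ℝ) + 2 * w - 2) * w * evalAt y (x.1 t A) := by
    rw [modD]
    split_ifs with h4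
    · rw [h.tractorD hQ hn _ hy]
      simp [projX, projY, projZ]
    · simp only [h.tractorD hQ hn _ hy, Fin.cons_zero, Fin.tail_cons]
      simp [projX, projY, projZ]
  rw [hb, EinsteinTractor.modBox]
  simp only [scaleTractor_eq hQ hn hy, Fintype.sum_sum_type, Finset.univ_unique,
    Finset.sum_singleton, hUpper, projX, projY, PUnit.default_eq_unit, hX, hY]
  simp only [Pi.sub_apply, Pi.neg_apply, Pi.smul_apply, smul_eq_mul, map_sub, map_neg, map_mul,
    map_add, map_natCast, map_one, map_ofNat, AlgHom.commutes, Algebra.algebraMap_self,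
    RingHom.id_apply]
  simp
  ring

lemma RepT.modBoxPow {V : Tractor n t} {x : altModule (TIdx n) (SmoothFn Q.dom)}
    (h : RepT V x.1) (hnt : n ≠ 4 ∨ t = 1) (w : ℝ) (q : ℕ) :
    RepT (modBoxPow Q.comp w q V)
      ((tcalc Q.alg).boxPow Q.pJ (algebraMap ℝ (SmoothFn Q.dom) w) q x).1 := by
  induction q with
  | zero => exact h
  | succ q ih =>
    have := ih.modBox hQ hn hnt (w - q)
    rw [map_sub, map_natCast] at this
    exact this

end PatchMetric
end
end EinsteinTractor

namespace EinsteinTractor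

noncomputable section

/-! ## Forms in the operator calculus -/

namespace Fock

set_option linter.unusedSectionVars false

variable {n : ℕ} {R : Type*} [CommRing R] [Algebra ℝ R]

/-- The tractor index of a coordinate index. -/
def zi {k : ℕ} (a : Fin k → Fin n) : Fin k → TIdx n := fun i => .inr (.inl (a i))

lemma zi_apply {k : ℕ} (a : Fin k → Fin n) (i : Fin k) : zi a i = .inr (.inl (a i)) := rfl

lemma zi_cons {k : ℕ} (c : Fin n) (a : Fin k → Fin n) :
    (Fin.cons (.inr (.inl c)) (zi a) : Fin (k + 1) → TIdx n) = zi (Fin.cons c a) := by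
  funext i
  refine Fin.cases rfl (fun _ => rfl) i

lemma zi_update {k : ℕ} (a : Fin k → Fin n) (i : Fin k) (c : Fin n) :
    Function.update (zi a) i (.inr (.inl c)) = zi (Function.update a i c) := by
  funext j
  rcases eq_or_ne j i with rfl | h
  · simp [zi]
  · simp [zi, h]

/-- Components of a form with an index along `X` or `Y` vanish, so this dichotomy reduces
comparisons to coordinate indices. -/
lemma exists_zi_or {k : ℕ} (L : Fin k → TIdx n) :
    (∃ a, L = zi a) ∨ ∃ i, L i = .inl () ∨ L i = .inr (.inr ()) := by
  by_cases h : ∃ i, L i = .inl () ∨ L i = .inr (.inr ())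
  · exact Or.inr h
  · push Not at h
    have h2 : ∀ i, ∃ a, L i = .inr (.inl a) := fun i => by
      rcases hi : L i with ⟨⟩ | a | ⟨⟩
      · exact absurd hi (h i).1
      · exact ⟨a, rfl⟩
      · exact absurd hi (h i).2
    choose a ha using h2
    exact Or.inl ⟨a, funext ha⟩

lemma IsAlt.apply_eq_zero {ι : Type*} {V : Fock ι R} (hV : V.IsAlt) {A : ι} (hA : Fock.ann A V = 0)
    {t : ℕ} (L : Fin t → ι) (i : Fin t) (hi : L i = A) : V t L = 0 := by
  cases t with
  | zero => exact i.elim0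
  | succ t =>
    have h0 : ∀ L : Fin (t + 1) → ι, L 0 = A → V (t + 1) L = 0 := fun L hL => by
      have := congrFun (congrFun hA t) (Fin.tail L)
      rw [ann_apply, ← hL, Fin.cons_self_tail] at this
      exact this
    rcases eq_or_ne i 0 with rfl | h
    · exact h0 L hi
    · have := hV (t + 1) L 0 i h.symm
      rw [h0 _ (by simp [hi])] at this
      exact neg_eq_zero.mp this.symm

/-- The alternating tractor with components `f` in the directions of the coordinates. -/
def zext (k : ℕ) (f : (Fin k → Fin n) → R) : Fock (TIdx n) R :=
  Pi.single k fun L => ∑ a : Fin k → Fin n, (∏ i, if L i = .inr (.inl (a i)) then (1 : R) else 0) * f a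

lemma zext_zi {k : ℕ} (f : (Fin k → Fin n) → R) (a : Fin k → Fin n) : zext k f k (zi a) = f a := by
  rw [zext, Pi.single_eq_same, Finset.sum_eq_single a]
  · simp [zi]
  · intro b _ hb
    obtain ⟨i, hi⟩ := Function.ne_iff.mp hb
    rw [Finset.prod_eq_zero (Finset.mem_univ i), zero_mul]
    simp [zi, hi.symm]
  · simp

lemma isAlt_zext {k : ℕ} {f : (Fin k → Fin n) → R}
    (hf : ∀ a i j, i ≠ j → f (a ∘ Equiv.swap i j) = -f a) : (zext k f).IsAlt := by
  intro t L i j hij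
  rcases eq_or_ne t k with rfl | h
  · rw [zext, Pi.single_eq_same, ← Finset.sum_neg_distrib,
      ← Equiv.sum_comp (Equiv.arrowCongr (Equiv.swap i j) (Equiv.refl (Fin n)))]
    refine Finset.sum_congr rfl fun a _ => ?_
    have h1 : (Equiv.arrowCongr (Equiv.swap i j) (Equiv.refl (Fin n))) a = a ∘ Equiv.swap i j := by
      funext l; simp
    rw [h1, hf a i j hij, mul_neg, ← Equiv.prod_comp (Equiv.swap i j)]
    simp
  · rw [zext, Pi.single_eq_of_ne h]; simp

lemma ann_zext {k : ℕ} (f : (Fin (k + 1) → Fin n) → R) {A : TIdx n}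
    (hA : ∀ a, A ≠ .inr (.inl a)) : ann A (zext (k + 1) f) = 0 := by
  rw [zext, ann_single, Pi.single_eq_zero_iff]
  funext L
  refine Finset.sum_eq_zero fun a _ => ?_
  rw [Finset.prod_eq_zero (Finset.mem_univ 0), zero_mul]
  simp [hA]

/-- Skew-symmetrising `η ⊗ V` gives the normalised exterior product. -/
lemma IsAlt.sum_sign_mul {ι : Type*} {V : Fock ι R} (hV : V.IsAlt) (η : ι → R) {k : ℕ}
    (A : Fin (k + 1) → ι) :
    ((k : R) + 1) * ∑ π : Equiv.Perm (Fin (k + 1)), ((Equiv.Perm.sign π : ℤ) : R)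
        * (η (A (π 0)) * V k (Fin.tail (A ∘ π)))
      = ((k + 1).factorial : R) * Fock.cre η V (k + 1) A := by
  have h1 : ∀ π : Equiv.Perm (Fin (k + 1)), ((Equiv.Perm.sign π : ℤ) : R)
      * Fock.cre η V (k + 1) (A ∘ π) = Fock.cre η V (k + 1) A := fun π => by
    rw [apply_perm_of_swap (fun L i j h => hV.cre η (k + 1) L i j h), ← mul_assoc, ← Int.cast_mul,
      ← Units.val_mul, Int.units_mul_self]
    simp
  -- Composing the permutation with the cycle that moves slot `i` to the front has sign `(-1)^i`, so
  -- every term of the alternating sum contributes equally.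
  have h2 : ∀ i : Fin (k + 1), ∑ π : Equiv.Perm (Fin (k + 1)), ((Equiv.Perm.sign π : ℤ) : R)
      * ((-1) ^ (i : ℕ) * (η (A (π i)) * V k ((A ∘ π) ∘ i.succAbove)))
      = ∑ π : Equiv.Perm (Fin (k + 1)), ((Equiv.Perm.sign π : ℤ) : R)
        * (η (A (π 0)) * V k (Fin.tail (A ∘ π))) := fun i => by
    conv_rhs => rw [← Equiv.sum_comp (Equiv.mulRight (i.cycleRange⁻¹))]
    refine Finset.sum_congr rfl fun π _ => ?_
    have h3 : Fin.tail (A ∘ ⇑(π * i.cycleRange⁻¹)) = (A ∘ π) ∘ i.succAbove := by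
      funext j
      simp [Fin.tail, Equiv.Perm.inv_def, Fin.cycleRange_symm_succ]
    have h4 : (π * i.cycleRange⁻¹) 0 = π i := by
      simp [Equiv.Perm.inv_def, Fin.cycleRange_symm_zero]
    simp only [Equiv.coe_mulRight]
    rw [h3, h4, Equiv.Perm.sign_mul, Equiv.Perm.sign_inv, Fin.sign_cycleRange]
    push_cast
    ring
  have h3 : ∑ π : Equiv.Perm (Fin (k + 1)), ((Equiv.Perm.sign π : ℤ) : R)
      * Fock.cre η V (k + 1) (A ∘ π) = ((k + 1).factorial : R) * Fock.cre η V (k + 1) A := by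
    simp only [h1, Finset.sum_const, Finset.card_univ, Fintype.card_perm, Fintype.card_fin,
      nsmul_eq_mul]
  rw [← h3]
  simp only [cre_apply, Finset.mul_sum (s := (Finset.univ : Finset (Fin (k + 1)))), Function.comp_apply]
  rw [Finset.sum_comm]
  simp only [Function.comp_def] at h2 ⊢
  simp only [h2, Finset.sum_const, Finset.card_univ, Fintype.card_fin, nsmul_eq_mul]
  push_cast
  ring

variable {𝒢 : AlgMetric n R}

lemma isForm_zext {m : ℕ} {f : (Fin (m + 1) → Fin n) → R}
    (hf : ∀ a i j, i ≠ j → f (a ∘ Equiv.swap i j) = -f a) :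
    (tcalc 𝒢).IsForm ((m + 1 : ℕ) : R) (⟨zext (m + 1) f, isAlt_zext hf⟩ : altModule (TIdx n) R) where
  bY := Subtype.ext (ann_zext f (by simp))
  bX := Subtype.ext (ann_zext f (by simp))
  num := by
    have h : (tcalc 𝒢).num = (tcalc 𝒢).op fun a b => if a = b then 1 else 0 := by
      simp [OpCalc.num, OpCalc.op]
    refine Subtype.ext ?_
    rw [h, coe_op]
    have hV := isAlt_zext hf
    have h0 : ∀ (t : ℕ) (L : Fin t → TIdx n) i, (L i = .inl () ∨ L i = .inr (.inr ())) →
        zext (m + 1) f t L = 0 := fun t L i hi => by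
      rcases hi with hi | hi
      · exact hV.apply_eq_zero (ann_zext f (by simp)) L i hi
      · exact hV.apply_eq_zero (ann_zext f (by simp)) L i hi
    funext t L
    rw [act_apply]
    simp only [Submodule.coe_smul, Pi.smul_apply, smul_eq_mul]
    rcases eq_or_ne t (m + 1) with rfl | ht
    · have key : ∀ j, ∑ B, zblock (fun a b => if a = b then (1 : R) else 0) (L j) B
          * zext (m + 1) f (m + 1) (Function.update L j B) = zext (m + 1) f (m + 1) L := fun j => by
        rcases hj : L j with ⟨⟩ | a | ⟨⟩
        · simp [zblock, h0 _ L j (Or.inl hj)]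
        · have hu : Function.update L j (.inr (.inl a)) = L := by rw [← hj, Function.update_eq_self]
          simp [zblock, hu]
        · simp [zblock, h0 _ L j (Or.inr hj)]
      simp only [key, Finset.sum_const, Finset.card_univ, Fintype.card_fin, nsmul_eq_mul]
    · simp [zext, Pi.single_eq_of_ne ht]

end Fock
end
end EinsteinTractor

namespace EinsteinTractor

noncomputable section

/-! ## Forms in a patch -/

namespace Fock

lemma coe_cod {n : ℕ} {R : Type*} [CommRing R] [Algebra ℝ R] (𝒢 : AlgMetric n R)
    (V : altModule (TIdx n) R) : ((tcalc 𝒢).cod • V).1 = -∑ a, ∑ b, 𝒢.gi a b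
      • ann (.inr (.inl b)) (derF (𝒢.der a) V.1 + act (zblock fun b c => -𝒢.chr c a b) V.1) := by
  simp only [← coe_nab, ← coe_b, OpCalc.cod, neg_smul, Finset.sum_smul, Submodule.coe_neg,
    Submodule.coe_sum, mul_smul, OpCalc.bu, smul_assoc, Submodule.coe_smul, OpCalc.bZ]
  rfl

end Fock

namespace PatchMetric

open Fock

variable {n : ℕ} {Q : PatchMetric n} {y : Space n} {k : ℕ}

/-- The components of the form `f` in the patch are those of `φ`. -/
def RepF (f : LForm n k) (φ : altModule (TIdx n) (SmoothFn Q.dom)) : Prop :=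
  Rep f fun a _ => φ.1 k (zi a)

lemma RepF.add {f f' : LForm n k} {φ φ' : altModule (TIdx n) (SmoothFn Q.dom)}
    (h : RepF f φ) (h' : RepF f' φ') : RepF (f + f') (φ + φ') := fun y hy a A => by
  simp only [Pi.add_apply, h y hy, h' y hy, Submodule.coe_add, map_add]

lemma RepF.smul {f : LForm n k} {φ : altModule (TIdx n) (SmoothFn Q.dom)}
    (h : RepF f φ) {r : ℝ} {x : SmoothFn Q.dom} (hr : ∀ y ∈ Q.dom, r = evalAt y x) :
    RepF (r • f) (x • φ) := fun y hy a A => by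
  simp only [Pi.smul_apply, h y hy, Submodule.coe_smul, smul_eq_mul, map_mul, hr y hy]

lemma RepF.fmul {f : LForm n k} {φ : altModule (TIdx n) (SmoothFn Q.dom)}
    (h : RepF f φ) {r : Space n → ℝ} {x : SmoothFn Q.dom} (hr : ∀ y ∈ Q.dom, r y = evalAt y x) :
    RepF (fmul r f) (x • φ) := fun y hy a A => by
  simp only [EinsteinTractor.fmul, Pi.smul_apply, h y hy, Submodule.coe_smul, smul_eq_mul, map_mul,
    hr y hy]

lemma RepF.extD {f : LForm n k} {φ : altModule (TIdx n) (SmoothFn Q.dom)}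
    (h : RepF f φ) : RepF (extD f) ((tcalc Q.alg).ext • φ) := fun y hy a A => by
  have hs : ∀ i : Fin (k + 1), ∑ c, (-1) ^ (i : ℕ) * ((Pi.single (.inr (.inl c)) 1 : TIdx n → _)
      (zi a i) * Q.alg.der c (φ.1 k (zi a ∘ i.succAbove)))
      = (-1) ^ (i : ℕ) * Q.alg.der (a i) (φ.1 k (zi a ∘ i.succAbove)) := fun i => by
    rw [← Finset.mul_sum]
    congr 1
    rw [Finset.sum_eq_single (a i)]
    · simp [zi]
    · intro c _ hc
      simp [zi, hc.symm]
    · simp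
  rw [OpCalc.ext_eq]
  simp only [EinsteinTractor.extD, Finset.sum_smul, mul_smul, Submodule.coe_sum, OpCalc.cZ, coe_c,
    coe_D, Finset.sum_apply, cre_apply, derF_apply]
  rw [Finset.sum_comm]
  simp only [hs, map_sum, map_mul, map_pow, map_neg, map_one]
  refine Finset.sum_congr rfl fun i _ => ?_
  rw [pd_eq (Q := Q) (fun z hz => h z hz (a ∘ i.succAbove) A) hy]
  rfl

variable (hQ : Q.IsEinstein) (hn : 3 ≤ n)
include hQ hn

lemma RepF.coD {f : LForm n (k + 1)} {φ : altModule (TIdx n) (SmoothFn Q.dom)}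
    (h : RepF f φ) : RepF (coD Q.comp f) ((tcalc Q.alg).cod • φ) := fun y hy a A => by
  have hc := Rep.covD hQ hn h y hy
  rw [coe_cod]
  simp only [EinsteinTractor.coD, hc, covR, Fin.cons_zero, Fin.tail_cons, Finset.univ_eq_empty,
    Finset.sum_empty, add_zero, Pi.neg_apply, Finset.sum_apply, Pi.smul_apply, ann_apply,
    Pi.add_apply, derF_apply, act_apply, zi_cons, smul_eq_mul, map_neg, map_sum, map_mul,
    evalAt_gi hy]
  congr 1
  refine Finset.sum_congr rfl fun b _ => Finset.sum_congr rfl fun c _ => ?_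
  congr 2
  rw [sub_eq_add_neg, ← Finset.sum_neg_distrib]
  congr 1
  refine Finset.sum_congr rfl fun i _ => ?_
  simp [zblock, zi_update, zi_apply]

lemma RepF.opP_dδ {f : LForm n (k + 1)} {φ : altModule (TIdx n) (SmoothFn Q.dom)}
    (h : RepF f φ) (κ q : ℕ) : RepF (opP Q.comp κ (dδ Q.comp) q f)
      (OpCalc.prodVec n Q.pJ (κ : SmoothFn Q.dom)
        (fun φ => (tcalc Q.alg).ext • (tcalc Q.alg).cod • φ) q φ) := by
  have h0 : (n : ℝ) ≠ 0 := by positivity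
  induction q with
  | zero => exact h
  | succ q ih =>
    refine (ih.coD hQ hn).extD.add (ih.fmul fun y hy => ?_)
    simp only [schoutenTrace_eq hn hy, map_mul, map_add, map_sub, map_natCast, map_one, map_ofNat]
    field_simp

lemma RepF.opP_δd {f : LForm n k} {φ : altModule (TIdx n) (SmoothFn Q.dom)}
    (h : RepF f φ) (κ q : ℕ) : RepF (opP Q.comp κ (δd Q.comp) q f)
      (OpCalc.prodVec n Q.pJ (κ : SmoothFn Q.dom)
        (fun φ => (tcalc Q.alg).cod • (tcalc Q.alg).ext • φ) q φ) := by
  have h0 : (n : ℝ) ≠ 0 := by positivity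
  induction q with
  | zero => exact h
  | succ q ih =>
    refine (ih.extD.coD hQ hn).add (ih.fmul fun y hy => ?_)
    simp only [schoutenTrace_eq hn hy, map_mul, map_add, map_sub, map_natCast, map_one, map_ofNat]
    field_simp

omit hQ hn

/-! ### The injections of forms into tractors -/

lemma prod_projZ (a b : Fin k → Fin n) : ∏ i, projZ (a i) (zi b i) = if a = b then 1 else 0 := by
  split_ifs with h
  · simp [h, projZ, zi]
  · obtain ⟨i, hi⟩ := Function.ne_iff.mp h
    exact Finset.prod_eq_zero (Finset.mem_univ i) (by simp [projZ, zi, Ne.symm hi])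

lemma RepF.injZ {κ : SmoothFn Q.dom} {f : LForm n k} {φ : altModule (TIdx n) (SmoothFn Q.dom)}
    (h : RepF f φ) (hφ : (tcalc Q.alg).IsForm κ φ) : RepT (injZ f) φ.1 := fun y hy a A => by
  rcases exists_zi_or A with ⟨b, rfl⟩ | ⟨i, hi⟩
  · simp [EinsteinTractor.injZ, prod_projZ, h y hy]
  · have h1 : φ.1 k A = 0 := by
      rcases hi with hi | hi
      · exact φ.2.apply_eq_zero (congrArg Subtype.val hφ.bY) A i hi
      · exact φ.2.apply_eq_zero (congrArg Subtype.val hφ.bX) A i hi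
    change _ = evalAt y (φ.1 k A)
    rw [h1, map_zero]
    refine Finset.sum_eq_zero fun b _ => ?_
    rw [Finset.prod_eq_zero (Finset.mem_univ i), zero_mul]
    rcases hi with hi | hi <;> simp [hi, projZ]

/-- The normalised skew-symmetrisation over `k + 1` slots is the unnormalised wedge product divided
by `k + 1`; this is the source of the factors `1/k` in the theorem. -/
lemma skew_eq {ψ : altModule (TIdx n) (SmoothFn Q.dom)} {V : Tractor n k} (h : RepT V ψ.1)
    {η : TIdx n → ℝ} {A₀ : TIdx n} (hη : ∀ A, η A = if A = A₀ then 1 else 0) (hy : y ∈ Q.dom)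
    (a : Fin 0 → Fin n) (A : Fin (k + 1) → TIdx n) :
    skew (fun y a A => η (A 0) * V y a (Fin.tail A)) y a A
      = 1 / ((k : ℝ) + 1) * evalAt y (((tcalc Q.alg).c A₀ • ψ).1 (k + 1) A) := by
  have h1 := congrArg (evalAt y) (ψ.2.sum_sign_mul (Pi.single A₀ 1) A)
  have h2 : ∀ A, evalAt y ((Pi.single A₀ 1 : TIdx n → SmoothFn Q.dom) A) = η A := fun A => by
    rw [hη, Pi.single_apply]; split_ifs <;> simp
  simp only [map_mul, map_sum, map_add, map_natCast, map_one, map_intCast, h2] at h1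
  have hk : (k : ℝ) + 1 ≠ 0 := by positivity
  have hf : ((k + 1).factorial : ℝ) ≠ 0 := by positivity
  have h3 : skew (fun y a A => η (A 0) * V y a (Fin.tail A)) y a A
      = 1 / ((k + 1).factorial : ℝ) * ∑ π : Equiv.Perm (Fin (k + 1)),
        ((Equiv.Perm.sign π : ℤ) : ℝ) * (η (A (π 0)) * evalAt y (ψ.1 k (Fin.tail (A ∘ π)))) := by
    simp only [skew, h y hy]
    rfl
  rw [coe_c, h3, div_mul_eq_mul_div, div_mul_eq_mul_div, div_eq_div_iff hf hk, one_mul, one_mul]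
  linear_combination h1

lemma RepF.injY {κ : SmoothFn Q.dom} {f : LForm n k} {φ : altModule (TIdx n) (SmoothFn Q.dom)}
    (h : RepF f φ) (hφ : (tcalc Q.alg).IsForm κ φ) (hy : y ∈ Q.dom) (a : Fin 0 → Fin n)
    (A : Fin (k + 1) → TIdx n) : injY f y a A
      = 1 / ((k : ℝ) + 1) * evalAt y (((tcalc Q.alg).cY • φ).1 (k + 1) A) :=
  skew_eq (h.injZ hφ) (fun A => by rcases A with _ | _ | _ <;> simp [projY]) hy a A

lemma RepF.injX {κ : SmoothFn Q.dom} {f : LForm n k} {φ : altModule (TIdx n) (SmoothFn Q.dom)}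
    (h : RepF f φ) (hφ : (tcalc Q.alg).IsForm κ φ) (hy : y ∈ Q.dom) (a : Fin 0 → Fin n)
    (A : Fin (k + 1) → TIdx n) : injX f y a A
      = 1 / ((k : ℝ) + 1) * evalAt y (((tcalc Q.alg).cX • φ).1 (k + 1) A) :=
  skew_eq (h.injZ hφ) (fun A => by rcases A with _ | _ | _ <;> simp [projX]) hy a A

end PatchMetric
end
end EinsteinTractor

namespace EinsteinTractor

noncomputable section

/-! ## The iterated operator on forms -/

/-- Real constants commute with the differential operator, whereas elements of `R` need not; this is
used for the overall factor `1/k` of `M f`. -/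
lemma Fock.boxPow_real_smul {n : ℕ} {R : Type*} [CommRing R] [Algebra ℝ R] (𝒢 : AlgMetric n R)
    (p w : R) (r : ℝ) (q : ℕ) (x : Fock.altModule (TIdx n) R) :
    (Fock.tcalc 𝒢).boxPow p w q (r • x) = r • (Fock.tcalc 𝒢).boxPow p w q x := by
  induction q with
  | zero => rfl
  | succ q ih =>
    rw [OpCalc.boxPow, ih, OpCalc.boxPow]
    exact LinearMap.map_smul _ r _

lemma OpCalc.IsForm.prodVec {n : ℕ} {R : Type*} [CommRing R] [Algebra ℝ R] {𝒢 : AlgMetric n R}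
    {E : Type*} [Ring E] [Module R E] [IsScalarTower R E E] {F : OpCalc 𝒢 E} {A : Type*}
    [AddCommGroup A] [Module E A] [Module R A] [IsScalarTower R E A] {κ κ' p : R} {φ : A}
    (h : F.IsForm κ φ) {T : A → A} (hT : ∀ {ψ}, F.IsForm κ ψ → F.IsForm κ (T ψ)) (q : ℕ) :
    F.IsForm κ (OpCalc.prodVec n p κ' T q φ) := by
  induction q with
  | zero => exact h
  | succ q ih => exact (hT ih).add (ih.smul _)

namespace PatchMetric

open Fock

variable {n : ℕ} {Q : PatchMetric n} {m : ℕ}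

lemma RepF.splitM (hQ : Q.IsEinstein) (hn : 3 ≤ n) {f : LForm n (m + 1)}
    {φ : altModule (TIdx n) (SmoothFn Q.dom)} (h : RepF f φ)
    (hφ : (tcalc Q.alg).IsForm ((m + 1 : ℕ) : SmoothFn Q.dom) φ) :
    RepT (splitM Q.comp f) ((1 / ((m : ℝ) + 1)) •
      (((n : SmoothFn Q.dom) - 2 * ((m + 1 : ℕ) : SmoothFn Q.dom)) • φ
        + (tcalc Q.alg).cX • (tcalc Q.alg).cod • φ)).1 := fun y hy a A => by
  have hm : (m : ℝ) + 1 ≠ 0 := by positivity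
  simp only [EinsteinTractor.splitM, Pi.add_apply, Pi.smul_apply, h.injZ hφ y hy,
    (h.coD hQ hn).injX (hφ.cod fun a => Derivation.map_natCast _ _) hy,
    Submodule.coe_smul_of_tower, Submodule.coe_add, map_smul, map_add, map_mul, map_sub,
    map_natCast, map_ofNat, smul_eq_mul]
  push_cast
  field_simp

/-- Evaluates `boxPow_split` at the points of the patch. Each form, operator and coefficient in the
formula is matched with its algebraic representative. -/
theorem opL_eq (hQ : Q.IsEinstein) (hn : 3 ≤ n) {f : LForm n (m + 1)}
    {φ : altModule (TIdx n) (SmoothFn Q.dom)} (h : RepF f φ)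
    (hφ : (tcalc Q.alg).IsForm ((m + 1 : ℕ) : SmoothFn Q.dom) φ) (hnt : n ≠ 4 ∨ m + 1 = 1) (q : ℕ)
    {u v : LForm n (m + 1)} (hu : u = opP Q.comp (m + 1) (dδ Q.comp) q f)
    (hv : v = opP Q.comp (m + 1 + 1) (δd Q.comp) q f) (y : Space n) (hy : y ∈ Q.dom) :
    opL Q.comp (q + 1) f y
        = (-(((q : ℝ) + 1) * ((n : ℝ) - 2 * (m + 1) - 2 * (q + 1))) • injY (coD Q.comp u)
            + (1 / ((m : ℝ) + 1)) • injZ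
                (((n : ℝ) - 2 * (m + 1) - 2 * (q + 1)) • dδ Q.comp u
                  + ((n : ℝ) - 2 * (m + 1)) • δd Q.comp v)
            + injX (coD Q.comp
                (dδ Q.comp u
                  + fmul (fun z => ((q : ℝ) + 1) * ((n : ℝ) - 2 * (m + 1) + 2) / n
                      * schoutenTrace Q.comp z) u))) y := by
  have hE := hQ.isEinsteinWith hn
  have hp := hE.der_eq_zero hn
  have h0 : (n : ℝ) ≠ 0 := by positivity
  have hm : (m : ℝ) + 1 ≠ 0 := by positivity
  have hu' := h.opP_dδ hQ hn (m + 1) q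
  have hv' := h.opP_δd hQ hn (m + 1 + 1) q
  rw [← hu] at hu'
  rw [← hv] at hv'
  set φu := OpCalc.prodVec n Q.pJ ((m + 1 : ℕ) : SmoothFn Q.dom)
    (fun φ => (tcalc Q.alg).ext • (tcalc Q.alg).cod • φ) q φ with hφu
  rw [Nat.cast_succ (m + 1)] at hv'
  set φv := OpCalc.prodVec n Q.pJ (((m + 1 : ℕ) : SmoothFn Q.dom) + 1)
    (fun φ => (tcalc Q.alg).cod • (tcalc Q.alg).ext • φ) q φ with hφv
  have split := OpCalc.boxPow_split (tcalc Q.alg) hE hp (m + 1) hφ q φu φv hφu hφv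
  have hκ : ∀ a, Q.alg.der a ((m + 1 : ℕ) : SmoothFn Q.dom) = 0 := fun a =>
    Derivation.map_natCast _ _
  have hκ1 : ∀ a, Q.alg.der a (((m + 1 : ℕ) : SmoothFn Q.dom) - 1) = 0 := fun a => by
    rw [map_sub, hκ, Derivation.map_one_eq_zero, sub_zero]
  have hκ2 : ∀ a, Q.alg.der a (((m + 1 : ℕ) : SmoothFn Q.dom) + 1) = 0 := fun a => by
    rw [map_add, hκ, Derivation.map_one_eq_zero, add_zero]
  have fT : ∀ {ψ : altModule (TIdx n) (SmoothFn Q.dom)}, (tcalc Q.alg).IsForm ((m + 1 : ℕ) : SmoothFn Q.dom) ψ →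
      (tcalc Q.alg).IsForm ((m + 1 : ℕ) : SmoothFn Q.dom)
        ((tcalc Q.alg).ext • (tcalc Q.alg).cod • ψ) := fun hψ => by
    have := (hψ.cod hκ).ext hκ1
    rwa [sub_add_cancel] at this
  have fT' : ∀ {ψ : altModule (TIdx n) (SmoothFn Q.dom)}, (tcalc Q.alg).IsForm ((m + 1 : ℕ) : SmoothFn Q.dom) ψ →
      (tcalc Q.alg).IsForm ((m + 1 : ℕ) : SmoothFn Q.dom)
        ((tcalc Q.alg).cod • (tcalc Q.alg).ext • ψ) := fun hψ => by
    have := (hψ.ext hκ).cod hκ2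
    rwa [add_sub_cancel_right] at this
  have fu := hφ.prodVec (n := n) (p := Q.pJ) (κ' := ((m + 1 : ℕ) : SmoothFn Q.dom)) fT q
  have fv := hφ.prodVec (n := n) (p := Q.pJ) (κ' := ((m + 1 : ℕ) : SmoothFn Q.dom) + 1) fT' q
  rw [← hφu] at fu
  rw [← hφv] at fv
  have hS := h.splitM hQ hn hφ
  have hB := hS.modBoxPow hQ hn hnt (-((m : ℝ) + 1)) (q + 1)
  have hw : algebraMap ℝ (SmoothFn Q.dom) (-((m : ℝ) + 1)) = -((m + 1 : ℕ) : SmoothFn Q.dom) := by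
    simp
  have hc : ∀ (r : SmoothFn Q.dom) (x : altModule (TIdx n) (SmoothFn Q.dom)),
      (tcalc Q.alg).cY • r • x = r • (tcalc Q.alg).cY • x := fun r x =>
    OpCalc.smul_vec ((tcalc Q.alg).c_smul _ r) x
  rw [hw, boxPow_real_smul, split, hc] at hB
  have rX : ∀ z ∈ Q.dom, ((q : ℝ) + 1) * ((n : ℝ) - 2 * (m + 1) + 2) / n * schoutenTrace Q.comp z
      = evalAt z (((q : SmoothFn Q.dom) + 1)
        * ((n : SmoothFn Q.dom) - 2 * ((m + 1 : ℕ) : SmoothFn Q.dom) + 2) * Q.pJ) := fun z hz => by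
    simp only [schoutenTrace_eq hn hz, map_mul, map_add, map_sub, map_natCast, map_one, map_ofNat]
    push_cast
    field_simp
  have r1 : ∀ z ∈ Q.dom, (n : ℝ) - 2 * (m + 1) - 2 * (q + 1) = evalAt z ((n : SmoothFn Q.dom)
      - 2 * ((m + 1 : ℕ) : SmoothFn Q.dom) - 2 * ((q : SmoothFn Q.dom) + 1)) := fun z hz => by
    simp [map_ofNat]
  have r2 : ∀ z ∈ Q.dom, (n : ℝ) - 2 * (m + 1) = evalAt z ((n : SmoothFn Q.dom)
      - 2 * ((m + 1 : ℕ) : SmoothFn Q.dom)) := fun z hz => by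
    simp [map_ofNat]
  have eZ := (((hu'.coD hQ hn).extD.smul r1).add ((hv'.extD.coD hQ hn).smul r2)).injZ
    (((fT fu).smul _).add ((fT' fv).smul _)) y hy
  have eY := (hu'.coD hQ hn).injY (fu.cod hκ) hy
  have eX := (((hu'.coD hQ hn).extD.add (hu'.fmul rX)).coD hQ hn).injX
    (((fT fu).add (fu.smul _)).cod hκ) hy
  funext a A
  -- The power of `σ` is trivial in this scale.
  simp only [opL, scaleDensity, one_pow, inv_one, one_mul, hB y hy, Pi.add_apply, Pi.smul_apply,
    dδ, δd, eY, eZ, eX]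
  simp only [Submodule.coe_smul_of_tower, Submodule.coe_add, Pi.add_apply,
    Pi.smul_apply, map_smul, map_add, map_mul, map_neg, map_sub, map_natCast, map_one, map_ofNat,
    smul_eq_mul, OpCalc.cY]
  push_cast
  ring

end PatchMetric

/-! ## Manifolds -/

section Manifold

variable {n : ℕ} {M : Type*} [TopologicalSpace M] [ChartedSpace (EuclideanSpace ℝ (Fin n)) M]
  {e : OpenPartialHomeomorph M (EuclideanSpace ℝ (Fin n))}

lemma mdifferentiable_of_mem_maximalAtlas (he : e ∈ IsManifold.maximalAtlas (𝓡 n) ∞ M) :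
    e.MDifferentiable (𝓡 n) (𝓡 n) :=
  ⟨(contMDiffOn_of_mem_maximalAtlas he).mdifferentiableOn (by simp),
    (contMDiffOn_symm_of_mem_maximalAtlas he).mdifferentiableOn (by simp)⟩

/-- The derivative of the inverse chart is an isomorphism onto the tangent space, so a null vector
of the Gram matrix would give a tangent vector orthogonal to everything. -/
lemma PseudoMetric.det_inChart_ne_zero (g : PseudoMetric n M)
    (he : e ∈ IsManifold.maximalAtlas (𝓡 n) ∞ M) {y : EuclideanSpace ℝ (Fin n)}
    (hy : y ∈ e.target) : (g.inChart e y).det ≠ 0 := by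
  intro hdet
  obtain ⟨v, hv, hgv⟩ := Matrix.exists_mulVec_eq_zero_iff.mpr hdet
  let T : EuclideanSpace ℝ (Fin n) ≃L[ℝ] TangentSpace (𝓡 n) (e.symm y) :=
    (mdifferentiable_of_mem_maximalAtlas he).symm.mfderiv hy
  have hT : ∀ w : EuclideanSpace ℝ (Fin n), T w = ∑ a, w a • coordVec e y a := fun w => by
    conv_lhs => rw [← (EuclideanSpace.basisFun (Fin n) ℝ).sum_repr w]
    rw [map_sum]
    refine Finset.sum_congr rfl fun a _ => ?_
    rw [map_smul]
    simp
    rfl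
  have hu : T (WithLp.toLp 2 v) = 0 := by
    refine g.nondegenerate _ _ fun w' => ?_
    obtain ⟨w, rfl⟩ := T.surjective w'
    have hz : ∀ b, ∑ a, v a * g.val (e.symm y) (coordVec e y a) (coordVec e y b) = 0 := fun b => by
      have := congrFun hgv b
      rw [Matrix.mulVec, dotProduct] at this
      refine Eq.trans (Finset.sum_congr rfl fun a _ => ?_) this
      rw [mul_comm, g.symm]
      rfl
    rw [hT w, map_sum]
    refine Finset.sum_eq_zero fun b _ => ?_
    rw [map_smul, hT, map_sum, LinearMap.sum_apply]
    simp only [map_smul, LinearMap.smul_apply, smul_eq_mul, hz, mul_zero]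
  have := T.injective (hu.trans (map_zero T).symm)
  exact hv (by simpa using congrArg WithLp.ofLp this)

/-- The chart expression of a metric. -/
def PseudoMetric.patch (g : PseudoMetric n M) (e : OpenPartialHomeomorph M (EuclideanSpace ℝ (Fin n)))
    (he : e ∈ IsManifold.maximalAtlas (𝓡 n) ∞ M) : PatchMetric n where
  dom := e.target
  isOpen := e.open_target
  comp := g.inChart e
  smooth := g.smooth e he
  symm _ _ _ _ := g.symm _ _ _
  det_ne _ hy := g.det_inChart_ne_zero he hy

lemma DiffForm.inChart_swap {k : ℕ} (f : DiffForm n M k) (y : EuclideanSpace ℝ (Fin n))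
    (a : Fin k → Fin n) (A : Fin 0 → TIdx n) {i j : Fin k} (hij : i ≠ j) :
    f.inChart e y (a ∘ Equiv.swap i j) A = -f.inChart e y a A :=
  (f.val (e.symm y)).map_swap (fun i => coordVec e y (a i)) hij

end Manifold

end
end EinsteinTractor

theorem mainTheorem3 {n : ℕ} (hn : 3 ≤ n)
    {M : Type*} [TopologicalSpace M] [ChartedSpace (EuclideanSpace ℝ (Fin n)) M]
    [IsManifold (𝓡 n) ∞ M]
    (g : PseudoMetric n M) (hg : g.IsEinstein)
    (k m p : ℕ) (hk : k = m + 1) (hp : 1 ≤ p) (hnk : n ≠ 4 ∨ k = 1)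
    (f : DiffForm n M (m + 1))
    (e : OpenPartialHomeomorph M (EuclideanSpace ℝ (Fin n)))
    (he : e ∈ IsManifold.maximalAtlas (𝓡 n) ∞ M)
    (G : LMetric n) (hG : G = g.inChart e)
    (F : LForm n (m + 1)) (hF : F = f.inChart e)
    (u v : LForm n (m + 1))
    (hu : u = opP G k (dδ G) (p - 1) F)
    (hv : v = opP G (k + 1) (δd G) (p - 1) F) :
    ∀ y ∈ e.target,
      opL G p F y
        = (-((p : ℝ) * ((n : ℝ) - 2 * k - 2 * p)) • injY (coD G u)
            + (1 / (k : ℝ)) • injZ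
                (((n : ℝ) - 2 * k - 2 * p) • dδ G u + ((n : ℝ) - 2 * k) • δd G v)
            + injX (coD G
                (dδ G u
                  + fmul (fun z => (p : ℝ) * ((n : ℝ) - 2 * k + 2) / n
                      * schoutenTrace G z) u))) y := by
  subst hk hG hF
  obtain ⟨q, rfl⟩ : ∃ q, p = q + 1 := ⟨p - 1, by omega⟩
  rw [Nat.add_sub_cancel] at hu hv
  let Q := g.patch e he
  -- The chart components are smooth on the target, which is all the algebra requires. They
  -- alternate at every point, also off the target, so the resulting tensor is alternating over the
  -- algebra.
  let φ : (Fin (m + 1) → Fin n) → SmoothFn Q.dom := fun a =>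
    SmoothFn.of (fun y => f.inChart e y a ![]) (f.smooth e he a)
  have hφ : ∀ a i j, i ≠ j → φ (a ∘ Equiv.swap i j) = -φ a := fun a i j hij =>
    SmoothFn.ext fun y => (f.inChart_swap y a ![] hij).trans (map_neg (evalAt y) (φ a)).symm
  have key := PatchMetric.opL_eq (Q := Q) (f := f.inChart e) (hg e he) hn
    (φ := ⟨Fock.zext (m + 1) φ, Fock.isAlt_zext hφ⟩)
    (fun y hy a A => by
      simp only [Fock.zext_zi]
      rfl)
    (Fock.isForm_zext hφ) hnk q hu hv
  push_cast
  exact key
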